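/- **Setting.** Let $n,m\ge 1$ and consider the system $x_{t+1}=Ax_t+Bu_t$ with $A\in\mathbb R^{n\times n}$ invertible, $B\in\mathbb R^{n\times m}$, $(A,B)$ stabilizable, and symmetric positive definite cost matrices $Q\in\mathbb R^{n\times n}$, $R\in\mathbb R^{m\times m}$. The initial state is drawn from a distribution $\mathcal D$ with $\mathbb E[x_0]=0$, $\mathbb E[x_0x_0^\top]=\Sigma_0\succ0$ and $\|x_0\|^2\le C_m$ almost surely. $\|\cdot\|$ is the spectral norm of matrices (and the Euclidean norm of vectors), $\kappa_X=\|X\|\|X^{-1}\|$, and $\|X\|_*^2=\sup_{z\ne0}\frac{z^\top X^\top P^*Xz}{z^\top P^*z}$. Let $$\mathcal R(P)=Q+A^\top\bigl(P-PB(R+B^\top PB)^{-1}B^\top P\bigr)A ,$$ let $P^*$ be the positive definite solution of $P=\mathcal R(P)$, let $K^*=(R+B^\top P^*B)^{-1}B^\top P^*A$ and $A_K^*=A-BK^*$. Fix $Q_N\succeq P^*$ and $\sigma>0$. For a horizon $N$ let $P^*_N=Q_N$, $P^*_t=\mathcal R(P^*_{t+1})$ and $K^*_t=(R+B^\top P^*_{t+1}B)^{-1}B^\top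 P^*_{t+1}A$. **Algorithm.** For $h=N-1,\dots,0$: choose an initial gain $K_{h,0}$; for $t=0,\dots,T_h-1$ draw independently $x_0\sim\mathcal D$ and $\eta\sim\mathcal N(0,I_m)$ (one sample), run the system from $x_0$ with $u_0=-K_{h,t}x_0+\sigma\eta$ and $u_i=-\widetilde K_{h+i}x_i$ for $i\ge1$, observe $$Q_h(x_0,u_0)=\sum_{i=0}^{N-h-1}\bigl(x_i^\top Qx_i+u_i^\top Ru_i\bigr)+x_{N-h}^\top Q_Nx_{N-h},$$ and set $K_{h,t+1}=K_{h,t}+\alpha_{h,t}\frac1\sigma Q_h(x_0,u_0)\,\eta x_0^\top$; finally put $\widetilde K_h=K_{h,T_h}$. The output is $\widetilde K_0$. The initial gains are given by a measurable rule $K_{h,0}=\mathrm{init}_h(\widetilde K_{h+1},\dots,\widetilde K_{N-1})$ with $\|K_{h,0}\|\le\kappa(1+\|\widetilde K_{h+1}\|)$ (with $\widetilde K_N:=0$) for a constant $\kappa$; e.g. $K_{h,0}=0$ or $K_{h,0}=\widetilde K_{h+1}$. **Parameters.** Let $\varepsilon,\zeta\in(0,1)$ and let $N=N(\varepsilon)$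 be the least integer $\ge1$ with $$N\ \ge\ \frac12\cdot\frac{\log\Bigl(\frac{2\|Q_N-P^*\|_*\,\kappa_{P^*}\,\|A_K^*\|\,\|B\|}{\varepsilon\,\lambda_{\min}(R)}\Bigr)}{\log\bigl(1/\|A_K^*\|_*\bigr)}+1 ,$$ where $\log 0=-\infty$. Put $a=\frac12\sigma_{\min}(Q)$, $\varphi=\max_{0\le t\le N-1}\|A-BK_t^*\|$, $p=\max_{1\le t\le N}\|P^*_t\|$, $C_1=\varphi\|B\|/\lambda_{\min}(R)$, $C_3=2\max_{1\le t\le N}\|R+B^\top(P_t^*+aI)B\|$, $\mu=4\sigma_{\min}(\Sigma_0)\sigma_{\min}(R)$, $L=C_3\|\Sigma_0\|$; $\varsigma_{0,\varepsilon}=\varepsilon/4$ and, for $h\ge1$, $$\varsigma_{h,\varepsilon}=\min\Bigl\{\sqrt{\tfrac a{C_3}\tfrac1N},\ \sqrt{\tfrac a{C_3}\tfrac a{2eNp}},\ \sqrt{\tfrac a{C_3}\tfrac\varepsilon{8eNC_1p}},\ \sqrt{\tfrac\varepsilon{4C_1C_3}}\Bigr\}.$$ With $\widetilde J_h(K)=\mathbb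 E_{x_0\sim\mathcal D}[Q_h(x_0,-Kx_0)]$ let $$\widetilde C_h=\frac{10\zeta^{-1}\widetilde J_h(K_{h,0})+\min_K\widetilde J_h(K)}{\sigma_{\min}(\Sigma_0)\sigma_{\min}(R)},$$ $$\xi_{h,1}=\bigl(\|Q\|+2\|R\|\widetilde C_h+2(p+a)(\|A\|^2+2\|B\|^2\widetilde C_h)\bigr)C_m^{3/2},\qquad \xi_{2}=2\bigl(\|R\|+2(p+a)\|B\|^2\bigr)C_m^{1/2},$$ $$\xi_{h,3}=\tfrac1{\sigma^2}\xi_{h,1}^2m+2\xi_{h,1}\xi_{2}m(m+2)+\sigma^2\xi_{2}^2m(m+2)(m+4),$$ $$\theta_h=\max\Bigl\{2,\frac{2L\xi_{h,3}}{\mu^2\widetilde J_h(K_{h,0})}\Bigr\},\qquad \alpha_{h,t}=\frac2\mu\,\frac1{t+\theta_h},\qquad T_h=\Bigl\lceil\frac{40}{7\mu\varsigma_{h,\varepsilon}^2\zeta}\,\theta_h\,\widetilde J_h(K_{h,0})\Bigr\rceil .$$ **Claim.** There is a constant $C>0$, depending only on $A,B,Q,R,Q_N,\Sigma_0,C_m,\sigma,\kappa$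 (and $n,m$), such that for all $\varepsilon\in(0,1)$, all $\mathcal D$ and all initialization rules as above: 1. for every $\zeta\in(0,1)$, with probability at least $1-N\zeta$ one has both $$\|\widetilde K_0-K^*\|\le\varepsilon\qquad\text{and}\qquad\sum_{h=0}^{N-1}T_h\le C\,\zeta^{-3}\,\varepsilon^{-2};$$ 2. for every $\delta\in(0,1)$, if the algorithm is run with $\zeta=\delta/N$, then with probability at least $1-\delta$ one has both $$\|\widetilde K_0-K^*\|\le\varepsilon\qquad\text{and}\qquad\sum_{h=0}^{N-1}T_h\le C\,\delta^{-3}\,\bigl(1+\log(1/\varepsilon)\bigr)^3\,\varepsilon^{-2}.$$ In particular $\sum_{h=0}^{N-1}T_h=\widetilde{\mathcal O}(\varepsilon^{-2})$ at any fixed confidence level, and the exponent $2$ does not depend on the problem data. -/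

import Mathlib

open MeasureTheory ProbabilityTheory
open scoped Matrix

noncomputable section

/-! Matrix quantities -/

open scoped Matrix.Norms.L2Operator in
/-- The spectral norm (operator 2-norm) of a real matrix. -/
def specNorm {p q : ℕ} (M : Matrix (Fin p) (Fin q) ℝ) : ℝ := ‖M‖

/-- The smallest (real) eigenvalue. -/
def lambdaMin {p : ℕ} (M : Matrix (Fin p) (Fin p) ℝ) : ℝ := sInf (spectrum ℝ M)

/-- The smallest singular value of a square matrix. -/
def sigmaMin {p : ℕ} (M : Matrix (Fin p) (Fin p) ℝ) : ℝ := √(lambdaMin (Mᵀ * M))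

/-- The condition number `‖M‖ ‖M⁻¹‖`. -/
def condNumber {p : ℕ} (M : Matrix (Fin p) (Fin p) ℝ) : ℝ := specNorm M * specNorm M⁻¹

/-- The `W`-induced norm of `X`, for `W` positive definite:
`‖X‖_W² = sup_{z ≠ 0} (zᵀ Xᵀ W X z) / (zᵀ W z)`. -/
def inducedNorm {p : ℕ} (W X : Matrix (Fin p) (Fin p) ℝ) : ℝ :=
  √(⨆ z : {z : Fin p → ℝ // z ≠ 0},
    ((X *ᵥ z.1) ⬝ᵥ (W *ᵥ (X *ᵥ z.1))) / (z.1 ⬝ᵥ (W *ᵥ z.1)))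

/-- `(A, B)` is stabilizable: some gain `K` makes the spectral radius of `A - B K` less than one
(eigenvalues are taken in `ℂ`). -/
def IsStabilizable {n m : ℕ} (A : Matrix (Fin n) (Fin n) ℝ) (B : Matrix (Fin n) (Fin m) ℝ) :
    Prop :=
  ∃ K : Matrix (Fin m) (Fin n) ℝ,
    spectralRadius ℂ ((A - B * K).map (fun r : ℝ => (r : ℂ))) < 1

/-! The regulator problem -/

/-- The numerical data of the problem: the system matrices `A`, `B`, the cost matrices `Q`, `R`,
the terminal cost matrix `QN`, the covariance `Sigma0` of the initial state, the bound `Cm` on the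
squared norm of the initial state, and the standard deviation `sigma` of the exploration noise. -/
structure LQR (n m : ℕ) where
  A : Matrix (Fin n) (Fin n) ℝ
  B : Matrix (Fin n) (Fin m) ℝ
  Q : Matrix (Fin n) (Fin n) ℝ
  R : Matrix (Fin m) (Fin m) ℝ
  QN : Matrix (Fin n) (Fin n) ℝ
  Sigma0 : Matrix (Fin n) (Fin n) ℝ
  Cm : ℝ
  sigma : ℝ

namespace LQR

/-- The Riccati operator. -/
def riccati {n m : ℕ} (S : LQR n m) (P : Matrix (Fin n) (Fin n) ℝ) : Matrix (Fin n) (Fin n) ℝ :=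
  S.Q + S.Aᵀ * (P - P * S.B * (S.R + S.Bᵀ * P * S.B)⁻¹ * S.Bᵀ * P) * S.A

/-- The gain `(R + Bᵀ P B)⁻¹ Bᵀ P A`. -/
def gain {n m : ℕ} (S : LQR n m) (P : Matrix (Fin n) (Fin n) ℝ) : Matrix (Fin m) (Fin n) ℝ :=
  (S.R + S.Bᵀ * P * S.B)⁻¹ * S.Bᵀ * P * S.A

/-- `P` is a positive definite solution of the algebraic Riccati equation. -/
def IsARESolution {n m : ℕ} (S : LQR n m) (P : Matrix (Fin n) (Fin n) ℝ) : Prop :=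
  P.PosDef ∧
    P = S.Aᵀ * P * S.A
      - S.Aᵀ * P * S.B * (S.R + S.Bᵀ * P * S.B)⁻¹ * S.Bᵀ * P * S.A + S.Q

/-- The law `D` of the initial state is a probability measure on `ℝⁿ` with mean zero and
covariance `Sigma0`, and `‖x₀‖² ≤ Cm` almost surely. -/
def IsInitialLaw {n m : ℕ} (S : LQR n m) (D : Measure (Fin n → ℝ)) : Prop :=
  IsProbabilityMeasure D ∧ (∀ i, ∫ x, x i ∂D = 0) ∧
    (∀ i j, ∫ x, x i * x j ∂D = S.Sigma0 i j) ∧ (∀ᵐ x ∂D, x ⬝ᵥ x ≤ S.Cm)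

/-- The solution `P*_t`, `t ≤ N`, of the Riccati difference equation
`P*_t = ℛ(P*_{t+1})`, `P*_N = QN`. -/
def rde {n m : ℕ} (S : LQR n m) (N t : ℕ) : Matrix (Fin n) (Fin n) ℝ :=
  S.riccati^[N - t] S.QN

/-- The optimal finite-horizon gain `K*_t`, `t < N`. -/
def optGain {n m : ℕ} (S : LQR n m) (N t : ℕ) : Matrix (Fin m) (Fin n) ℝ :=
  S.gain (S.rde N (t + 1))

/-! Rollouts and surrogate costs. `Kt t` is the frozen gain at step `t`. -/

/-- The state `x_i` of the trajectory started at stage `h` in `x0`, with first input `u0` and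
inputs `u_i = - Kt (h + i) x_i` for `i ≥ 1`. -/
def rollout {n m : ℕ} (S : LQR n m) (Kt : ℕ → Matrix (Fin m) (Fin n) ℝ) (h : ℕ)
    (x0 : Fin n → ℝ) (u0 : Fin m → ℝ) : ℕ → Fin n → ℝ
  | 0 => x0
  | i + 1 =>
    S.A *ᵥ rollout S Kt h x0 u0 i +
      S.B *ᵥ (if i = 0 then u0 else -(Kt (h + i) *ᵥ rollout S Kt h x0 u0 i))

/-- The input `u_i` along the same trajectory. -/
def rolloutInput {n m : ℕ} (S : LQR n m) (Kt : ℕ → Matrix (Fin m) (Fin n) ℝ) (h : ℕ)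
    (x0 : Fin n → ℝ) (u0 : Fin m → ℝ) (i : ℕ) : Fin m → ℝ :=
  if i = 0 then u0 else -(Kt (h + i) *ᵥ S.rollout Kt h x0 u0 i)

/-- The observed cost `Q_h(x0, u0)`: `N - h` stage costs followed by the terminal cost. -/
def costToGo {n m : ℕ} (S : LQR n m) (N : ℕ) (Kt : ℕ → Matrix (Fin m) (Fin n) ℝ) (h : ℕ)
    (x0 : Fin n → ℝ) (u0 : Fin m → ℝ) : ℝ :=
  (∑ i ∈ Finset.range (N - h),
    (S.rollout Kt h x0 u0 i ⬝ᵥ (S.Q *ᵥ S.rollout Kt h x0 u0 i)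
      + S.rolloutInput Kt h x0 u0 i ⬝ᵥ (S.R *ᵥ S.rolloutInput Kt h x0 u0 i)))
    + S.rollout Kt h x0 u0 (N - h) ⬝ᵥ (S.QN *ᵥ S.rollout Kt h x0 u0 (N - h))

/-- The surrogate cost `J̃_h(K) = E_{x₀ ∼ D} [Q_h(x₀, - K x₀)]`. -/
def surrogate {n m : ℕ} (S : LQR n m) (D : Measure (Fin n → ℝ)) (N : ℕ)
    (Kt : ℕ → Matrix (Fin m) (Fin n) ℝ) (h : ℕ) (K : Matrix (Fin m) (Fin n) ℝ) : ℝ :=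
  ∫ x, S.costToGo N Kt h x (-(K *ᵥ x)) ∂D

/-- The minimal surrogate cost `J̃_h(K̃*_h) = min_K J̃_h(K)`. -/
def surrogateMin {n m : ℕ} (S : LQR n m) (D : Measure (Fin n → ℝ)) (N : ℕ)
    (Kt : ℕ → Matrix (Fin m) (Fin n) ℝ) (h : ℕ) : ℝ :=
  ⨅ K : Matrix (Fin m) (Fin n) ℝ, S.surrogate D N Kt h K

/-! Parameters of the algorithm -/

/-- The horizon `N`: the least integer `≥ 1` which is at least
`(1/2) log (2 ‖QN - P*‖_* κ(P*) ‖A - B K*‖ ‖B‖ / (ε λ_min(R))) / log (1 / ‖A - B K*‖_*) + 1`.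
(If `B = 0` or `QN = P*` the first logarithm stands for `-∞`; here it is `0`,
and both readings give `N = 1`.) -/
def horizon {n m : ℕ} (S : LQR n m) (P : Matrix (Fin n) (Fin n) ℝ) (ε : ℝ) : ℕ :=
  max 1 ⌈1 / 2 *
    (Real.log (2 * inducedNorm P (S.QN - P) * condNumber P * specNorm (S.A - S.B * S.gain P)
        * specNorm S.B / (ε * lambdaMin S.R))
      / Real.log (1 / inducedNorm P (S.A - S.B * S.gain P))) + 1⌉₊

/-- `a = σ_min(Q) / 2`. -/
def ca {n m : ℕ} (S : LQR n m) : ℝ := sigmaMin S.Q / 2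

/-- `φ = max_{0 ≤ t ≤ N-1} ‖A - B K*_t‖`. -/
def phi {n m : ℕ} (S : LQR n m) (N : ℕ) : ℝ :=
  ⨆ t : Fin N, specNorm (S.A - S.B * S.optGain N t)

/-- `p = max_{1 ≤ t ≤ N} ‖P*_t‖`; this is `‖QN‖` whenever `P*_t ⪯ QN` for all `t`. -/
def pMax {n m : ℕ} (S : LQR n m) (N : ℕ) : ℝ :=
  ⨆ t : Fin N, specNorm (S.rde N (t + 1))

/-- `C₁ = φ ‖B‖ / λ_min(R)`. -/
def c1 {n m : ℕ} (S : LQR n m) (N : ℕ) : ℝ := S.phi N * specNorm S.B / lambdaMin S.R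

/-- `C₃ = 2 max_{1 ≤ t ≤ N} ‖R + Bᵀ (P*_t + a I) B‖`; this is `2 ‖R + Bᵀ (QN + a I) B‖` whenever
`P*_t ⪯ QN` for all `t`. -/
def c3 {n m : ℕ} (S : LQR n m) (N : ℕ) : ℝ :=
  2 * ⨆ t : Fin N,
    specNorm (S.R + S.Bᵀ * (S.rde N (t + 1) + S.ca • (1 : Matrix (Fin n) (Fin n) ℝ)) * S.B)

/-- The accuracy `ς_{h,ε}` demanded of the inner loop at stage `h`. (The divisor `C₁` vanishes
only if `B = 0`; then the horizon is `1` and only `h = 0` occurs.) -/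
def tol {n m : ℕ} (S : LQR n m) (N : ℕ) (ε : ℝ) (h : ℕ) : ℝ :=
  if h = 0 then ε / 4
  else
    min (min √(S.ca / S.c3 N * (1 / N))
        √(S.ca / S.c3 N * (S.ca / (2 * Real.exp 1 * N * S.pMax N))))
      (min √(S.ca / S.c3 N * (ε / (8 * Real.exp 1 * N * S.c1 N * S.pMax N)))
        √(ε / (4 * S.c1 N * S.c3 N)))

/-- `μ = 4 σ_min(Σ₀) σ_min(R)`. -/
def mu {n m : ℕ} (S : LQR n m) : ℝ := 4 * sigmaMin S.Sigma0 * sigmaMin S.R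

/-- `L = C₃ ‖Σ₀‖`. -/
def smoothL {n m : ℕ} (S : LQR n m) (N : ℕ) : ℝ := S.c3 N * specNorm S.Sigma0

/-- `C̃_h = (10 ζ⁻¹ J̃_h(K_{h,0}) + J̃_h(K̃*_h)) / (σ_min(Σ₀) σ_min(R))`. -/
def cTilde {n m : ℕ} (S : LQR n m) (D : Measure (Fin n → ℝ)) (N : ℕ) (ζ : ℝ)
    (Kt : ℕ → Matrix (Fin m) (Fin n) ℝ) (h : ℕ) (K0 : Matrix (Fin m) (Fin n) ℝ) : ℝ :=
  (10 * ζ⁻¹ * S.surrogate D N Kt h K0 + S.surrogateMin D N Kt h)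
    / (sigmaMin S.Sigma0 * sigmaMin S.R)

def xi1 {n m : ℕ} (S : LQR n m) (D : Measure (Fin n → ℝ)) (N : ℕ) (ζ : ℝ)
    (Kt : ℕ → Matrix (Fin m) (Fin n) ℝ) (h : ℕ) (K0 : Matrix (Fin m) (Fin n) ℝ) : ℝ :=
  (specNorm S.Q + 2 * specNorm S.R * S.cTilde D N ζ Kt h K0
    + 2 * (S.pMax N + S.ca)
      * (specNorm S.A ^ 2 + 2 * specNorm S.B ^ 2 * S.cTilde D N ζ Kt h K0)) * √S.Cm ^ 3

def xi2 {n m : ℕ} (S : LQR n m) (N : ℕ) : ℝ :=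
  2 * (specNorm S.R + 2 * (S.pMax N + S.ca) * specNorm S.B ^ 2) * √S.Cm

def xi3 {n m : ℕ} (S : LQR n m) (D : Measure (Fin n → ℝ)) (N : ℕ) (ζ : ℝ)
    (Kt : ℕ → Matrix (Fin m) (Fin n) ℝ) (h : ℕ) (K0 : Matrix (Fin m) (Fin n) ℝ) : ℝ :=
  1 / S.sigma ^ 2 * S.xi1 D N ζ Kt h K0 ^ 2 * m
    + 2 * S.xi1 D N ζ Kt h K0 * S.xi2 N * m * (m + 2)
    + S.sigma ^ 2 * S.xi2 N ^ 2 * m * (m + 2) * (m + 4)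

/-- `θ_h = max {2, 2 L ξ_{h,3} / (μ² J̃_h(K_{h,0}))}`. -/
def theta {n m : ℕ} (S : LQR n m) (D : Measure (Fin n → ℝ)) (N : ℕ) (ζ : ℝ)
    (Kt : ℕ → Matrix (Fin m) (Fin n) ℝ) (h : ℕ) (K0 : Matrix (Fin m) (Fin n) ℝ) : ℝ :=
  max 2 (2 * S.smoothL N * S.xi3 D N ζ Kt h K0 / (S.mu ^ 2 * S.surrogate D N Kt h K0))

/-- The step size `α_{h,t} = (2 / μ) / (t + θ_h)`. -/
def stepSize {n m : ℕ} (S : LQR n m) (D : Measure (Fin n → ℝ)) (N : ℕ) (ζ : ℝ)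
    (Kt : ℕ → Matrix (Fin m) (Fin n) ℝ) (h : ℕ) (K0 : Matrix (Fin m) (Fin n) ℝ) (t : ℕ) : ℝ :=
  2 / S.mu * (1 / (t + S.theta D N ζ Kt h K0))

/-- The number of inner iterations
`T_h = ⌈40 / (7 μ ς_{h,ε}² ζ) * θ_h * J̃_h(K_{h,0})⌉`. -/
def numIters {n m : ℕ} (S : LQR n m) (D : Measure (Fin n → ℝ)) (N : ℕ) (ε ζ : ℝ)
    (Kt : ℕ → Matrix (Fin m) (Fin n) ℝ) (h : ℕ) (K0 : Matrix (Fin m) (Fin n) ℝ) : ℕ :=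
  ⌈40 / (7 * S.mu * S.tol N ε h ^ 2 * ζ) * S.theta D N ζ Kt h K0 * S.surrogate D N Kt h K0⌉₊

/-! The algorithm -/

/-- The one-point gradient estimate `-(1/σ) Q_h(x₀, -K x₀ + σ η) η x₀ᵀ`. -/
def gradEst {n m : ℕ} (S : LQR n m) (N : ℕ) (Kt : ℕ → Matrix (Fin m) (Fin n) ℝ) (h : ℕ)
    (K : Matrix (Fin m) (Fin n) ℝ) (x0 : Fin n → ℝ) (η : Fin m → ℝ) :
    Matrix (Fin m) (Fin n) ℝ :=
  (-(1 / S.sigma) * S.costToGo N Kt h x0 (-(K *ᵥ x0) + S.sigma • η)) • Matrix.vecMulVec η x0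

/-- The iterates `K_{h,t}` of the inner loop at stage `h`, started at `K0`, when the `t`-th
sample `(x₀, η)` is `z t`. -/
def innerIter {n m : ℕ} (S : LQR n m) (D : Measure (Fin n → ℝ)) (N : ℕ) (ζ : ℝ)
    (Kt : ℕ → Matrix (Fin m) (Fin n) ℝ) (h : ℕ) (K0 : Matrix (Fin m) (Fin n) ℝ)
    (z : ℕ → (Fin n → ℝ) × (Fin m → ℝ)) : ℕ → Matrix (Fin m) (Fin n) ℝ
  | 0 => K0
  | t + 1 =>
    innerIter S D N ζ Kt h K0 z t - S.stepSize D N ζ Kt h K0 t •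
      S.gradEst N Kt h (innerIter S D N ζ Kt h K0 z t) (z t).1 (z t).2

/-- The table of gains after the first `k` passes of the outer loop (stages `N-1, …, N-k`). Gains
which are not yet computed are recorded as `0`. The initial gain `K_{h,0}` of stage `h` is
`init h Kt`, where `Kt` is the table before stage `h`; the samples used at stage `h` are `z h`. -/
def table {n m : ℕ} (S : LQR n m) (D : Measure (Fin n → ℝ)) (N : ℕ) (ε ζ : ℝ)
    (init : ℕ → (ℕ → Matrix (Fin m) (Fin n) ℝ) → Matrix (Fin m) (Fin n) ℝ)
    (z : ℕ → ℕ → (Fin n → ℝ) × (Fin m → ℝ)) : ℕ → ℕ → Matrix (Fin m) (Fin n) ℝ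
  | 0 => fun _ => 0
  | k + 1 =>
    Function.update (table S D N ε ζ init z k) (N - 1 - k)
      (S.innerIter D N ζ (table S D N ε ζ init z k) (N - 1 - k)
        (init (N - 1 - k) (table S D N ε ζ init z k)) (z (N - 1 - k))
        (S.numIters D N ε ζ (table S D N ε ζ init z k) (N - 1 - k)
          (init (N - 1 - k) (table S D N ε ζ init z k))))

/-- The output `K̃_0` of the algorithm. -/
def output {n m : ℕ} (S : LQR n m) (D : Measure (Fin n → ℝ)) (N : ℕ) (ε ζ : ℝ)
    (init : ℕ → (ℕ → Matrix (Fin m) (Fin n) ℝ) → Matrix (Fin m) (Fin n) ℝ)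
    (z : ℕ → ℕ → (Fin n → ℝ) × (Fin m → ℝ)) : Matrix (Fin m) (Fin n) ℝ :=
  S.table D N ε ζ init z N 0

/-- The number `T_h` of samples (simulated trajectories) used at stage `h < N`. -/
def stageSamples {n m : ℕ} (S : LQR n m) (D : Measure (Fin n → ℝ)) (N : ℕ) (ε ζ : ℝ)
    (init : ℕ → (ℕ → Matrix (Fin m) (Fin n) ℝ) → Matrix (Fin m) (Fin n) ℝ)
    (z : ℕ → ℕ → (Fin n → ℝ) × (Fin m → ℝ)) (h : ℕ) : ℕ :=
  S.numIters D N ε ζ (S.table D N ε ζ init z (N - 1 - h)) h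
    (init h (S.table D N ε ζ init z (N - 1 - h)))

/-- The total number of samples `∑_{h=0}^{N-1} T_h`. -/
def totalSamples {n m : ℕ} (S : LQR n m) (D : Measure (Fin n → ℝ)) (N : ℕ) (ε ζ : ℝ)
    (init : ℕ → (ℕ → Matrix (Fin m) (Fin n) ℝ) → Matrix (Fin m) (Fin n) ℝ)
    (z : ℕ → ℕ → (Fin n → ℝ) × (Fin m → ℝ)) : ℕ :=
  ∑ h ∈ Finset.range N, S.stageSamples D N ε ζ init z h

end LQR

/-- An admissible initialization rule with growth constant `κ`: a measurable function of the gains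
computed so far, with `‖K_{h,0}‖ ≤ κ (1 + ‖K̃_{h+1}‖)`, where `K̃_N` is read as `0`. Constant
initializations and the warm start `K_{h,0} = K̃_{h+1}` are of this kind. -/
def IsInitRule {n m : ℕ} (κ : ℝ)
    (init : ℕ → (ℕ → Matrix (Fin m) (Fin n) ℝ) → Matrix (Fin m) (Fin n) ℝ) : Prop :=
  ∀ h, (∀ i j, Measurable fun Kt : ℕ → Fin m → Fin n → ℝ =>
      init h (fun t => Matrix.of (Kt t)) i j) ∧
    ∀ Kt, specNorm (init h Kt) ≤ κ * (1 + specNorm (Kt (h + 1)))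

/-- The samples `z h t = (x₀, η_{h,t})`, over all stages `h` and iterations `t`, are independent
random variables with law `D ⊗ 𝒩(0, I_m)`. -/
def IsSampleArray {n m : ℕ} {Ω : Type*} [MeasurableSpace Ω] (Pr : Measure Ω)
    (D : Measure (Fin n → ℝ)) (z : ℕ → ℕ → Ω → (Fin n → ℝ) × (Fin m → ℝ)) : Prop :=
  (∀ h t, Measurable (z h t)) ∧
    (∀ h t, Pr.map (z h t) = D.prod (Measure.pi fun _ : Fin m => gaussianReal 0 1)) ∧
    iIndepFun (fun p : ℕ × ℕ => z p.1 p.2) Pr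

end

/-! The algorithm is approximate dynamic programming, backwards in time. Fix stage $h$ and freeze
the later gains; let $P$ be their cost-to-go matrix at $h+1$, $W=R+B^\top PB$ and $G$ = `S.gain P`.
Completing the square (`stageMat_eq`) gives exactly $\widetilde J_h(K)=\min\widetilde J_h+\mathbb
E\,\|(K-G)x_0\|_W^2$. So every inner problem is a strongly convex quadratic with a known minimizer,
and the Lyapunov function of the inner loop is the `excess` $V(K)=\mathbb E\,\|(K-G)x_0\|_W^2$.

Inner loop. The observed cost is a quadratic polynomial in the noise $\eta$. By parity only its
linear term correlates with $\eta$, so the one-point estimate is exactly unbiased, and gradient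
domination with constant $\mu$ yields one-step contraction (`lintegral_step_le`). The variance is
controlled only for bounded $K$, that is while $V\le 10J/\zeta$ with $J=\widetilde J_h(K_{h,0})$.
There the choice of $\theta_h$ gives $\mathbb E V_{t+1}\le(1-\frac2{t+\theta})V_t+\theta
J/(t+\theta)^2$. The process is stopped on leaving this region (`measure_markovIter_gt_le`). Without
using the contraction, $\mathbb EV\le 3J$, so escape has probability at most $3\zeta/10$. With it,
the unstopped mass satisfies $\mathbb EV\le\theta J/(T+\theta)$, and Markov's inequality with the
prescribed $T_h$ costs at most $7\zeta/10$. Hence a stage fails with probability at most $\zeta$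
once the later ones are accurate (`measure_stage_le`). Each stage uses samples independent of the
gains computed before it, so $N$ stages fail with probability at most $N\zeta$
(`measure_not_accurate_le`).

Outer loop. Cost errors are quadratic in gain errors. Measured relative to the optimal cost $P^*_h$,
a stage with tolerance $\varsigma$ loses a factor $\eta=C_3\varsigma^2/(4a)$, and since $\mathcal R$
is monotone with $\mathcal R(sP)\preceq s\mathcal R(P)$ for $s\ge1$, these losses add up: the
cost-to-go is at most $(1+(N-h)\eta)P^*_h$ (`costMat_le_mul_rde`). The gain is Lipschitz in $P$
(`gain_sub_gain`). So $\widetilde K_0$ is within $\varepsilon/4$ (its own inner error) plus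
$\varepsilon/4$ (propagated error) of $K^*_0$, and $K^*_0$ is within $\varepsilon/2$ of $K^*$ by the
geometric convergence of the Riccati iteration (`specNorm_optGain_horizon_sub_le`).

Sample count. $p$, $C_1$, $C_3$ and the initial costs are bounded uniformly in the horizon, and
$T_h$ is of order $\zeta^{-3}\varsigma_h^{-2}$: one $\zeta^{-1}$ from Markov's inequality, two from
the squared bound on the admissible gains. Only stage $0$ needs tolerance of order $\varepsilon$.
The other stages need only $\sqrt{\varepsilon/N}$ and cost $N^2/\varepsilon$ together, which is
$O(\varepsilon^{-2})$ because $N=O(1+\log(1/\varepsilon))$. This is why the exponent is $2$ whatever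
the data. With $\zeta=\delta/N$ the factor $\zeta^{-3}$ becomes $N^3\delta^{-3}$. -/

noncomputable section

/-! ### Quadratic forms -/

/-- The quadratic form `xᵀ M x`. -/
def qf {p : ℕ} (M : Matrix (Fin p) (Fin p) ℝ) (x : Fin p → ℝ) : ℝ := x ⬝ᵥ (M *ᵥ x)

section QuadraticForm

variable {p q : ℕ}

lemma dotProduct_mulVec_comm' (M : Matrix (Fin p) (Fin q) ℝ) (x : Fin p → ℝ) (y : Fin q → ℝ) :
    x ⬝ᵥ (M *ᵥ y) = (Mᵀ *ᵥ x) ⬝ᵥ y := by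
  rw [Matrix.dotProduct_mulVec, Matrix.mulVec_transpose]

lemma dotProduct_mulVec_symm {M : Matrix (Fin p) (Fin p) ℝ} (hM : Mᵀ = M) (x y : Fin p → ℝ) :
    x ⬝ᵥ (M *ᵥ y) = y ⬝ᵥ (M *ᵥ x) := by
  rw [dotProduct_mulVec_comm', hM, dotProduct_comm]

lemma dotProduct_self_nonneg' (x : Fin p → ℝ) : 0 ≤ x ⬝ᵥ x :=
  Finset.sum_nonneg fun i _ => mul_self_nonneg (x i)

lemma dotProduct_self_pos' {x : Fin p → ℝ} (hx : x ≠ 0) : 0 < x ⬝ᵥ x :=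
  (dotProduct_self_nonneg' x).lt_of_ne fun h => hx (dotProduct_self_eq_zero.1 h.symm)

lemma dotProduct_sq_le (x y : Fin p → ℝ) : (x ⬝ᵥ y) ^ 2 ≤ (x ⬝ᵥ x) * (y ⬝ᵥ y) := by
  have := Finset.sum_mul_sq_le_sq_mul_sq Finset.univ x y
  simpa [dotProduct, pow_two] using this

lemma dotProduct_add_self_le (x y : Fin p → ℝ) :
    (x + y) ⬝ᵥ (x + y) ≤ 2 * (x ⬝ᵥ x) + 2 * (y ⬝ᵥ y) := by
  have h := dotProduct_self_nonneg' (x - y)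
  simp only [dotProduct_add, add_dotProduct, dotProduct_sub, sub_dotProduct] at h ⊢
  linarith

lemma qf_add (M N : Matrix (Fin p) (Fin p) ℝ) (x : Fin p → ℝ) :
    qf (M + N) x = qf M x + qf N x := by
  simp [qf, Matrix.add_mulVec, dotProduct_add]

lemma qf_sub (M N : Matrix (Fin p) (Fin p) ℝ) (x : Fin p → ℝ) :
    qf (M - N) x = qf M x - qf N x := by
  simp [qf, Matrix.sub_mulVec, dotProduct_sub]

lemma qf_smul (c : ℝ) (M : Matrix (Fin p) (Fin p) ℝ) (x : Fin p → ℝ) :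
    qf (c • M) x = c * qf M x := by
  simp [qf, Matrix.smul_mulVec]

lemma qf_one (x : Fin p → ℝ) : qf 1 x = x ⬝ᵥ x := by simp [qf]

lemma qf_zero_vec (M : Matrix (Fin p) (Fin p) ℝ) : qf M 0 = 0 := by simp [qf]

lemma qf_congr (X : Matrix (Fin p) (Fin q) ℝ) (M : Matrix (Fin p) (Fin p) ℝ) (x : Fin q → ℝ) :
    qf (Xᵀ * M * X) x = qf M (X *ᵥ x) := by
  simp only [qf, ← Matrix.mulVec_mulVec]
  rw [dotProduct_mulVec_comm', Matrix.transpose_transpose]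

lemma qf_add_vec {M : Matrix (Fin p) (Fin p) ℝ} (hM : Mᵀ = M) (x y : Fin p → ℝ) :
    qf M (x + y) = qf M x + 2 * (x ⬝ᵥ (M *ᵥ y)) + qf M y := by
  simp only [qf, Matrix.mulVec_add, dotProduct_add, add_dotProduct,
    dotProduct_mulVec_symm hM y x]
  ring

lemma qf_smul_vec (M : Matrix (Fin p) (Fin p) ℝ) (c : ℝ) (x : Fin p → ℝ) :
    qf M (c • x) = c ^ 2 * qf M x := by
  simp only [qf, Matrix.mulVec_smul, dotProduct_smul, smul_dotProduct, smul_eq_mul]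
  ring

lemma posSemidef_transpose {M : Matrix (Fin p) (Fin p) ℝ} (hM : M.PosSemidef) : Mᵀ = M := by
  have := hM.isHermitian
  rwa [Matrix.IsHermitian, Matrix.conjTranspose_eq_transpose_of_trivial] at this

lemma posSemidef_iff_qf {M : Matrix (Fin p) (Fin p) ℝ} :
    M.PosSemidef ↔ Mᵀ = M ∧ ∀ x, 0 ≤ qf M x := by
  constructor
  · intro h
    exact ⟨posSemidef_transpose h, fun x => by simpa [qf] using h.dotProduct_mulVec_nonneg x⟩
  · rintro ⟨h, h'⟩
    refine Matrix.PosSemidef.of_dotProduct_mulVec_nonneg ?_ fun x => by simpa [qf] using h' x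
    rwa [Matrix.IsHermitian, Matrix.conjTranspose_eq_transpose_of_trivial]

lemma qf_nonneg {M : Matrix (Fin p) (Fin p) ℝ} (hM : M.PosSemidef) (x : Fin p → ℝ) : 0 ≤ qf M x :=
  (posSemidef_iff_qf.1 hM).2 x

lemma qf_pos {M : Matrix (Fin p) (Fin p) ℝ} (hM : M.PosDef) {x : Fin p → ℝ} (hx : x ≠ 0) :
    0 < qf M x := by
  simpa [qf] using hM.dotProduct_mulVec_pos hx

lemma posSemidef_congr (X : Matrix (Fin p) (Fin q) ℝ) {M : Matrix (Fin p) (Fin p) ℝ}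
    (hM : M.PosSemidef) : (Xᵀ * M * X).PosSemidef := by
  rw [posSemidef_iff_qf]
  refine ⟨?_, fun x => by rw [qf_congr]; exact qf_nonneg hM _⟩
  rw [Matrix.transpose_mul, Matrix.transpose_mul, Matrix.transpose_transpose,
    posSemidef_transpose hM, Matrix.mul_assoc]

/-- The Cauchy-Schwarz inequality for a positive semidefinite form. -/
lemma dotProduct_mulVec_sq_le {M : Matrix (Fin p) (Fin p) ℝ} (hM : M.PosSemidef)
    (x y : Fin p → ℝ) : (x ⬝ᵥ (M *ᵥ y)) ^ 2 ≤ qf M x * qf M y := by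
  have h : ∀ t : ℝ, 0 ≤ qf M y * (t * t) + 2 * (x ⬝ᵥ (M *ᵥ y)) * t + qf M x := by
    intro t
    have := qf_nonneg hM (x + t • y)
    rw [qf_add_vec (posSemidef_transpose hM), qf_smul_vec, Matrix.mulVec_smul,
      dotProduct_smul, smul_eq_mul] at this
    linarith
  have := discrim_le_zero h
  rw [discrim] at this
  linarith

/-- If `c |x|² ≤ xᵀ M x` then `c xᵀ M x ≤ |M x|²`. -/
lemma mul_qf_le_mulVec_sq {M : Matrix (Fin p) (Fin p) ℝ} {c : ℝ} (hc : 0 ≤ c)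
    (h : ∀ x, c * (x ⬝ᵥ x) ≤ qf M x) (x : Fin p → ℝ) :
    c * qf M x ≤ (M *ᵥ x) ⬝ᵥ (M *ᵥ x) := by
  have h1 := h x
  -- Euclidean Cauchy-Schwarz; combined with $c|x|^2\le x^\top Mx$, one factor $x^\top Mx$ cancels.
  have h2 : (qf M x) ^ 2 ≤ (x ⬝ᵥ x) * ((M *ᵥ x) ⬝ᵥ (M *ᵥ x)) := dotProduct_sq_le x (M *ᵥ x)
  have h3 := dotProduct_self_nonneg' x
  have h4 := dotProduct_self_nonneg' (M *ᵥ x)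
  have h0 : 0 ≤ qf M x := (mul_nonneg hc h3).trans h1
  rcases h0.eq_or_lt with h5 | h5
  · rw [← h5, mul_zero]; exact h4
  · have : c * qf M x * qf M x ≤ ((M *ᵥ x) ⬝ᵥ (M *ᵥ x)) * qf M x := by nlinarith
    exact le_of_mul_le_mul_right this h5

end QuadraticForm

/-! ### The spectral norm -/

section SpecNorm

variable {p q r : ℕ}

lemma dotProduct_self_eq_norm_sq (x : Fin p → ℝ) : x ⬝ᵥ x = ‖WithLp.toLp 2 x‖ ^ 2 := by
  rw [EuclideanSpace.norm_sq_eq]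
  simp [dotProduct, pow_two]

open scoped Matrix.Norms.L2Operator in
lemma specNorm_nonneg (M : Matrix (Fin p) (Fin q) ℝ) : 0 ≤ specNorm M := by
  exact norm_nonneg M

lemma specNorm_mul_le (M : Matrix (Fin p) (Fin q) ℝ) (N : Matrix (Fin q) (Fin r) ℝ) :
    specNorm (M * N) ≤ specNorm M * specNorm N := Matrix.l2_opNorm_mul M N

open scoped Matrix.Norms.L2Operator in
lemma specNorm_add_le (M N : Matrix (Fin p) (Fin q) ℝ) :
    specNorm (M + N) ≤ specNorm M + specNorm N := norm_add_le M N

open scoped Matrix.Norms.L2Operator in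
lemma specNorm_sub_le (M N : Matrix (Fin p) (Fin q) ℝ) :
    specNorm (M - N) ≤ specNorm M + specNorm N := norm_sub_le M N

open scoped Matrix.Norms.L2Operator in
lemma specNorm_eq_zero {M : Matrix (Fin p) (Fin q) ℝ} : specNorm M = 0 ↔ M = 0 :=
  norm_eq_zero (a := M)

lemma specNorm_transpose (M : Matrix (Fin p) (Fin q) ℝ) : specNorm Mᵀ = specNorm M := by
  rw [← Matrix.conjTranspose_eq_transpose_of_trivial]
  exact Matrix.l2_opNorm_conjTranspose M

lemma mulVec_sq_le (M : Matrix (Fin p) (Fin q) ℝ) (x : Fin q → ℝ) :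
    (M *ᵥ x) ⬝ᵥ (M *ᵥ x) ≤ specNorm M ^ 2 * (x ⬝ᵥ x) := by
  have h := Matrix.l2_opNorm_mulVec M (WithLp.toLp 2 x)
  rw [dotProduct_self_eq_norm_sq, dotProduct_self_eq_norm_sq, ← mul_pow]
  exact pow_le_pow_left₀ (norm_nonneg _) h 2

open scoped Matrix.Norms.L2Operator in
lemma specNorm_le_of {M : Matrix (Fin p) (Fin q) ℝ} {c : ℝ} (hc : 0 ≤ c)
    (h : ∀ x, (M *ᵥ x) ⬝ᵥ (M *ᵥ x) ≤ c ^ 2 * (x ⬝ᵥ x)) : specNorm M ≤ c := by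
  unfold specNorm
  rw [Matrix.l2_opNorm_def]
  refine ContinuousLinearMap.opNorm_le_bound _ hc fun x => ?_
  have := h x.ofLp
  rw [dotProduct_self_eq_norm_sq, dotProduct_self_eq_norm_sq, ← mul_pow] at this
  exact le_of_sq_le_sq this (mul_nonneg hc (norm_nonneg _))

lemma qf_le_specNorm (M : Matrix (Fin p) (Fin p) ℝ) (x : Fin p → ℝ) :
    qf M x ≤ specNorm M * (x ⬝ᵥ x) := by
  have h1 := dotProduct_sq_le x (M *ᵥ x)
  have h2 := mulVec_sq_le M x
  have h3 := dotProduct_self_nonneg' x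
  refine le_of_sq_le_sq ?_ (mul_nonneg (specNorm_nonneg M) h3)
  calc qf M x ^ 2 ≤ (x ⬝ᵥ x) * ((M *ᵥ x) ⬝ᵥ (M *ᵥ x)) := h1
    _ ≤ (x ⬝ᵥ x) * (specNorm M ^ 2 * (x ⬝ᵥ x)) := mul_le_mul_of_nonneg_left h2 h3
    _ = _ := by ring

/-- A positive semidefinite matrix with `xᵀ M x ≤ c |x|²` has `‖M‖ ≤ c`. -/
lemma specNorm_le_of_qf {M : Matrix (Fin p) (Fin p) ℝ} (hM : M.PosSemidef) {c : ℝ} (hc : 0 ≤ c)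
    (h : ∀ x, qf M x ≤ c * (x ⬝ᵥ x)) : specNorm M ≤ c := by
  refine specNorm_le_of hc fun x => ?_
  set y := M *ᵥ x with hy
  -- Cauchy-Schwarz for the form $M$ itself, as $y^\top y=y^\top Mx$. Thus bounds on the form alone
  -- control the operator norm.
  have h1 : (y ⬝ᵥ y) ^ 2 ≤ qf M y * qf M x := dotProduct_mulVec_sq_le hM y x
  have h2 := h x
  have h3 := h y
  have h4 := dotProduct_self_nonneg' x
  have h5 := dotProduct_self_nonneg' y
  have h6 := qf_nonneg hM x
  have h7 := qf_nonneg hM y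
  rcases h5.eq_or_lt with h8 | h8
  · rw [← h8]; positivity
  · have : (y ⬝ᵥ y) * (y ⬝ᵥ y) ≤ c ^ 2 * (x ⬝ᵥ x) * (y ⬝ᵥ y) := by
      calc (y ⬝ᵥ y) * (y ⬝ᵥ y) = (y ⬝ᵥ y) ^ 2 := by ring
        _ ≤ qf M y * qf M x := h1
        _ ≤ (c * (y ⬝ᵥ y)) * (c * (x ⬝ᵥ x)) := mul_le_mul h3 h2 h6 (by positivity)
        _ = _ := by ring
    exact le_of_mul_le_mul_right this h8

/-- The square of the Frobenius norm. -/
def frobSq (M : Matrix (Fin p) (Fin q) ℝ) : ℝ := ∑ i, M i ⬝ᵥ M i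

lemma frobSq_nonneg (M : Matrix (Fin p) (Fin q) ℝ) : 0 ≤ frobSq M :=
  Finset.sum_nonneg fun _ _ => dotProduct_self_nonneg' _

lemma mulVec_sq_le_frobSq (M : Matrix (Fin p) (Fin q) ℝ) (x : Fin q → ℝ) :
    (M *ᵥ x) ⬝ᵥ (M *ᵥ x) ≤ frobSq M * (x ⬝ᵥ x) := by
  rw [frobSq, Finset.sum_mul]
  refine Finset.sum_le_sum fun i _ => ?_
  have := dotProduct_sq_le (M i) x
  rwa [pow_two] at this

lemma specNorm_sq_le_frobSq (M : Matrix (Fin p) (Fin q) ℝ) : specNorm M ^ 2 ≤ frobSq M := by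
  have : specNorm M ≤ √(frobSq M) := by
    refine specNorm_le_of (Real.sqrt_nonneg _) fun x => ?_
    rw [Real.sq_sqrt (frobSq_nonneg M)]
    exact mulVec_sq_le_frobSq M x
  calc specNorm M ^ 2 ≤ √(frobSq M) ^ 2 := pow_le_pow_left₀ (specNorm_nonneg M) this 2
    _ = _ := Real.sq_sqrt (frobSq_nonneg M)

lemma specNorm_le_of_frobSq {M : Matrix (Fin p) (Fin q) ℝ} {c : ℝ} (hc : 0 ≤ c)
    (h : frobSq M ≤ c ^ 2) : specNorm M ≤ c :=
  le_of_sq_le_sq ((specNorm_sq_le_frobSq M).trans h) hc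

end SpecNorm

/-! ### Eigenvalue bounds -/

section Eigenvalues

variable {p : ℕ}

/-- Spectral theorem in coordinates: `c i` is the squared coordinate of $x$ along the $i$-th
eigenvector. Every form bound then reduces to a bound on eigenvalues, weighted by nonnegative
numbers. -/
lemma qf_eigenvalue_bounds {M : Matrix (Fin p) (Fin p) ℝ} (hM : Mᵀ = M) (x : Fin p → ℝ) :
    ∃ c : Fin p → ℝ, ∃ lam : Fin p → ℝ, (∀ i, 0 ≤ c i) ∧ x ⬝ᵥ x = ∑ i, c i ∧
      qf M x = ∑ i, lam i * c i ∧ ∀ i, ∃ v : Fin p → ℝ, v ≠ 0 ∧ M *ᵥ v = lam i • v := by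
  have hH : M.IsHermitian := by
    rwa [Matrix.IsHermitian, Matrix.conjTranspose_eq_transpose_of_trivial]
  let b := hH.eigenvectorBasis
  let X : EuclideanSpace ℝ (Fin p) := WithLp.toLp 2 x
  refine ⟨fun i => (inner ℝ (b i) X) ^ 2, hH.eigenvalues, fun i => sq_nonneg _, ?_, ?_, fun i =>
    ⟨(b i).ofLp, ?_, hH.mulVec_eigenvectorBasis i⟩⟩
  · rw [dotProduct_self_eq_norm_sq, ← b.sum_sq_norm_inner_right X]
    simp
  · have h1 := b.sum_inner_mul_inner X (WithLp.toLp 2 (M *ᵥ x))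
    have h2 : ∀ u v : EuclideanSpace ℝ (Fin p), inner ℝ u v = u.ofLp ⬝ᵥ v.ofLp := by
      intro u v
      rw [EuclideanSpace.inner_eq_star_dotProduct]
      simp [dotProduct_comm]
    rw [h2 X] at h1
    change _ = x ⬝ᵥ (M *ᵥ x) at h1
    rw [qf, ← h1]
    refine Finset.sum_congr rfl fun i _ => ?_
    have h3 : inner ℝ (b i) (WithLp.toLp 2 (M *ᵥ x)) = hH.eigenvalues i * inner ℝ (b i) X := by
      rw [h2, h2]
      change (b i).ofLp ⬝ᵥ (M *ᵥ x) = _ * ((b i).ofLp ⬝ᵥ x)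
      rw [dotProduct_mulVec_comm', hM, hH.mulVec_eigenvectorBasis i, smul_dotProduct, smul_eq_mul]
    rw [h3, real_inner_comm (b i) X]
    ring
  · intro h0
    have := b.orthonormal.ne_zero i
    exact this (by ext j; simpa using congrFun h0 j)

lemma qf_le_of_eigenvalue_le {M : Matrix (Fin p) (Fin p) ℝ} (hM : Mᵀ = M) {c : ℝ}
    (h : ∀ (l : ℝ) (v : Fin p → ℝ), v ≠ 0 → M *ᵥ v = l • v → l ≤ c) (x : Fin p → ℝ) :
    qf M x ≤ c * (x ⬝ᵥ x) := by
  obtain ⟨w, lam, hw, h1, h2, h3⟩ := qf_eigenvalue_bounds hM x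
  rw [h1, h2, Finset.mul_sum]
  refine Finset.sum_le_sum fun i _ => mul_le_mul_of_nonneg_right ?_ (hw i)
  obtain ⟨v, hv, hv'⟩ := h3 i
  exact h _ v hv hv'

lemma le_qf_of_le_eigenvalue {M : Matrix (Fin p) (Fin p) ℝ} (hM : Mᵀ = M) {c : ℝ}
    (h : ∀ (l : ℝ) (v : Fin p → ℝ), v ≠ 0 → M *ᵥ v = l • v → c ≤ l) (x : Fin p → ℝ) :
    c * (x ⬝ᵥ x) ≤ qf M x := by
  obtain ⟨w, lam, hw, h1, h2, h3⟩ := qf_eigenvalue_bounds hM x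
  rw [h1, h2, Finset.mul_sum]
  refine Finset.sum_le_sum fun i _ => mul_le_mul_of_nonneg_right ?_ (hw i)
  obtain ⟨v, hv, hv'⟩ := h3 i
  exact h _ v hv hv'

lemma mem_spectrum_iff_eigenvector {M : Matrix (Fin p) (Fin p) ℝ} {l : ℝ} :
    l ∈ spectrum ℝ M ↔ ∃ v : Fin p → ℝ, v ≠ 0 ∧ M *ᵥ v = l • v := by
  rw [← Matrix.spectrum_toLin', ← Module.End.hasEigenvalue_iff_mem_spectrum]
  constructor
  · intro h
    obtain ⟨v, hv⟩ := h.exists_hasEigenvector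
    exact ⟨v, hv.2, by simpa using hv.apply_eq_smul⟩
  · rintro ⟨v, hv, h⟩
    exact Module.End.hasEigenvalue_of_hasEigenvector
      (Module.End.hasEigenvector_iff.2 ⟨Module.End.mem_eigenspace_iff.2 (by simpa using h), hv⟩)

lemma spectrum_finite (M : Matrix (Fin p) (Fin p) ℝ) : (spectrum ℝ M).Finite :=
  Matrix.finite_real_spectrum

lemma lambdaMin_mul_le_qf {M : Matrix (Fin p) (Fin p) ℝ} (hM : Mᵀ = M) (x : Fin p → ℝ) :
    lambdaMin M * (x ⬝ᵥ x) ≤ qf M x :=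
  le_qf_of_le_eigenvalue hM (fun _ v hv h => csInf_le (spectrum_finite M).bddBelow
    (mem_spectrum_iff_eigenvector.2 ⟨v, hv, h⟩)) x

lemma spectrum_nonempty_of_symm (hp : 0 < p) {M : Matrix (Fin p) (Fin p) ℝ} (hM : Mᵀ = M) :
    (spectrum ℝ M).Nonempty := by
  have hx : (1 : Fin p → ℝ) ≠ 0 := fun h => by simpa using congrFun h ⟨0, hp⟩
  obtain ⟨w, lam, hw, h1, h2, h3⟩ := qf_eigenvalue_bounds hM 1
  exact ⟨lam ⟨0, hp⟩, mem_spectrum_iff_eigenvector.2 (h3 _)⟩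

lemma lambdaMin_mem (hp : 0 < p) {M : Matrix (Fin p) (Fin p) ℝ} (hM : Mᵀ = M) :
    ∃ v : Fin p → ℝ, v ≠ 0 ∧ M *ᵥ v = lambdaMin M • v :=
  mem_spectrum_iff_eigenvector.1
    ((spectrum_nonempty_of_symm hp hM).csInf_mem (spectrum_finite M))

lemma posDef_eigenvalue_pos {M : Matrix (Fin p) (Fin p) ℝ} (hM : M.PosDef) {l : ℝ}
    {v : Fin p → ℝ} (hv : v ≠ 0) (h : M *ᵥ v = l • v) : 0 < l := by
  have h1 := qf_pos hM hv
  rw [qf, h, dotProduct_smul, smul_eq_mul] at h1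
  exact pos_of_mul_pos_left h1 (dotProduct_self_nonneg' v)

lemma lambdaMin_pos (hp : 0 < p) {M : Matrix (Fin p) (Fin p) ℝ} (hM : M.PosDef) :
    0 < lambdaMin M := by
  obtain ⟨v, hv, h⟩ := lambdaMin_mem hp (posSemidef_transpose hM.posSemidef)
  exact posDef_eigenvalue_pos hM hv h

/-- An eigenvalue $l>0$ of $M$ produces the eigenvalue $l^2$ of $M^\top M=M^2$, so the square root
of the least eigenvalue of $M^\top M$ is at most $l$. -/
lemma sigmaMin_mul_le_qf {M : Matrix (Fin p) (Fin p) ℝ} (hM : M.PosDef) (x : Fin p → ℝ) :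
    sigmaMin M * (x ⬝ᵥ x) ≤ qf M x := by
  have hs := posSemidef_transpose hM.posSemidef
  refine le_qf_of_le_eigenvalue hs (fun l v hv h => ?_) x
  refine Real.sqrt_le_iff.2 ⟨(posDef_eigenvalue_pos hM hv h).le, ?_⟩
  refine csInf_le (spectrum_finite _).bddBelow (mem_spectrum_iff_eigenvector.2 ⟨v, hv, ?_⟩)
  rw [hs, ← Matrix.mulVec_mulVec, h, Matrix.mulVec_smul, h, smul_smul, pow_two]

lemma sigmaMin_pos (hp : 0 < p) {M : Matrix (Fin p) (Fin p) ℝ} (hM : M.PosDef) :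
    0 < sigmaMin M := by
  have hs := posSemidef_transpose hM.posSemidef
  refine Real.sqrt_pos.2 (lambdaMin_pos hp ?_)
  rw [hs]
  have h2 : (M * M).PosDef := by
    have h3 : M * M = Mᴴ * M := by rw [Matrix.conjTranspose_eq_transpose_of_trivial, hs]
    rw [h3]
    exact Matrix.PosDef.conjTranspose_mul_self M
      (Matrix.mulVec_injective_iff_isUnit.2 hM.isUnit)
  exact h2

/-- Cauchy-Schwarz for the form $M$ between $x$ and $y=M^{-1}x$: the mixed term is $x^\top
My=|x|^2$, and $y^\top My=x^\top M^{-1}x$. -/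
lemma qf_inv_le (M : Matrix (Fin p) (Fin p) ℝ) (hM : M.PosDef) (x : Fin p → ℝ) :
    x ⬝ᵥ x ≤ specNorm M⁻¹ * qf M x := by
  have hu : IsUnit M.det := (Matrix.isUnit_iff_isUnit_det M).1 hM.isUnit
  set y := M⁻¹ *ᵥ x with hy
  have h0 : M *ᵥ y = x := by rw [hy, Matrix.mulVec_mulVec, Matrix.mul_nonsing_inv _ hu,
    Matrix.one_mulVec]
  have h1 := dotProduct_mulVec_sq_le hM.posSemidef x y
  rw [h0] at h1
  have h2 : qf M y ≤ specNorm M⁻¹ * (x ⬝ᵥ x) := by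
    rw [qf, h0, dotProduct_comm]; exact qf_le_specNorm _ x
  have h3 := qf_nonneg hM.posSemidef x
  have h4 := dotProduct_self_nonneg' x
  rcases h4.eq_or_lt with h5 | h5
  · rw [← h5]; exact mul_nonneg (specNorm_nonneg _) h3
  · refine le_of_mul_le_mul_right ?_ h5
    calc (x ⬝ᵥ x) * (x ⬝ᵥ x) = (x ⬝ᵥ x) ^ 2 := by ring
      _ ≤ qf M x * qf M y := h1
      _ ≤ qf M x * (specNorm M⁻¹ * (x ⬝ᵥ x)) := mul_le_mul_of_nonneg_left h2 h3
      _ = _ := by ring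

/-- The inverse of a matrix with `c |x|² ≤ xᵀ M x` has norm at most `1 / c`. -/
lemma specNorm_inv_mul_le {q : ℕ} {M : Matrix (Fin p) (Fin p) ℝ} {c : ℝ} (hc : 0 < c)
    (h : ∀ x, c * (x ⬝ᵥ x) ≤ qf M x) (hu : IsUnit M.det) (N : Matrix (Fin p) (Fin q) ℝ) :
    specNorm (M⁻¹ * N) ≤ specNorm N / c := by
  refine specNorm_le_of (div_nonneg (specNorm_nonneg N) hc.le) fun x => ?_
  set y := (M⁻¹ * N) *ᵥ x with hy
  have h0 : M *ᵥ y = N *ᵥ x := by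
    rw [hy, Matrix.mulVec_mulVec, ← Matrix.mul_assoc, Matrix.mul_nonsing_inv _ hu, Matrix.one_mul]
  have h1 := mul_qf_le_mulVec_sq hc.le h y
  have h2 := h y
  have h3 := mulVec_sq_le N x
  rw [h0] at h1
  have h4 : c ^ 2 * (y ⬝ᵥ y) ≤ specNorm N ^ 2 * (x ⬝ᵥ x) := by nlinarith
  rw [div_pow, div_mul_eq_mul_div, le_div_iff₀ (by positivity)]
  linarith

end Eigenvalues

/-! ### The induced norm -/

section InducedNorm

variable {p : ℕ}

lemma inducedNorm_nonneg (W X : Matrix (Fin p) (Fin p) ℝ) : 0 ≤ inducedNorm W X :=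
  Real.sqrt_nonneg _

lemma inducedNorm_bddAbove {W : Matrix (Fin p) (Fin p) ℝ} (hW : W.PosDef)
    (X : Matrix (Fin p) (Fin p) ℝ) :
    BddAbove (Set.range fun z : {z : Fin p → ℝ // z ≠ 0} =>
      ((X *ᵥ z.1) ⬝ᵥ (W *ᵥ (X *ᵥ z.1))) / (z.1 ⬝ᵥ (W *ᵥ z.1))) := by
  refine ⟨specNorm W * specNorm X ^ 2 * specNorm W⁻¹, ?_⟩
  rintro _ ⟨⟨z, hz⟩, rfl⟩
  have h0 : 0 < qf W z := qf_pos hW hz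
  change qf W (X *ᵥ z) / qf W z ≤ _
  rw [div_le_iff₀ h0]
  calc qf W (X *ᵥ z) ≤ specNorm W * ((X *ᵥ z) ⬝ᵥ (X *ᵥ z)) := qf_le_specNorm _ _
    _ ≤ specNorm W * (specNorm X ^ 2 * (z ⬝ᵥ z)) :=
      mul_le_mul_of_nonneg_left (mulVec_sq_le X z) (specNorm_nonneg W)
    _ ≤ specNorm W * (specNorm X ^ 2 * (specNorm W⁻¹ * qf W z)) :=
      mul_le_mul_of_nonneg_left (mul_le_mul_of_nonneg_left (qf_inv_le W hW z) (sq_nonneg _))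
        (specNorm_nonneg W)
    _ = _ := by ring

lemma qf_mulVec_le_inducedNorm {W : Matrix (Fin p) (Fin p) ℝ} (hW : W.PosDef)
    (X : Matrix (Fin p) (Fin p) ℝ) (z : Fin p → ℝ) :
    qf W (X *ᵥ z) ≤ inducedNorm W X ^ 2 * qf W z := by
  by_cases hz : z = 0
  · subst hz; simp [qf]
  have h0 : 0 < qf W z := qf_pos hW hz
  have h1 := le_ciSup (inducedNorm_bddAbove hW X) ⟨z, hz⟩
  have h2 : 0 ≤ qf W (X *ᵥ z) / qf W z := div_nonneg (qf_nonneg hW.posSemidef _) h0.le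
  rw [inducedNorm, Real.sq_sqrt (h2.trans h1), ← div_le_iff₀ h0]
  exact h1

lemma inducedNorm_le (hp : 0 < p) {W X : Matrix (Fin p) (Fin p) ℝ} (hW : W.PosDef) {c : ℝ}
    (h : ∀ z, qf W (X *ᵥ z) ≤ c * qf W z) : inducedNorm W X ≤ √c := by
  have : Nonempty {z : Fin p → ℝ // z ≠ 0} :=
    ⟨⟨1, fun h => by simpa using congrFun h ⟨0, hp⟩⟩⟩
  refine Real.sqrt_le_sqrt (ciSup_le ?_)
  rintro ⟨z, hz⟩
  exact (div_le_iff₀ (qf_pos hW hz)).2 (h z)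

lemma inducedNorm_pos {W X : Matrix (Fin p) (Fin p) ℝ} (hW : W.PosDef) (hX : X ≠ 0) :
    0 < inducedNorm W X := by
  refine (inducedNorm_nonneg W X).lt_of_ne fun h0 => hX ?_
  ext i j
  have h1 := qf_mulVec_le_inducedNorm hW X (Pi.single j 1)
  rw [← h0] at h1
  have h2 : X *ᵥ Pi.single j 1 = 0 := by
    by_contra h3
    have := qf_pos hW h3
    rw [zero_pow two_ne_zero, zero_mul] at h1
    linarith
  simpa using congrFun h2 i

/-- A symmetric matrix is bounded, as a quadratic form, by each of its induced norms. -/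
lemma qf_le_inducedNorm {W D : Matrix (Fin p) (Fin p) ℝ} (hW : W.PosDef) (hD : Dᵀ = D)
    (x : Fin p → ℝ) : qf D x ≤ inducedNorm W D * (x ⬝ᵥ x) := by
  -- Eigenvalues do not depend on the inner product: each one is bounded by every induced operator
  -- norm, so no condition number is lost here.
  refine qf_le_of_eigenvalue_le hD (fun l v hv h => ?_) x
  have h1 := qf_mulVec_le_inducedNorm hW D v
  rw [h, qf_smul_vec] at h1
  exact le_of_sq_le_sq (le_of_mul_le_mul_right h1 (qf_pos hW hv)) (inducedNorm_nonneg W D)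

lemma qf_mulVec_pow_le {W : Matrix (Fin p) (Fin p) ℝ} (hW : W.PosDef)
    (X : Matrix (Fin p) (Fin p) ℝ) (k : ℕ) (z : Fin p → ℝ) :
    qf W ((X ^ k) *ᵥ z) ≤ inducedNorm W X ^ (2 * k) * qf W z := by
  induction k with
  | zero => simp
  | succ k ih =>
    rw [pow_succ', ← Matrix.mulVec_mulVec]
    calc _ ≤ inducedNorm W X ^ 2 * qf W ((X ^ k) *ᵥ z) := qf_mulVec_le_inducedNorm hW X _
      _ ≤ inducedNorm W X ^ 2 * (inducedNorm W X ^ (2 * k) * qf W z) :=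
        mul_le_mul_of_nonneg_left ih (sq_nonneg _)
      _ = _ := by ring

/-- Powers of a matrix in the spectral norm, in terms of an induced norm. -/
lemma mulVec_pow_sq_le {W : Matrix (Fin p) (Fin p) ℝ} (hW : W.PosDef)
    (X : Matrix (Fin p) (Fin p) ℝ) (k : ℕ) (z : Fin p → ℝ) :
    ((X ^ k) *ᵥ z) ⬝ᵥ ((X ^ k) *ᵥ z) ≤ condNumber W * inducedNorm W X ^ (2 * k) * (z ⬝ᵥ z) := by
  have hr : 0 ≤ inducedNorm W X ^ (2 * k) := pow_nonneg (inducedNorm_nonneg _ _) _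
  calc _ ≤ specNorm W⁻¹ * qf W ((X ^ k) *ᵥ z) := qf_inv_le W hW _
    _ ≤ specNorm W⁻¹ * (inducedNorm W X ^ (2 * k) * qf W z) :=
      mul_le_mul_of_nonneg_left (qf_mulVec_pow_le hW X k z) (specNorm_nonneg _)
    _ ≤ specNorm W⁻¹ * (inducedNorm W X ^ (2 * k) * (specNorm W * (z ⬝ᵥ z))) :=
      mul_le_mul_of_nonneg_left (mul_le_mul_of_nonneg_left (qf_le_specNorm W z) hr)
        (specNorm_nonneg _)
    _ = _ := by rw [condNumber]; ring

end InducedNorm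

/-! ### The Riccati operator -/

namespace LQR

variable {n m : ℕ} (S : LQR n m)

/-- The matrix `R + Bᵀ P B`. -/
def inputWeight (P : Matrix (Fin n) (Fin n) ℝ) : Matrix (Fin m) (Fin m) ℝ :=
  S.R + S.Bᵀ * P * S.B

/-- The one-stage cost `Q + Kᵀ R K + (A - B K)ᵀ P (A - B K)` of the gain `K` with cost-to-go `P`. -/
def stageMat (K : Matrix (Fin m) (Fin n) ℝ) (P : Matrix (Fin n) (Fin n) ℝ) :
    Matrix (Fin n) (Fin n) ℝ :=
  S.Q + Kᵀ * S.R * K + (S.A - S.B * K)ᵀ * P * (S.A - S.B * K)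

variable {S}

lemma qf_stageMat (K : Matrix (Fin m) (Fin n) ℝ) (P : Matrix (Fin n) (Fin n) ℝ) (x : Fin n → ℝ) :
    qf (S.stageMat K P) x = qf S.Q x + qf S.R (K *ᵥ x) + qf P ((S.A - S.B * K) *ᵥ x) := by
  rw [stageMat, qf_add, qf_add, qf_congr, qf_congr]

lemma stageMat_posSemidef (hQ : S.Q.PosDef) (hR : S.R.PosDef) (K : Matrix (Fin m) (Fin n) ℝ)
    {P : Matrix (Fin n) (Fin n) ℝ} (hP : P.PosSemidef) : (S.stageMat K P).PosSemidef :=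
  (hQ.posSemidef.add (posSemidef_congr K hR.posSemidef)).add (posSemidef_congr _ hP)

lemma qf_inputWeight (P : Matrix (Fin n) (Fin n) ℝ) (u : Fin m → ℝ) :
    qf (S.inputWeight P) u = qf S.R u + qf P (S.B *ᵥ u) := by
  rw [inputWeight, qf_add, qf_congr]

lemma inputWeight_posDef (hR : S.R.PosDef) {P : Matrix (Fin n) (Fin n) ℝ} (hP : P.PosSemidef) :
    (S.inputWeight P).PosDef :=
  hR.add_posSemidef (posSemidef_congr _ hP)

lemma inputWeight_isUnit (hR : S.R.PosDef) {P : Matrix (Fin n) (Fin n) ℝ} (hP : P.PosSemidef) :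
    IsUnit (S.inputWeight P).det :=
  (Matrix.isUnit_iff_isUnit_det _).1 (inputWeight_posDef hR hP).isUnit

lemma inputWeight_mul_gain (hR : S.R.PosDef) {P : Matrix (Fin n) (Fin n) ℝ} (hP : P.PosSemidef) :
    S.inputWeight P * S.gain P = S.Bᵀ * P * S.A := by
  have : S.gain P = (S.inputWeight P)⁻¹ * (S.Bᵀ * P * S.A) := by
    simp only [gain, inputWeight, Matrix.mul_assoc]
  rw [this, ← Matrix.mul_assoc, Matrix.mul_nonsing_inv _ (inputWeight_isUnit hR hP), Matrix.one_mul]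

/-- Completion of squares: the one-stage cost exceeds the Riccati operator by a square. -/
lemma stageMat_eq (hR : S.R.PosDef) {P : Matrix (Fin n) (Fin n) ℝ} (hP : P.PosSemidef)
    (K : Matrix (Fin m) (Fin n) ℝ) :
    S.stageMat K P =
      S.riccati P + (K - S.gain P)ᵀ * S.inputWeight P * (K - S.gain P) := by
  have h1 := inputWeight_mul_gain hR hP
  have hW := posSemidef_transpose (inputWeight_posDef hR hP).posSemidef
  have hPt := posSemidef_transpose hP
  have h2 : (S.gain P)ᵀ * S.inputWeight P = S.Aᵀ * P * S.B := by
    have := congrArg Matrix.transpose h1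
    rw [Matrix.transpose_mul, hW] at this
    rw [this]
    simp only [Matrix.transpose_mul, Matrix.transpose_transpose, hPt, Matrix.mul_assoc]
  have h3 : S.riccati P = S.Q + S.Aᵀ * P * S.A - S.Aᵀ * P * S.B * S.gain P := by
    simp only [riccati, gain, Matrix.mul_sub, Matrix.sub_mul, Matrix.mul_assoc]
    abel
  have h4 : (K - S.gain P)ᵀ * S.inputWeight P * (K - S.gain P)
      = Kᵀ * S.inputWeight P * K - Kᵀ * (S.inputWeight P * S.gain P)
        - ((S.gain P)ᵀ * S.inputWeight P) * K
        + ((S.gain P)ᵀ * S.inputWeight P) * S.gain P := by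
    simp only [Matrix.transpose_sub, Matrix.mul_sub, Matrix.sub_mul, Matrix.mul_assoc]
    abel
  rw [h3, h4, h1, h2]
  simp only [stageMat, inputWeight, Matrix.transpose_sub, Matrix.transpose_mul, Matrix.mul_sub,
    Matrix.sub_mul, Matrix.mul_add, Matrix.add_mul, Matrix.mul_assoc]
  abel

lemma qf_stageMat_eq (hR : S.R.PosDef) {P : Matrix (Fin n) (Fin n) ℝ} (hP : P.PosSemidef)
    (K : Matrix (Fin m) (Fin n) ℝ) (x : Fin n → ℝ) :
    qf (S.stageMat K P) x =
      qf (S.riccati P) x + qf (S.inputWeight P) ((K - S.gain P) *ᵥ x) := by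
  rw [stageMat_eq hR hP, qf_add, qf_congr]

lemma stageMat_gain (hR : S.R.PosDef) {P : Matrix (Fin n) (Fin n) ℝ} (hP : P.PosSemidef) :
    S.stageMat (S.gain P) P = S.riccati P := by
  rw [stageMat_eq hR hP, sub_self]; simp

lemma riccati_le_stageMat (hR : S.R.PosDef) {P : Matrix (Fin n) (Fin n) ℝ} (hP : P.PosSemidef)
    (K : Matrix (Fin m) (Fin n) ℝ) (x : Fin n → ℝ) :
    qf (S.riccati P) x ≤ qf (S.stageMat K P) x := by
  rw [qf_stageMat_eq hR hP]
  linarith [qf_nonneg (inputWeight_posDef hR hP).posSemidef ((K - S.gain P) *ᵥ x)]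

lemma riccati_posSemidef (hQ : S.Q.PosDef) (hR : S.R.PosDef) {P : Matrix (Fin n) (Fin n) ℝ}
    (hP : P.PosSemidef) : (S.riccati P).PosSemidef := by
  rw [← stageMat_gain hR hP]; exact stageMat_posSemidef hQ hR _ hP

lemma le_riccati (hR : S.R.PosDef) {P : Matrix (Fin n) (Fin n) ℝ} (hP : P.PosSemidef)
    (x : Fin n → ℝ) : qf S.Q x ≤ qf (S.riccati P) x := by
  rw [← stageMat_gain hR hP, qf_stageMat]
  linarith [qf_nonneg hR.posSemidef (S.gain P *ᵥ x),
    qf_nonneg hP ((S.A - S.B * S.gain P) *ᵥ x)]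

/-- If `P₁ ⪯ s P₂` with `s ≥ 1`, then `ℛ(P₁) ⪯ s ℛ(P₂)`. -/
lemma riccati_le_mul (hQ : S.Q.PosDef) (hR : S.R.PosDef) {P₁ P₂ : Matrix (Fin n) (Fin n) ℝ}
    (h₁ : P₁.PosSemidef) (h₂ : P₂.PosSemidef) {s : ℝ} (hs : 1 ≤ s)
    (h : ∀ x, qf P₁ x ≤ s * qf P₂ x) (x : Fin n → ℝ) :
    qf (S.riccati P₁) x ≤ s * qf (S.riccati P₂) x := by
  -- The optimal gain for $P_2$ is merely suboptimal for $P_1$. The hypothesis $s\ge1$ absorbs the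
  -- $Q$- and $R$-terms, which are not scaled.
  refine (riccati_le_stageMat hR h₁ (S.gain P₂) x).trans ?_
  rw [← stageMat_gain hR h₂, qf_stageMat, qf_stageMat]
  have h3 := h ((S.A - S.B * S.gain P₂) *ᵥ x)
  have h4 := qf_nonneg hQ.posSemidef x
  have h5 := qf_nonneg hR.posSemidef (S.gain P₂ *ᵥ x)
  nlinarith

lemma riccati_mono (hQ : S.Q.PosDef) (hR : S.R.PosDef) {P₁ P₂ : Matrix (Fin n) (Fin n) ℝ}
    (h₁ : P₁.PosSemidef) (h₂ : P₂.PosSemidef) (h : ∀ x, qf P₁ x ≤ qf P₂ x) (x : Fin n → ℝ) :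
    qf (S.riccati P₁) x ≤ qf (S.riccati P₂) x := by
  have := riccati_le_mul hQ hR h₁ h₂ le_rfl (fun x => by rw [one_mul]; exact h x) x
  rwa [one_mul] at this

/-- Applying the gain of $P_2$ to $P_1$ is suboptimal, and the stage costs of the two sides are then
identical and cancel. -/
lemma riccati_sub_le (hR : S.R.PosDef) {P₁ P₂ : Matrix (Fin n) (Fin n) ℝ}
    (h₁ : P₁.PosSemidef) (h₂ : P₂.PosSemidef) (x : Fin n → ℝ) :
    qf (S.riccati P₁) x - qf (S.riccati P₂) x
      ≤ qf P₁ ((S.A - S.B * S.gain P₂) *ᵥ x) - qf P₂ ((S.A - S.B * S.gain P₂) *ᵥ x) := by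
  have := riccati_le_stageMat hR h₁ (S.gain P₂) x
  rw [← stageMat_gain hR h₂]
  rw [qf_stageMat] at this ⊢
  linarith

/-- Subtract the normal equations `inputWeight_mul_gain` for $P_1$ and $P_2$. The closed loop of
$P_2$ alone appears, so the Lipschitz constant of the gain involves only $\|B\|$, this closed loop
and $1/\lambda_{\min}(R)$. -/
lemma gain_sub_gain (hR : S.R.PosDef) {P₁ P₂ : Matrix (Fin n) (Fin n) ℝ}
    (h₁ : P₁.PosSemidef) (h₂ : P₂.PosSemidef) :
    S.gain P₁ - S.gain P₂ =
      (S.inputWeight P₁)⁻¹ * (S.Bᵀ * (P₁ - P₂) * (S.A - S.B * S.gain P₂)) := by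
  have hu := inputWeight_isUnit hR h₁
  have h : S.inputWeight P₁ * (S.gain P₁ - S.gain P₂)
      = S.Bᵀ * (P₁ - P₂) * (S.A - S.B * S.gain P₂) := by
    have e : S.inputWeight P₁ * S.gain P₂
        = S.inputWeight P₂ * S.gain P₂ + S.Bᵀ * (P₁ - P₂) * S.B * S.gain P₂ := by
      simp only [inputWeight, Matrix.add_mul, Matrix.mul_sub, Matrix.sub_mul]
      abel
    rw [Matrix.mul_sub, e, inputWeight_mul_gain hR h₁, inputWeight_mul_gain hR h₂]
    simp only [Matrix.mul_sub, Matrix.sub_mul, Matrix.mul_assoc]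
    abel
  rw [← h, ← Matrix.mul_assoc, Matrix.nonsing_inv_mul _ hu, Matrix.one_mul]

lemma lambdaMin_le_inputWeight (hR : S.R.PosDef) {P : Matrix (Fin n) (Fin n) ℝ}
    (hP : P.PosSemidef) (u : Fin m → ℝ) :
    lambdaMin S.R * (u ⬝ᵥ u) ≤ qf (S.inputWeight P) u := by
  rw [qf_inputWeight]
  linarith [lambdaMin_mul_le_qf (posSemidef_transpose hR.posSemidef) u, qf_nonneg hP (S.B *ᵥ u)]

lemma sigmaMin_le_inputWeight (hR : S.R.PosDef) {P : Matrix (Fin n) (Fin n) ℝ}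
    (hP : P.PosSemidef) (u : Fin m → ℝ) :
    sigmaMin S.R * (u ⬝ᵥ u) ≤ qf (S.inputWeight P) u := by
  rw [qf_inputWeight]
  linarith [sigmaMin_mul_le_qf hR u, qf_nonneg hP (S.B *ᵥ u)]

lemma specNorm_gain_sub_le (hm : 0 < m) (hR : S.R.PosDef) {P₁ P₂ : Matrix (Fin n) (Fin n) ℝ}
    (h₁ : P₁.PosSemidef) (h₂ : P₂.PosSemidef) :
    specNorm (S.gain P₁ - S.gain P₂)
      ≤ specNorm S.B * specNorm (P₁ - P₂) * specNorm (S.A - S.B * S.gain P₂) / lambdaMin S.R := by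
  rw [gain_sub_gain hR h₁ h₂]
  refine (specNorm_inv_mul_le (lambdaMin_pos hm hR) (lambdaMin_le_inputWeight hR h₁)
    (inputWeight_isUnit hR h₁) _).trans
    (div_le_div_of_nonneg_right ?_ (lambdaMin_pos hm hR).le)
  refine (specNorm_mul_le _ _).trans (mul_le_mul_of_nonneg_right ?_ (specNorm_nonneg _))
  refine (specNorm_mul_le _ _).trans_eq ?_
  rw [specNorm_transpose]

lemma specNorm_gain_le (hm : 0 < m) (hR : S.R.PosDef) {P : Matrix (Fin n) (Fin n) ℝ}
    (hP : P.PosSemidef) :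
    specNorm (S.gain P) ≤ specNorm S.B * specNorm P * specNorm S.A / lambdaMin S.R := by
  have : S.gain P = (S.inputWeight P)⁻¹ * (S.Bᵀ * P * S.A) := by
    simp only [gain, inputWeight, Matrix.mul_assoc]
  rw [this]
  refine (specNorm_inv_mul_le (lambdaMin_pos hm hR) (lambdaMin_le_inputWeight hR hP)
    (inputWeight_isUnit hR hP) _).trans
    (div_le_div_of_nonneg_right ?_ (lambdaMin_pos hm hR).le)
  refine (specNorm_mul_le _ _).trans (mul_le_mul_of_nonneg_right ?_ (specNorm_nonneg _))
  refine (specNorm_mul_le _ _).trans_eq ?_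
  rw [specNorm_transpose]

/-- The closed loop of a Riccati gain vanishes only if `A` does. -/
lemma closedLoop_ne_zero (hn : 0 < n) (hR : S.R.PosDef) (hA : IsUnit S.A)
    {P : Matrix (Fin n) (Fin n) ℝ} (hP : P.PosSemidef) : S.A - S.B * S.gain P ≠ 0 := by
  intro h0
  have hu : IsUnit S.R.det := (Matrix.isUnit_iff_isUnit_det _).1 hR.isUnit
  have h1 := inputWeight_mul_gain hR hP
  -- The normal equation rewritten as $RG=B^\top P(A-BG)$: a vanishing closed loop forces $G=0$,
  -- hence $A=0$.
  have h2 : S.R * S.gain P = S.Bᵀ * P * (S.A - S.B * S.gain P) := by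
    rw [Matrix.mul_sub, ← h1, inputWeight, Matrix.add_mul]
    simp only [Matrix.mul_assoc]
    abel
  have h3 : S.gain P = 0 := by
    have : S.R⁻¹ * (S.R * S.gain P) = 0 := by rw [h2, h0]; simp
    rwa [← Matrix.mul_assoc, Matrix.nonsing_inv_mul _ hu, Matrix.one_mul] at this
  rw [h3, Matrix.mul_zero, sub_zero] at h0
  rw [h0] at hA
  have : Nonempty (Fin n) := ⟨⟨0, hn⟩⟩
  exact not_isUnit_zero hA

/-! ### The Riccati difference equation -/

lemma riccati_eq_of_isARESolution {P : Matrix (Fin n) (Fin n) ℝ} (hP : S.IsARESolution P) :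
    S.riccati P = P := by
  conv_rhs => rw [hP.2]
  simp only [riccati, Matrix.mul_sub, Matrix.sub_mul, Matrix.mul_assoc]
  abel

lemma rde_self (N : ℕ) : S.rde N N = S.QN := by simp [rde]

lemma rde_eq_riccati {N t : ℕ} (h : t < N) : S.rde N t = S.riccati (S.rde N (t + 1)) := by
  rw [rde, rde, show N - t = (N - (t + 1)) + 1 by omega, Function.iterate_succ_apply']

lemma iterate_riccati_posSemidef (hQ : S.Q.PosDef) (hR : S.R.PosDef)
    (hQN : S.QN.PosSemidef) (k : ℕ) : (S.riccati^[k] S.QN).PosSemidef := by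
  induction k with
  | zero => exact hQN
  | succ k ih => rw [Function.iterate_succ_apply']; exact riccati_posSemidef hQ hR ih

lemma rde_posSemidef (hQ : S.Q.PosDef) (hR : S.R.PosDef)
    (hQN : S.QN.PosSemidef) (N t : ℕ) : (S.rde N t).PosSemidef :=
  iterate_riccati_posSemidef hQ hR hQN _

/-! ### Comparison of the Riccati iteration with its fixed point. -/

section ARE

variable {P : Matrix (Fin n) (Fin n) ℝ}

lemma terminal_posSemidef (hP : S.IsARESolution P) (hQN : (S.QN - P).PosSemidef) :
    S.QN.PosSemidef := by
  have := hQN.add hP.1.posSemidef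
  rwa [sub_add_cancel] at this

lemma iterate_riccati_ge (hQ : S.Q.PosDef) (hR : S.R.PosDef) (hP : S.IsARESolution P)
    (hQN : (S.QN - P).PosSemidef) (k : ℕ) (x : Fin n → ℝ) :
    qf P x ≤ qf (S.riccati^[k] S.QN) x := by
  have hT := terminal_posSemidef hP hQN
  induction k generalizing x with
  | zero =>
    have := qf_nonneg hQN x
    rw [qf_sub] at this
    simpa using this
  | succ k ih =>
    rw [Function.iterate_succ_apply']
    conv_lhs => rw [← riccati_eq_of_isARESolution hP]
    exact riccati_mono hQ hR hP.1.posSemidef (iterate_riccati_posSemidef hQ hR hT k) ih x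

lemma iterate_riccati_sub_posSemidef (hQ : S.Q.PosDef) (hR : S.R.PosDef) (hP : S.IsARESolution P)
    (hQN : (S.QN - P).PosSemidef) (k : ℕ) : (S.riccati^[k] S.QN - P).PosSemidef := by
  have hT := terminal_posSemidef hP hQN
  refine posSemidef_iff_qf.2 ⟨?_, fun x => ?_⟩
  · rw [Matrix.transpose_sub, posSemidef_transpose (iterate_riccati_posSemidef hQ hR hT k),
      posSemidef_transpose hP.1.posSemidef]
  · rw [qf_sub]; linarith [iterate_riccati_ge hQ hR hP hQN k x]

/-- Iterating `riccati_sub_le` against the fixed point $P$ uses the same gain at every step, so the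
error is transported by powers of the one closed loop $A-BK^*$. -/
lemma iterate_riccati_sub_le (hQ : S.Q.PosDef) (hR : S.R.PosDef) (hP : S.IsARESolution P)
    (hQN : (S.QN - P).PosSemidef) (k : ℕ) (x : Fin n → ℝ) :
    qf (S.riccati^[k] S.QN - P) x ≤ qf (S.QN - P) (((S.A - S.B * S.gain P) ^ k) *ᵥ x) := by
  have hT := terminal_posSemidef hP hQN
  induction k generalizing x with
  | zero => simp
  | succ k ih =>
    rw [Function.iterate_succ_apply', pow_succ, ← Matrix.mulVec_mulVec]
    refine le_trans ?_ (ih _)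
    rw [qf_sub, qf_sub]
    have := riccati_sub_le hR (iterate_riccati_posSemidef hQ hR hT k) hP.1.posSemidef x
    rwa [riccati_eq_of_isARESolution hP] at this

/-- Geometric convergence of the Riccati difference equation. -/
lemma specNorm_iterate_riccati_sub_le (hQ : S.Q.PosDef) (hR : S.R.PosDef)
    (hP : S.IsARESolution P) (hQN : (S.QN - P).PosSemidef) (k : ℕ) :
    specNorm (S.riccati^[k] S.QN - P) ≤ inducedNorm P (S.QN - P) * condNumber P
      * inducedNorm P (S.A - S.B * S.gain P) ^ (2 * k) := by
  have hc : 0 ≤ condNumber P := mul_nonneg (specNorm_nonneg _) (specNorm_nonneg _)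
  have hd := inducedNorm_nonneg P (S.QN - P)
  refine specNorm_le_of_qf (iterate_riccati_sub_posSemidef hQ hR hP hQN k)
    (mul_nonneg (mul_nonneg hd hc) (pow_nonneg (inducedNorm_nonneg _ _) _)) fun x => ?_
  refine (iterate_riccati_sub_le hQ hR hP hQN k x).trans ?_
  refine (qf_le_inducedNorm hP.1 (posSemidef_transpose hQN) _).trans ?_
  refine (mul_le_mul_of_nonneg_left (mulVec_pow_sq_le hP.1 _ k x) hd).trans_eq ?_
  ring

/-- The optimal closed loop contracts in the norm induced by the Riccati solution. -/
lemma inducedNorm_closedLoop_lt_one (hn : 0 < n) (hQ : S.Q.PosDef) (hR : S.R.PosDef)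
    (hP : S.IsARESolution P) : inducedNorm P (S.A - S.B * S.gain P) < 1 := by
  have hσ := lambdaMin_pos hn hQ
  have hx : (1 : Fin n → ℝ) ≠ 0 := fun h => by simpa using congrFun h ⟨0, hn⟩
  have hp : 0 < specNorm P := by
    refine (specNorm_nonneg P).lt_of_ne fun h => ?_
    have h1 := qf_le_specNorm P 1
    have h2 := qf_pos hP.1 hx
    rw [← h, zero_mul] at h1
    linarith
  -- From $P=Q+K^{*\top}RK^*+A_K^{*\top}PA_K^*$ and
  -- $Q\succeq\lambda_{\min}(Q)I\succeq(\lambda_{\min}(Q)/\|P\|)P$, each step loses the fraction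
  -- $\lambda_{\min}(Q)/\|P\|$ of the $P$-form.
  have key : inducedNorm P (S.A - S.B * S.gain P) ≤ √(1 - lambdaMin S.Q / specNorm P) := by
    refine inducedNorm_le hn hP.1 fun z => ?_
    have h1 := qf_stageMat (S := S) (S.gain P) P z
    rw [stageMat_gain hR hP.1.posSemidef, riccati_eq_of_isARESolution hP] at h1
    have h2 := qf_nonneg hR.posSemidef (S.gain P *ᵥ z)
    have h3 := lambdaMin_mul_le_qf (posSemidef_transpose hQ.posSemidef) z
    have h4 := qf_le_specNorm P z
    have h5 : lambdaMin S.Q / specNorm P * qf P z ≤ lambdaMin S.Q * (z ⬝ᵥ z) := by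
      rw [div_mul_eq_mul_div, div_le_iff₀ hp]
      nlinarith
    nlinarith
  refine key.trans_lt ?_
  rw [Real.sqrt_lt' one_pos]
  have := div_pos hσ hp
  linarith

lemma inducedNorm_closedLoop_pos (hn : 0 < n) (hR : S.R.PosDef) (hA : IsUnit S.A)
    (hP : S.IsARESolution P) : 0 < inducedNorm P (S.A - S.B * S.gain P) :=
  inducedNorm_pos hP.1 (closedLoop_ne_zero hn hR hA hP.1.posSemidef)

lemma one_le_horizon (ε : ℝ) : 1 ≤ S.horizon P ε := le_max_left _ _

/-- At the prescribed horizon, the optimal finite-horizon gain is `ε / 2`-close to `K*`. -/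
lemma specNorm_optGain_horizon_sub_le (hn : 0 < n) (hm : 0 < m) (hQ : S.Q.PosDef)
    (hR : S.R.PosDef) (hA : IsUnit S.A) (hP : S.IsARESolution P) (hQN : (S.QN - P).PosSemidef)
    {ε : ℝ} (hε : 0 < ε) :
    specNorm (S.optGain (S.horizon P ε) 0 - S.gain P) ≤ ε / 2 := by
  set N := S.horizon P ε with hN
  set ρ := inducedNorm P (S.A - S.B * S.gain P) with hρ
  have hρ0 : 0 < ρ := inducedNorm_closedLoop_pos hn hR hA hP
  have hρ1 : ρ < 1 := inducedNorm_closedLoop_lt_one hn hQ hR hP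
  have hl := lambdaMin_pos hm hR
  have hT := terminal_posSemidef hP hQN
  set X := 2 * inducedNorm P (S.QN - P) * condNumber P * specNorm (S.A - S.B * S.gain P)
        * specNorm S.B / (ε * lambdaMin S.R) with hX
  have hX0 : 0 ≤ X := by
    have := inducedNorm_nonneg P (S.QN - P)
    have := specNorm_nonneg (S.A - S.B * S.gain P)
    have := specNorm_nonneg S.B
    have : 0 ≤ condNumber P := mul_nonneg (specNorm_nonneg _) (specNorm_nonneg _)
    positivity
  have hN1 : 1 ≤ N := one_le_horizon ε
  have hlog : 0 < Real.log (1 / ρ) := Real.log_pos (by rw [lt_div_iff₀ hρ0]; linarith)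
  have hXρ : X * ρ ^ (2 * (N - 1)) ≤ 1 := by
    -- If $X=0$ its logarithm carries no information, but then the claim is trivial.
    rcases hX0.eq_or_lt with h0 | h0
    · rw [← h0]; simp
    have h1 : 1 / 2 * (Real.log X / Real.log (1 / ρ)) + 1 ≤ (N : ℝ) :=
      (Nat.le_ceil _).trans (by exact_mod_cast le_max_right _ _)
    have h2 : Real.log X ≤ ((2 * (N - 1) : ℕ) : ℝ) * Real.log (1 / ρ) := by
      push_cast [Nat.cast_sub hN1]
      rw [← div_le_iff₀ hlog]
      linarith
    have h3 : X ≤ (1 / ρ) ^ (2 * (N - 1)) := by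
      rw [← Real.log_pow] at h2
      exact (Real.log_le_log_iff h0 (by positivity)).1 h2
    calc X * ρ ^ (2 * (N - 1)) ≤ (1 / ρ) ^ (2 * (N - 1)) * ρ ^ (2 * (N - 1)) :=
          mul_le_mul_of_nonneg_right h3 (by positivity)
      _ = 1 := by rw [← mul_pow, one_div, inv_mul_cancel₀ hρ0.ne', one_pow]
  -- The gain at time $0$ is computed from $P^*_1$, which is only $N-1$ Riccati steps away from
  -- $Q_N$; hence the summand $1$ in the horizon.
  have h5 : S.rde N (0 + 1) = S.riccati^[N - 1] S.QN := by rw [rde]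
  have h4 := specNorm_gain_sub_le hm hR (iterate_riccati_posSemidef hQ hR hT (N - 1))
    hP.1.posSemidef
  have h6 := specNorm_iterate_riccati_sub_le hQ hR hP hQN (N - 1)
  rw [optGain, h5]
  refine h4.trans ?_
  rw [div_le_iff₀ hl]
  have hB := specNorm_nonneg S.B
  have hAK := specNorm_nonneg (S.A - S.B * S.gain P)
  calc _ ≤ specNorm S.B * (inducedNorm P (S.QN - P) * condNumber P * ρ ^ (2 * (N - 1)))
          * specNorm (S.A - S.B * S.gain P) :=
        mul_le_mul_of_nonneg_right (mul_le_mul_of_nonneg_left h6 hB) hAK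
    -- The factor $2$ in $X$ is what leaves $\varepsilon/2$ here.
    _ = X * ρ ^ (2 * (N - 1)) * (ε / 2 * lambdaMin S.R) := by rw [hX]; field_simp
    _ ≤ 1 * (ε / 2 * lambdaMin S.R) := mul_le_mul_of_nonneg_right hXρ (by positivity)
    _ = _ := one_mul _

end ARE

end LQR

/-! ### Cost-to-go matrices of a table of gains -/

namespace LQR

variable {n m : ℕ} (S : LQR n m)

/-- The cost-to-go matrix of the last `k` gains of the table `Kt`. -/
def lastCost (N : ℕ) (Kt : ℕ → Matrix (Fin m) (Fin n) ℝ) : ℕ → Matrix (Fin n) (Fin n) ℝ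
  | 0 => S.QN
  | k + 1 => S.stageMat (Kt (N - 1 - k)) (lastCost N Kt k)

/-- The cost-to-go matrix from stage `h` of the table of gains `Kt`. -/
def costMat (N : ℕ) (Kt : ℕ → Matrix (Fin m) (Fin n) ℝ) (h : ℕ) : Matrix (Fin n) (Fin n) ℝ :=
  S.lastCost N Kt (N - h)

/-- The gain of stage `h` has the accuracy demanded by the algorithm, in Frobenius norm. -/
def StageAccurate (N : ℕ) (ε : ℝ) (Kt : ℕ → Matrix (Fin m) (Fin n) ℝ) (h : ℕ) : Prop :=
  frobSq (Kt h - S.gain (S.costMat N Kt (h + 1))) ≤ S.tol N ε h ^ 2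

variable {S}

lemma costMat_self (N : ℕ) (Kt : ℕ → Matrix (Fin m) (Fin n) ℝ) : S.costMat N Kt N = S.QN := by
  simp [costMat, lastCost]

lemma costMat_eq {N h : ℕ} (hh : h < N) (Kt : ℕ → Matrix (Fin m) (Fin n) ℝ) :
    S.costMat N Kt h = S.stageMat (Kt h) (S.costMat N Kt (h + 1)) := by
  rw [costMat, costMat, show N - h = (N - (h + 1)) + 1 by omega, lastCost,
    show N - 1 - (N - (h + 1)) = h by omega]

lemma lastCost_congr {N k : ℕ} {Kt Kt' : ℕ → Matrix (Fin m) (Fin n) ℝ}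
    (h : ∀ j, N - k ≤ j → j < N → Kt j = Kt' j) (hk : k ≤ N) :
    S.lastCost N Kt k = S.lastCost N Kt' k := by
  induction k with
  | zero => rfl
  | succ k ih =>
    rw [lastCost, lastCost, ih (fun j h1 h2 => h j (by omega) h2) (by omega),
      h _ (by omega) (by omega)]

lemma costMat_congr {N h : ℕ} {Kt Kt' : ℕ → Matrix (Fin m) (Fin n) ℝ}
    (hK : ∀ j, h ≤ j → j < N → Kt j = Kt' j) : S.costMat N Kt h = S.costMat N Kt' h :=
  lastCost_congr (fun j h1 h2 => hK j (by omega) h2) (by omega)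

lemma stageAccurate_congr {N h : ℕ} {ε : ℝ} {Kt Kt' : ℕ → Matrix (Fin m) (Fin n) ℝ}
    (hK : ∀ j, h ≤ j → j < N → Kt j = Kt' j) (hh : h < N) :
    S.StageAccurate N ε Kt h ↔ S.StageAccurate N ε Kt' h := by
  rw [StageAccurate, StageAccurate, hK h le_rfl hh,
    costMat_congr (S := S) fun j h1 h2 => hK j (by omega) h2]

lemma lastCost_posSemidef (hQ : S.Q.PosDef) (hR : S.R.PosDef) (hT : S.QN.PosSemidef) (N : ℕ)
    (Kt : ℕ → Matrix (Fin m) (Fin n) ℝ) (k : ℕ) : (S.lastCost N Kt k).PosSemidef := by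
  induction k with
  | zero => exact hT
  | succ k ih => exact stageMat_posSemidef hQ hR _ ih

lemma costMat_posSemidef (hQ : S.Q.PosDef) (hR : S.R.PosDef) (hT : S.QN.PosSemidef) (N : ℕ)
    (Kt : ℕ → Matrix (Fin m) (Fin n) ℝ) (h : ℕ) : (S.costMat N Kt h).PosSemidef :=
  lastCost_posSemidef hQ hR hT N Kt _

/-- The Riccati difference equation gives the least cost-to-go. -/
lemma rde_le_costMat (hQ : S.Q.PosDef) (hR : S.R.PosDef) (hT : S.QN.PosSemidef) {N : ℕ}
    (Kt : ℕ → Matrix (Fin m) (Fin n) ℝ) {h : ℕ} (hh : h ≤ N) :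
    ∀ x, qf (S.rde N h) x ≤ qf (S.costMat N Kt h) x := by
  induction hh using Nat.decreasingInduction with
  | self => intro x; rw [rde_self, costMat_self]
  | of_succ k hk ih =>
    intro x
    rw [rde_eq_riccati hk, costMat_eq hk]
    exact (riccati_mono hQ hR (rde_posSemidef hQ hR hT _ _)
      (costMat_posSemidef hQ hR hT _ _ _) ih x).trans
      (riccati_le_stageMat hR (costMat_posSemidef hQ hR hT _ _ _) _ x)

/-! ### Parameters of the algorithm -/

lemma ca_pos (hn : 0 < n) (hQ : S.Q.PosDef) : 0 < S.ca := half_pos (sigmaMin_pos hn hQ)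

lemma two_ca_mul_le (hQ : S.Q.PosDef) (x : Fin n → ℝ) : 2 * S.ca * (x ⬝ᵥ x) ≤ qf S.Q x := by
  have := sigmaMin_mul_le_qf hQ x
  rw [ca]; linarith

lemma le_iSup_fin {N : ℕ} (f : Fin N → ℝ) (i : Fin N) : f i ≤ ⨆ t, f t :=
  le_ciSup (Set.finite_range f).bddAbove i

lemma specNorm_rde_le_pMax {N h : ℕ} (hh : h < N) : specNorm (S.rde N (h + 1)) ≤ S.pMax N :=
  le_iSup_fin (fun t : Fin N => specNorm (S.rde N (t + 1))) ⟨h, hh⟩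

lemma pMax_nonneg (N : ℕ) : 0 ≤ S.pMax N := Real.iSup_nonneg fun _ => specNorm_nonneg _

lemma phi_nonneg (N : ℕ) : 0 ≤ S.phi N := Real.iSup_nonneg fun _ => specNorm_nonneg _

lemma c1_nonneg (hm : 0 < m) (hR : S.R.PosDef) (N : ℕ) : 0 ≤ S.c1 N :=
  div_nonneg (mul_nonneg (phi_nonneg N) (specNorm_nonneg _)) (lambdaMin_pos hm hR).le

lemma c3_nonneg (N : ℕ) : 0 ≤ S.c3 N :=
  mul_nonneg two_pos.le (Real.iSup_nonneg fun _ => specNorm_nonneg _)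

/-- The input weights of near-optimal cost-to-go matrices are bounded by `C₃ / 2`. -/
lemma qf_inputWeight_le_c3 {N h : ℕ} (hh : h < N) {P : Matrix (Fin n) (Fin n) ℝ}
    (hle : ∀ x, qf P x ≤ qf (S.rde N (h + 1)) x + S.ca * (x ⬝ᵥ x)) (u : Fin m → ℝ) :
    qf (S.inputWeight P) u ≤ S.c3 N / 2 * (u ⬝ᵥ u) := by
  have h1 : specNorm (S.R + S.Bᵀ * (S.rde N (h + 1) + S.ca • 1) * S.B) ≤ S.c3 N / 2 := by
    rw [c3, mul_div_cancel_left₀ _ two_ne_zero]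
    exact le_iSup_fin (fun t : Fin N => specNorm (S.R + S.Bᵀ * (S.rde N (t + 1)
      + S.ca • (1 : Matrix (Fin n) (Fin n) ℝ)) * S.B)) ⟨h, hh⟩
  refine le_trans ?_ (mul_le_mul_of_nonneg_right h1 (dotProduct_self_nonneg' u))
  refine le_trans ?_ (qf_le_specNorm _ u)
  rw [qf_inputWeight, qf_add, qf_congr, qf_add, qf_smul, qf_one]
  linarith [hle (S.B *ᵥ u)]

/-- $R+B^\top P^*_1B$ lies between $\sigma_{\min}(R)$ and $C_3/2$ as a form. This provides $C_3>0$,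
and a lower bound on $C_3$ that does not depend on the horizon. -/
lemma sigmaMin_le_c3 (hm : 0 < m) (hn : 0 < n) (hQ : S.Q.PosDef) (hR : S.R.PosDef)
    (hT : S.QN.PosSemidef) {N : ℕ} (hN : 1 ≤ N) : 2 * sigmaMin S.R ≤ S.c3 N := by
  have hx : (1 : Fin m → ℝ) ≠ 0 := fun h => by simpa using congrFun h ⟨0, hm⟩
  have h1 := qf_inputWeight_le_c3 (S := S) (N := N) (h := 0) (by omega)
    (P := S.rde N (0 + 1)) (fun x => le_add_of_nonneg_right
      (mul_nonneg (ca_pos hn hQ).le (dotProduct_self_nonneg' x))) 1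
  have h2 := sigmaMin_le_inputWeight hR (rde_posSemidef hQ hR hT N (0 + 1)) 1
  have := le_of_mul_le_mul_right (h2.trans h1) (dotProduct_self_pos' hx)
  linarith

lemma c3_pos (hm : 0 < m) (hn : 0 < n) (hQ : S.Q.PosDef) (hR : S.R.PosDef)
    (hT : S.QN.PosSemidef) {N : ℕ} (hN : 1 ≤ N) : 0 < S.c3 N := by
  linarith [sigmaMin_le_c3 hm hn hQ hR hT hN, sigmaMin_pos hm hR]

/-- The tolerance of the stages `h ≥ 1`. -/
lemma tol_sq_eq (hm : 0 < m) (hn : 0 < n) (hQ : S.Q.PosDef) (hR : S.R.PosDef) {N : ℕ} {ε : ℝ}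
    (hε : 0 < ε) {h : ℕ} (hh : 1 ≤ h) :
    S.tol N ε h ^ 2 = min (min (S.ca / S.c3 N * (1 / N))
        (S.ca / S.c3 N * (S.ca / (2 * Real.exp 1 * N * S.pMax N))))
      (min (S.ca / S.c3 N * (ε / (8 * Real.exp 1 * N * S.c1 N * S.pMax N)))
        (ε / (4 * S.c1 N * S.c3 N))) := by
  have ha := (ca_pos hn hQ).le
  have hp := pMax_nonneg (S := S) N
  have h1 := c1_nonneg hm hR N
  have h3 := c3_nonneg (S := S) N
  rw [tol, if_neg (by omega)]
  simp only [← Real.sqrt_monotone.map_min]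
  exact Real.sq_sqrt (le_min (le_min (by positivity) (by positivity))
    (le_min (by positivity) (by positivity)))

lemma tol_nonneg {N h : ℕ} {ε : ℝ} (hε : 0 < ε) : 0 ≤ S.tol N ε h := by
  rw [tol]
  split_ifs
  · positivity
  · exact le_min (le_min (Real.sqrt_nonneg _) (Real.sqrt_nonneg _))
      (le_min (Real.sqrt_nonneg _) (Real.sqrt_nonneg _))

/-- The relative loss `C₃ ς² / (4 a)` of one stage. -/
def stageLoss (S : LQR n m) (N : ℕ) (ε : ℝ) : ℝ := S.c3 N * S.tol N ε 1 ^ 2 / (4 * S.ca)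

lemma stageLoss_nonneg (hn : 0 < n) (hQ : S.Q.PosDef) (N : ℕ) (ε : ℝ) :
    0 ≤ S.stageLoss N ε :=
  div_nonneg (mul_nonneg (c3_nonneg N) (sq_nonneg _)) (by linarith [ca_pos hn hQ])

lemma one_le_exp_one : 1 ≤ Real.exp 1 := by
  have := Real.add_one_le_exp (1 : ℝ); linarith

/-- The accumulated loss of all stages stays below $aI$, which is the slack built into $C_3$. The
second term of the minimum defining $\varsigma$ gives $a/(8e)$, with room to spare; $p=0$ is
separated because $p$ is a divisor. -/
lemma mul_stageLoss_le_ca (hm : 0 < m) (hn : 0 < n) (hQ : S.Q.PosDef) (hR : S.R.PosDef)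
    (hT : S.QN.PosSemidef) {N : ℕ} (hN : 1 ≤ N) {ε : ℝ} (hε : 0 < ε) :
    N * S.stageLoss N ε * S.pMax N ≤ S.ca := by
  have ha := ca_pos hn hQ
  have h3 := c3_pos hm hn hQ hR hT hN
  have he := one_le_exp_one
  have hN0 : (0 : ℝ) < N := by exact_mod_cast hN
  rcases (pMax_nonneg (S := S) N).eq_or_lt with hp | hp
  · rw [← hp, mul_zero]; exact ha.le
  have ht : S.tol N ε 1 ^ 2 ≤ S.ca / S.c3 N * (S.ca / (2 * Real.exp 1 * N * S.pMax N)) := by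
    rw [tol_sq_eq hm hn hQ hR hε le_rfl]
    exact (min_le_left _ _).trans (min_le_right _ _)
  calc N * S.stageLoss N ε * S.pMax N
      = N * S.pMax N * S.c3 N / (4 * S.ca) * S.tol N ε 1 ^ 2 := by rw [stageLoss]; ring
    _ ≤ N * S.pMax N * S.c3 N / (4 * S.ca) *
        (S.ca / S.c3 N * (S.ca / (2 * Real.exp 1 * N * S.pMax N))) :=
        mul_le_mul_of_nonneg_left ht (by positivity)
    _ = S.ca * (1 / (8 * Real.exp 1)) := by field_simp; ring
    _ ≤ S.ca * 1 := mul_le_mul_of_nonneg_left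
        (by rw [div_le_one (by positivity)]; linarith) ha.le
    _ = S.ca := mul_one _

/-- $C_1$ is the Lipschitz constant from cost-to-go to gain, so this is the share of the propagated
error in the final accuracy. It comes from the third term of the minimum. -/
lemma c1_mul_stageLoss_le (hm : 0 < m) (hn : 0 < n) (hQ : S.Q.PosDef) (hR : S.R.PosDef)
    (hT : S.QN.PosSemidef) {N : ℕ} (hN : 1 ≤ N) {ε : ℝ} (hε : 0 < ε) :
    S.c1 N * (N * S.stageLoss N ε * S.pMax N) ≤ ε / 4 := by
  have ha := ca_pos hn hQ
  have h3 := c3_pos hm hn hQ hR hT hN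
  have he := one_le_exp_one
  have hN0 : (0 : ℝ) < N := by exact_mod_cast hN
  rcases (pMax_nonneg (S := S) N).eq_or_lt with hp | hp
  · rw [← hp, mul_zero, mul_zero]; positivity
  rcases (c1_nonneg hm hR N).eq_or_lt with h1 | h1
  · rw [← h1, zero_mul]; positivity
  have ht : S.tol N ε 1 ^ 2
      ≤ S.ca / S.c3 N * (ε / (8 * Real.exp 1 * N * S.c1 N * S.pMax N)) := by
    rw [tol_sq_eq hm hn hQ hR hε le_rfl]
    exact (min_le_right _ _).trans (min_le_left _ _)
  calc S.c1 N * (N * S.stageLoss N ε * S.pMax N)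
      = S.c1 N * N * S.pMax N * S.c3 N / (4 * S.ca) * S.tol N ε 1 ^ 2 := by rw [stageLoss]; ring
    _ ≤ S.c1 N * N * S.pMax N * S.c3 N / (4 * S.ca) *
        (S.ca / S.c3 N * (ε / (8 * Real.exp 1 * N * S.c1 N * S.pMax N))) :=
        mul_le_mul_of_nonneg_left ht (by positivity)
    _ = ε / 4 * (1 / (8 * Real.exp 1)) := by field_simp
    _ ≤ ε / 4 * 1 := mul_le_mul_of_nonneg_left
        (by rw [div_le_one (by positivity)]; linarith) (by positivity)
    _ = ε / 4 := mul_one _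

/-! ### Propagation of the stage errors -/

lemma tol_eq_tol_one {N h : ℕ} {ε : ℝ} (hh : 1 ≤ h) : S.tol N ε h = S.tol N ε 1 := by
  rw [tol, tol, if_neg (by omega), if_neg one_ne_zero]

lemma qf_rde_le_pMax {N h : ℕ} (h1 : 1 ≤ h) (hh : h ≤ N) (x : Fin n → ℝ) :
    qf (S.rde N h) x ≤ S.pMax N * (x ⬝ᵥ x) := by
  obtain ⟨k, rfl⟩ : ∃ k, h = k + 1 := ⟨h - 1, by omega⟩
  exact (qf_le_specNorm _ x).trans
    (mul_le_mul_of_nonneg_right (specNorm_rde_le_pMax hh) (dotProduct_self_nonneg' x))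

/-- Losses are measured relative to the optimal cost, so they add up instead of compounding. The
factor $1+(N-h-1)\eta$ passes unchanged through $\mathcal R$ by `riccati_le_mul`, and the gain error
at stage $h$ contributes a further $\eta P^*_h$. The restriction $1\le h$ excludes stage $0$, whose
tolerance is different. -/
lemma costMat_le_mul_rde (hm : 0 < m) (hn : 0 < n) (hQ : S.Q.PosDef) (hR : S.R.PosDef)
    (hT : S.QN.PosSemidef) {N : ℕ} (hN : 1 ≤ N) {ε : ℝ} (hε : 0 < ε)
    {Kt : ℕ → Matrix (Fin m) (Fin n) ℝ} {h : ℕ} (hh : h ≤ N) :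
    1 ≤ h → (∀ j, h ≤ j → j < N → S.StageAccurate N ε Kt j) →
      ∀ x, qf (S.costMat N Kt h) x
        ≤ qf (S.rde N h) x + (N - h) * S.stageLoss N ε * qf (S.rde N h) x := by
  have ha := ca_pos hn hQ
  have h3 := c3_pos hm hn hQ hR hT hN
  have hη := stageLoss_nonneg hn hQ N ε (S := S)
  induction hh using Nat.decreasingInduction with
  | self => intro _ _ x; rw [rde_self, costMat_self]; simp
  | of_succ k hk ih =>
    intro h1 hacc x
    have hP := costMat_posSemidef hQ hR hT N Kt (k + 1)
    have hr := rde_posSemidef hQ hR hT N (k + 1)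
    have ih' := ih (by omega) fun j h1 h2 => hacc j (by omega) h2
    have hNk : (0 : ℝ) ≤ N - (k + 1 : ℕ) := by
      rw [sub_nonneg]; exact_mod_cast hk
    -- The bound $P_{k+1}\preceq P^*_{k+1}+aI$ is recovered from the induction hypothesis and $N\eta
    -- p\le a$; it is what allows the input weight to be estimated by $C_3/2$.
    have hle : ∀ x, qf (S.costMat N Kt (k + 1)) x
        ≤ qf (S.rde N (k + 1)) x + S.ca * (x ⬝ᵥ x) := by
      intro x
      refine (ih' x).trans (add_le_add le_rfl ?_)
      have h4 := qf_rde_le_pMax (S := S) (N := N) (h := k + 1) (by omega) hk x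
      have hx := dotProduct_self_nonneg' x
      calc (N - (k + 1 : ℕ)) * S.stageLoss N ε * qf (S.rde N (k + 1)) x
          ≤ N * S.stageLoss N ε * (S.pMax N * (x ⬝ᵥ x)) := by
            refine mul_le_mul (mul_le_mul_of_nonneg_right ?_ hη) h4 (qf_nonneg hr x)
              (by positivity)
            have : (0 : ℝ) ≤ ((k + 1 : ℕ) : ℝ) := Nat.cast_nonneg _
            linarith
        _ = (N * S.stageLoss N ε * S.pMax N) * (x ⬝ᵥ x) := by ring
        _ ≤ S.ca * (x ⬝ᵥ x) :=
          mul_le_mul_of_nonneg_right (mul_stageLoss_le_ca hm hn hQ hR hT hN hε) hx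
    have hs : 1 ≤ 1 + (N - (k + 1 : ℕ)) * S.stageLoss N ε :=
      le_add_of_nonneg_right (mul_nonneg hNk hη)
    have h5 := riccati_le_mul hQ hR hP hr hs (fun x => (ih' x).trans_eq (by ring)) x
    rw [← rde_eq_riccati hk] at h5
    set D := Kt k - S.gain (S.costMat N Kt (k + 1)) with hD
    -- The excess is at most $\frac{C_3}2\varsigma^2|x|^2$, and $2a|x|^2\le x^\top Qx\le x^\top
    -- P^*_kx$ makes it a relative loss $\frac{C_3\varsigma^2}{4a}=\eta$.
    have h6 : qf (S.inputWeight (S.costMat N Kt (k + 1))) (D *ᵥ x)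
        ≤ S.stageLoss N ε * qf (S.rde N k) x := by
      have hx := dotProduct_self_nonneg' x
      have h7 : frobSq D ≤ S.tol N ε 1 ^ 2 := by
        have := hacc k le_rfl hk
        rwa [StageAccurate, tol_eq_tol_one h1] at this
      have h8 : 2 * S.ca * (x ⬝ᵥ x) ≤ qf (S.rde N k) x := by
        rw [rde_eq_riccati hk]
        exact (two_ca_mul_le hQ x).trans (le_riccati hR hr x)
      calc _ ≤ S.c3 N / 2 * ((D *ᵥ x) ⬝ᵥ (D *ᵥ x)) := qf_inputWeight_le_c3 hk hle _
        _ ≤ S.c3 N / 2 * (S.tol N ε 1 ^ 2 * (x ⬝ᵥ x)) := by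
          refine mul_le_mul_of_nonneg_left ?_ (by positivity)
          exact (mulVec_sq_le_frobSq D x).trans (mul_le_mul_of_nonneg_right h7 hx)
        _ = S.stageLoss N ε * (2 * S.ca * (x ⬝ᵥ x)) := by
          rw [stageLoss]; field_simp; ring
        _ ≤ _ := mul_le_mul_of_nonneg_left h8 hη
    rw [costMat_eq hk, qf_stageMat_eq hR hP]
    push_cast at h5
    linarith

lemma costMat_le_rde_add (hm : 0 < m) (hn : 0 < n) (hQ : S.Q.PosDef) (hR : S.R.PosDef)
    (hT : S.QN.PosSemidef) {N : ℕ} (hN : 1 ≤ N) {ε : ℝ} (hε : 0 < ε)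
    {Kt : ℕ → Matrix (Fin m) (Fin n) ℝ} {h : ℕ} (hh : h ≤ N) (h1 : 1 ≤ h)
    (hacc : ∀ j, h ≤ j → j < N → S.StageAccurate N ε Kt j) (x : Fin n → ℝ) :
    qf (S.costMat N Kt h) x
      ≤ qf (S.rde N h) x + N * S.stageLoss N ε * S.pMax N * (x ⬝ᵥ x) := by
  have hη := stageLoss_nonneg hn hQ N ε (S := S)
  refine (costMat_le_mul_rde hm hn hQ hR hT hN hε hh h1 hacc x).trans (add_le_add le_rfl ?_)
  rw [mul_assoc (N * S.stageLoss N ε)]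
  refine mul_le_mul (mul_le_mul_of_nonneg_right ?_ hη) (qf_rde_le_pMax h1 hh x)
    (qf_nonneg (rde_posSemidef hQ hR hT N h) x) (by positivity)
  have : (0 : ℝ) ≤ (h : ℝ) := Nat.cast_nonneg _
  linarith

lemma costMat_le_rde_add_ca (hm : 0 < m) (hn : 0 < n) (hQ : S.Q.PosDef) (hR : S.R.PosDef)
    (hT : S.QN.PosSemidef) {N : ℕ} (hN : 1 ≤ N) {ε : ℝ} (hε : 0 < ε)
    {Kt : ℕ → Matrix (Fin m) (Fin n) ℝ} {h : ℕ} (hh : h ≤ N) (h1 : 1 ≤ h)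
    (hacc : ∀ j, h ≤ j → j < N → S.StageAccurate N ε Kt j) (x : Fin n → ℝ) :
    qf (S.costMat N Kt h) x ≤ qf (S.rde N h) x + S.ca * (x ⬝ᵥ x) :=
  (costMat_le_rde_add hm hn hQ hR hT hN hε hh h1 hacc x).trans
    (add_le_add le_rfl (mul_le_mul_of_nonneg_right (mul_stageLoss_le_ca hm hn hQ hR hT hN hε)
      (dotProduct_self_nonneg' x)))

/-- If all stages are accurate, then the first gain is `ε`-close to `K*`. -/
lemma specNorm_sub_gain_le_of_stageAccurate (hm : 0 < m) (hn : 0 < n) (hQ : S.Q.PosDef)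
    (hR : S.R.PosDef) (hA : IsUnit S.A) {P : Matrix (Fin n) (Fin n) ℝ} (hP : S.IsARESolution P)
    (hQN : (S.QN - P).PosSemidef) {ε : ℝ} (hε : 0 < ε) {Kt : ℕ → Matrix (Fin m) (Fin n) ℝ}
    (hacc : ∀ j < S.horizon P ε, S.StageAccurate (S.horizon P ε) ε Kt j) :
    specNorm (Kt 0 - S.gain P) ≤ ε := by
  have hT := terminal_posSemidef hP hQN
  have hfar := specNorm_optGain_horizon_sub_le hn hm hQ hR hA hP hQN hε
  have hN : 1 ≤ S.horizon P ε := one_le_horizon ε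
  generalize S.horizon P ε = N at *
  have hη := stageLoss_nonneg hn hQ N ε (S := S)
  have hC := costMat_posSemidef hQ hR hT N Kt 1
  have hr := rde_posSemidef hQ hR hT N 1
  have h1 : specNorm (Kt 0 - S.gain (S.costMat N Kt 1)) ≤ ε / 4 := by
    refine specNorm_le_of_frobSq (by positivity) ?_
    have := hacc 0 (by omega)
    rwa [StageAccurate, tol, if_pos rfl] at this
  have h2 : specNorm (S.costMat N Kt 1 - S.rde N 1) ≤ N * S.stageLoss N ε * S.pMax N := by
    refine specNorm_le_of_qf (posSemidef_iff_qf.2 ⟨?_, fun x => ?_⟩)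
      (mul_nonneg (by positivity) (pMax_nonneg N)) fun x => ?_
    · rw [Matrix.transpose_sub, posSemidef_transpose hC, posSemidef_transpose hr]
    · rw [qf_sub]; linarith [rde_le_costMat hQ hR hT Kt hN x]
    · rw [qf_sub]
      linarith [costMat_le_rde_add hm hn hQ hR hT hN hε hN le_rfl
        (fun j _ h2 => hacc j h2) x]
  have h3 : specNorm (S.gain (S.costMat N Kt 1) - S.optGain N 0) ≤ ε / 4 := by
    refine (specNorm_gain_sub_le hm hR hC hr).trans ?_
    have hphi : specNorm (S.A - S.B * S.gain (S.rde N 1)) ≤ S.phi N :=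
      le_iSup_fin (fun t : Fin N => specNorm (S.A - S.B * S.optGain N t)) ⟨0, hN⟩
    have hl := lambdaMin_pos hm hR
    have hB := specNorm_nonneg S.B
    refine le_trans ?_ (c1_mul_stageLoss_le hm hn hQ hR hT hN hε)
    rw [c1, div_mul_eq_mul_div]
    refine div_le_div_of_nonneg_right ?_ hl.le
    calc _ ≤ specNorm S.B * (N * S.stageLoss N ε * S.pMax N) * S.phi N :=
          mul_le_mul (mul_le_mul_of_nonneg_left h2 hB) hphi (specNorm_nonneg _)
            (mul_nonneg hB ((specNorm_nonneg _).trans h2))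
      _ = _ := by ring
  -- Inner error $\varepsilon/4$, propagated error $\varepsilon/4$, finite-horizon error
  -- $\varepsilon/2$.
  have e : Kt 0 - S.gain P = (Kt 0 - S.gain (S.costMat N Kt 1))
      + (S.gain (S.costMat N Kt 1) - S.optGain N 0) + (S.optGain N 0 - S.gain P) := by abel
  rw [e]
  have h4 := specNorm_add_le ((Kt 0 - S.gain (S.costMat N Kt 1))
      + (S.gain (S.costMat N Kt 1) - S.optGain N 0)) (S.optGain N 0 - S.gain P)
  have h5 := specNorm_add_le (Kt 0 - S.gain (S.costMat N Kt 1))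
    (S.gain (S.costMat N Kt 1) - S.optGain N 0)
  linarith

/-! ### Rollouts -/

/-- After its first step, a rollout from stage $h$ is a rollout from stage $h+1$ whose first input
is again given by the table. This is the recursion behind `costToGo_step`. -/
lemma rollout_succ (Kt : ℕ → Matrix (Fin m) (Fin n) ℝ) (h : ℕ) (x : Fin n → ℝ) (u : Fin m → ℝ)
    (i : ℕ) :
    S.rollout Kt h x u (i + 1) = S.rollout Kt (h + 1) (S.A *ᵥ x + S.B *ᵥ u)
      (-(Kt (h + 1) *ᵥ (S.A *ᵥ x + S.B *ᵥ u))) i := by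
  induction i with
  | zero => simp [rollout]
  | succ i ih =>
    rw [rollout, ih, rollout, if_neg (by omega)]
    by_cases hi : i = 0
    · subst hi; simp [rollout]
    · rw [if_neg hi, show h + (i + 1) = h + 1 + i by ring]

lemma rolloutInput_succ (Kt : ℕ → Matrix (Fin m) (Fin n) ℝ) (h : ℕ) (x : Fin n → ℝ)
    (u : Fin m → ℝ) (i : ℕ) :
    S.rolloutInput Kt h x u (i + 1) = S.rolloutInput Kt (h + 1) (S.A *ᵥ x + S.B *ᵥ u)
      (-(Kt (h + 1) *ᵥ (S.A *ᵥ x + S.B *ᵥ u))) i := by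
  rw [rolloutInput, rolloutInput, if_neg (by omega), rollout_succ]
  by_cases hi : i = 0
  · subst hi; simp [rollout]
  · rw [if_neg hi, show h + (i + 1) = h + 1 + i by ring]

lemma costToGo_step {N h : ℕ} (hh : h < N) (Kt : ℕ → Matrix (Fin m) (Fin n) ℝ) (x : Fin n → ℝ)
    (u : Fin m → ℝ) :
    S.costToGo N Kt h x u = qf S.Q x + qf S.R u
      + S.costToGo N Kt (h + 1) (S.A *ᵥ x + S.B *ᵥ u)
        (-(Kt (h + 1) *ᵥ (S.A *ᵥ x + S.B *ᵥ u))) := by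
  rw [costToGo, costToGo, show N - h = N - (h + 1) + 1 by omega, Finset.sum_range_succ']
  simp only [rollout_succ, rolloutInput_succ]
  simp only [rollout, rolloutInput, if_true, qf]
  ring

lemma costToGo_closed {N h : ℕ} (hh : h ≤ N) (Kt : ℕ → Matrix (Fin m) (Fin n) ℝ) :
    ∀ x, S.costToGo N Kt h x (-(Kt h *ᵥ x)) = qf (S.costMat N Kt h) x := by
  induction hh using Nat.decreasingInduction with
  | self => intro x; simp [costToGo, costMat_self, rollout, qf]
  | of_succ k hk ih =>
    intro x
    rw [costToGo_step hk, ih, costMat_eq hk, qf_stageMat]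
    have e : S.A *ᵥ x + S.B *ᵥ -(Kt k *ᵥ x) = (S.A - S.B * Kt k) *ᵥ x := by
      rw [Matrix.sub_mulVec, Matrix.mulVec_neg, Matrix.mulVec_mulVec, sub_eq_add_neg]
    rw [e]
    simp [qf, Matrix.mulVec_neg]

/-- The observed cost in terms of the cost-to-go matrix of the next stage. -/
lemma costToGo_eq {N h : ℕ} (hh : h < N) (Kt : ℕ → Matrix (Fin m) (Fin n) ℝ) (x : Fin n → ℝ)
    (u : Fin m → ℝ) :
    S.costToGo N Kt h x u
      = qf S.Q x + qf S.R u + qf (S.costMat N Kt (h + 1)) (S.A *ᵥ x + S.B *ᵥ u) := by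
  rw [costToGo_step hh, costToGo_closed hh]

lemma costToGo_neg_mulVec {N h : ℕ} (hh : h < N) (Kt : ℕ → Matrix (Fin m) (Fin n) ℝ)
    (K : Matrix (Fin m) (Fin n) ℝ) (x : Fin n → ℝ) :
    S.costToGo N Kt h x (-(K *ᵥ x)) = qf (S.stageMat K (S.costMat N Kt (h + 1))) x := by
  rw [costToGo_eq hh, qf_stageMat]
  have e : S.A *ᵥ x + S.B *ᵥ -(K *ᵥ x) = (S.A - S.B * K) *ᵥ x := by
    rw [Matrix.sub_mulVec, Matrix.mulVec_neg, Matrix.mulVec_mulVec, sub_eq_add_neg]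
  rw [e]
  simp [qf, Matrix.mulVec_neg]

end LQR

/-! ### Moments of the standard Gaussian vector -/

section Gaussian

/-- The polynomials with `(d/dt)^k exp (t² / 2) = p_k(t) exp (t² / 2)`. -/
def gaussianMomentPoly : ℕ → Polynomial ℝ
  | 0 => 1
  | k + 1 => (gaussianMomentPoly k).derivative + Polynomial.X * gaussianMomentPoly k

lemma iteratedDeriv_exp_sq_half (k : ℕ) :
    iteratedDeriv k (fun t : ℝ => Real.exp (t ^ 2 / 2))
      = fun t => (gaussianMomentPoly k).eval t * Real.exp (t ^ 2 / 2) := by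
  induction k with
  | zero => simp [gaussianMomentPoly]
  | succ k ih =>
    rw [iteratedDeriv_succ, ih]
    funext t
    have h1 : HasDerivAt (fun t : ℝ => Real.exp (t ^ 2 / 2)) (Real.exp (t ^ 2 / 2) * t) t := by
      have : HasDerivAt (fun t : ℝ => t ^ 2 / 2) t t := by
        have := (hasDerivAt_pow 2 t).div_const 2
        convert! this using 1
        norm_num
      exact this.exp
    have h2 := ((gaussianMomentPoly k).hasDerivAt t).mul h1
    refine h2.deriv.trans ?_
    simp only [gaussianMomentPoly, Polynomial.eval_add, Polynomial.eval_mul, Polynomial.eval_X]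
    ring

/-- Moments are the derivatives at $0$ of the moment generating function $e^{t^2/2}$, and these are
computed by the polynomial recursion. -/
lemma integral_pow_gaussianReal (k : ℕ) :
    ∫ y, y ^ k ∂(gaussianReal 0 1) = (gaussianMomentPoly k).eval 0 := by
  have h0 : (0 : ℝ) ∈ interior (integrableExpSet id (gaussianReal 0 1)) := by
    rw [integrableExpSet_id_gaussianReal, interior_univ]; trivial
  have h1 := iteratedDeriv_mgf_zero h0 k
  have h2 : mgf id (gaussianReal 0 1) = fun t : ℝ => Real.exp (t ^ 2 / 2) := by
    rw [mgf_id_gaussianReal]; funext t; simp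
  rw [h2, iteratedDeriv_exp_sq_half] at h1
  simpa using h1.symm

lemma integrable_pow_gaussianReal (k : ℕ) :
    Integrable (fun y : ℝ => y ^ k) (gaussianReal 0 1) := by
  have h := (memLp_id_gaussianReal (μ := 0) (v := 1) (k : NNReal)).integrable_norm_pow'
  refine h.mono' (by fun_prop) (Filter.Eventually.of_forall fun y => ?_)
  simp

/-- The law of a standard Gaussian vector. -/
abbrev stdGaussianPi (m : ℕ) : Measure (Fin m → ℝ) := Measure.pi fun _ : Fin m => gaussianReal 0 1

/-- Splits off one coordinate of the Gaussian vector, for inductions on the dimension. -/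
lemma integral_stdGaussianPi_succ {m : ℕ} (f : (Fin (m + 1) → ℝ) → ℝ) (g : ℝ × (Fin m → ℝ) → ℝ)
    (hfg : ∀ y s, f (Fin.cons y s) = g (y, s)) :
    (Integrable g ((gaussianReal 0 1).prod (stdGaussianPi m)) →
      Integrable f (stdGaussianPi (m + 1))) ∧
    ∫ η, f η ∂(stdGaussianPi (m + 1)) = ∫ z, g z ∂((gaussianReal 0 1).prod (stdGaussianPi m)) := by
  have hmp := (measurePreserving_piFinSuccAbove (fun _ : Fin (m + 1) => gaussianReal 0 1) 0)
  have he : ∀ η, f η = g (MeasurableEquiv.piFinSuccAbove (fun _ => ℝ) 0 η) := by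
    intro η
    conv_lhs => rw [← Fin.cons_self_tail η]
    rw [hfg]
    rfl
  have he' : f = g ∘ (MeasurableEquiv.piFinSuccAbove (fun _ => ℝ) 0) := funext he
  constructor
  · intro h
    rw [he']
    exact (hmp.integrable_comp_emb (MeasurableEquiv.measurableEmbedding _)).2 h
  · rw [he']
    exact hmp.integral_comp (MeasurableEquiv.measurableEmbedding _) g

/-- Moments of the $\chi^2_m$ law, by induction on $m$: expand $(y^2+|s|^2)^k$ and insert the scalar
moments $1,3,15$. These are the numbers occurring in $\xi_{h,3}$. -/
lemma stdGaussianPi_moments (m : ℕ) :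
    (∀ k ≤ 3, Integrable (fun η : Fin m → ℝ => (η ⬝ᵥ η) ^ k) (stdGaussianPi m)) ∧
    ∫ η : Fin m → ℝ, η ⬝ᵥ η ∂(stdGaussianPi m) = m ∧
    ∫ η : Fin m → ℝ, (η ⬝ᵥ η) ^ 2 ∂(stdGaussianPi m) = m * (m + 2) ∧
    ∫ η : Fin m → ℝ, (η ⬝ᵥ η) ^ 3 ∂(stdGaussianPi m) = m * (m + 2) * (m + 4) := by
  induction m with
  | zero =>
    refine ⟨fun k _ => ?_, by simp, by simp, by simp⟩
    have : (fun η : Fin 0 → ℝ => (η ⬝ᵥ η) ^ k) = fun _ => (0 : ℝ) ^ k := by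
      funext η; simp
    rw [this]
    exact integrable_const _
  | succ m ih =>
    obtain ⟨hi, h1, h2, h3⟩ := ih
    have hi1 : Integrable (fun η : Fin m → ℝ => η ⬝ᵥ η) (stdGaussianPi m) := by
      simpa using hi 1 (by norm_num)
    have hi2 := hi 2 (by norm_num)
    have hi3 := hi 3 (by norm_num)
    have g2 : ∫ y, y ^ 2 ∂(gaussianReal 0 1) = 1 := by
      rw [integral_pow_gaussianReal]; simp [gaussianMomentPoly]
    have g4 : ∫ y, y ^ 4 ∂(gaussianReal 0 1) = 3 := by
      rw [integral_pow_gaussianReal]; simp [gaussianMomentPoly]; norm_num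
    have g6 : ∫ y, y ^ 6 ∂(gaussianReal 0 1) = 15 := by
      rw [integral_pow_gaussianReal]; simp [gaussianMomentPoly]; norm_num
    have i2 := integrable_pow_gaussianReal 2
    have i4 := integrable_pow_gaussianReal 4
    have i6 := integrable_pow_gaussianReal 6
    have hc : ∀ (y : ℝ) (s : Fin m → ℝ),
        (Fin.cons y s : Fin (m + 1) → ℝ) ⬝ᵥ (Fin.cons y s : Fin (m + 1) → ℝ)
          = y ^ 2 + s ⬝ᵥ s := by
      intro y s
      simp [dotProduct, Fin.sum_univ_succ, pow_two]
    let ν := (gaussianReal 0 1).prod (stdGaussianPi m)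
    have a1 : Integrable (fun z : ℝ × (Fin m → ℝ) => z.1 ^ 2) ν := i2.comp_fst _
    have a2 : Integrable (fun z : ℝ × (Fin m → ℝ) => z.2 ⬝ᵥ z.2) ν := hi1.comp_snd _
    have b1 : Integrable (fun z : ℝ × (Fin m → ℝ) => z.1 ^ 4) ν := i4.comp_fst _
    have b2 : Integrable (fun z : ℝ × (Fin m → ℝ) => z.1 ^ 2 * (z.2 ⬝ᵥ z.2)) ν := i2.mul_prod hi1
    have b3 : Integrable (fun z : ℝ × (Fin m → ℝ) => (z.2 ⬝ᵥ z.2) ^ 2) ν := hi2.comp_snd _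
    have c1 : Integrable (fun z : ℝ × (Fin m → ℝ) => z.1 ^ 6) ν := i6.comp_fst _
    have c2 : Integrable (fun z : ℝ × (Fin m → ℝ) => z.1 ^ 4 * (z.2 ⬝ᵥ z.2)) ν := i4.mul_prod hi1
    have c3 : Integrable (fun z : ℝ × (Fin m → ℝ) => z.1 ^ 2 * (z.2 ⬝ᵥ z.2) ^ 2) ν :=
      i2.mul_prod hi2
    have c4 : Integrable (fun z : ℝ × (Fin m → ℝ) => (z.2 ⬝ᵥ z.2) ^ 3) ν := hi3.comp_snd _
    have b2' : Integrable (fun z : ℝ × (Fin m → ℝ) => 2 * (z.1 ^ 2 * (z.2 ⬝ᵥ z.2))) ν :=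
      b2.const_mul 2
    have b12 : Integrable
        (fun z : ℝ × (Fin m → ℝ) => z.1 ^ 4 + 2 * (z.1 ^ 2 * (z.2 ⬝ᵥ z.2))) ν := b1.add b2'
    have c2' : Integrable (fun z : ℝ × (Fin m → ℝ) => 3 * (z.1 ^ 4 * (z.2 ⬝ᵥ z.2))) ν :=
      c2.const_mul 3
    have c3' : Integrable (fun z : ℝ × (Fin m → ℝ) => 3 * (z.1 ^ 2 * (z.2 ⬝ᵥ z.2) ^ 2)) ν :=
      c3.const_mul 3
    have c12 : Integrable
        (fun z : ℝ × (Fin m → ℝ) => z.1 ^ 6 + 3 * (z.1 ^ 4 * (z.2 ⬝ᵥ z.2))) ν := c1.add c2'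
    have c123 : Integrable (fun z : ℝ × (Fin m → ℝ) => z.1 ^ 6 + 3 * (z.1 ^ 4 * (z.2 ⬝ᵥ z.2))
        + 3 * (z.1 ^ 2 * (z.2 ⬝ᵥ z.2) ^ 2)) ν := c12.add c3'
    have f1 : ∀ f : ℝ → ℝ, ∫ z : ℝ × (Fin m → ℝ), f z.1 ∂ν = ∫ y, f y ∂(gaussianReal 0 1) := by
      intro f; simpa using integral_fun_fst (μ := gaussianReal 0 1) (ν := stdGaussianPi m) f
    have f2 : ∀ f : (Fin m → ℝ) → ℝ,
        ∫ z : ℝ × (Fin m → ℝ), f z.2 ∂ν = ∫ y, f y ∂(stdGaussianPi m) := by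
      intro f; simpa using integral_fun_snd (μ := gaussianReal 0 1) (ν := stdGaussianPi m) f
    have f3 : ∀ (f : ℝ → ℝ) (g : (Fin m → ℝ) → ℝ), ∫ z : ℝ × (Fin m → ℝ), f z.1 * g z.2 ∂ν
        = (∫ y, f y ∂(gaussianReal 0 1)) * ∫ y, g y ∂(stdGaussianPi m) :=
      fun f g => integral_prod_mul f g
    have s1 := integral_stdGaussianPi_succ (m := m) (fun η => η ⬝ᵥ η)
      (fun z => z.1 ^ 2 + z.2 ⬝ᵥ z.2) hc
    have s2 := integral_stdGaussianPi_succ (m := m) (fun η => (η ⬝ᵥ η) ^ 2)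
      (fun z => z.1 ^ 4 + 2 * (z.1 ^ 2 * (z.2 ⬝ᵥ z.2)) + (z.2 ⬝ᵥ z.2) ^ 2)
      (fun y s => by rw [hc]; ring)
    have s3 := integral_stdGaussianPi_succ (m := m) (fun η => (η ⬝ᵥ η) ^ 3)
      (fun z => z.1 ^ 6 + 3 * (z.1 ^ 4 * (z.2 ⬝ᵥ z.2)) + 3 * (z.1 ^ 2 * (z.2 ⬝ᵥ z.2) ^ 2)
        + (z.2 ⬝ᵥ z.2) ^ 3) (fun y s => by rw [hc]; ring)
    refine ⟨fun k hk => ?_, ?_, ?_, ?_⟩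
    · interval_cases k
      · simp
      · simpa using s1.1 (a1.add a2)
      · exact s2.1 (b12.add b3)
      · exact s3.1 (c123.add c4)
    · rw [s1.2, integral_add a1 a2, f1 (fun y => y ^ 2), f2 (fun s => s ⬝ᵥ s), g2, h1]
      push_cast; ring
    · rw [s2.2, integral_add b12 b3, integral_add b1 b2',
        integral_const_mul, f1 (fun y => y ^ 4), f3 (fun y => y ^ 2) (fun s => s ⬝ᵥ s),
        f2 (fun s => (s ⬝ᵥ s) ^ 2), g2, g4, h1, h2]
      push_cast; ring
    · rw [s3.2, integral_add c123 c4, integral_add c12 c3', integral_add c1 c2',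
        integral_const_mul, integral_const_mul, f1 (fun y => y ^ 6),
        f3 (fun y => y ^ 4) (fun s => s ⬝ᵥ s), f3 (fun y => y ^ 2) (fun s => (s ⬝ᵥ s) ^ 2),
        f2 (fun s => (s ⬝ᵥ s) ^ 3), g2, g4, g6, h1, h2, h3]
      push_cast; ring

/-- The law is invariant under $\eta\mapsto-\eta$, so the integral equals its own negative; no
integrability is needed. -/
lemma integral_odd_stdGaussianPi {m : ℕ} {f : (Fin m → ℝ) → ℝ} (hf : ∀ η, f (-η) = -f η) :
    ∫ η, f η ∂(stdGaussianPi m) = 0 := by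
  have h1 : (stdGaussianPi m).map (fun η => -η) = stdGaussianPi m := by
    have h2 : MeasurePreserving (fun y : ℝ => -y) (gaussianReal 0 1) (gaussianReal 0 1) :=
      ⟨measurable_neg, by rw [gaussianReal_map_neg, neg_zero]⟩
    exact (measurePreserving_pi (fun _ : Fin m => gaussianReal 0 1)
      (fun _ : Fin m => gaussianReal 0 1) (fun _ => h2)).map_eq
  have h3 : ∫ η, f η ∂(stdGaussianPi m) = ∫ η, f (-η) ∂(stdGaussianPi m) := by
    conv_lhs => rw [← h1]
    exact integral_map_equiv (MeasurableEquiv.neg (Fin m → ℝ)) f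
  simp only [hf, integral_neg] at h3
  linarith

lemma integral_mul_coord_stdGaussianPi {m : ℕ} (i j : Fin m) :
    ∫ η : Fin m → ℝ, η i * η j ∂(stdGaussianPi m) = if i = j then 1 else 0 := by
  -- Written as a product over all coordinates, so that the integral over the product measure
  -- factorizes.
  have h1 : ∀ η : Fin m → ℝ, η i * η j
      = ∏ k, ((if i = k then η k else 1) * (if j = k then η k else 1)) := by
    intro η
    rw [Finset.prod_mul_distrib, Finset.prod_ite_eq, Finset.prod_ite_eq]
    simp
  simp only [h1]
  rw [integral_fintype_prod_eq_prod (μ := fun _ : Fin m => gaussianReal 0 1)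
    (fun (k : Fin m) (y : ℝ) => (if i = k then y else 1) * (if j = k then y else 1))]
  split_ifs with hij
  · subst hij
    refine Finset.prod_eq_one fun k _ => ?_
    by_cases hk : i = k
    · have := integral_pow_gaussianReal 2
      simpa [hk, gaussianMomentPoly, pow_two] using this
    · simp [hk]
  · refine Finset.prod_eq_zero (Finset.mem_univ i) ?_
    have hji : ¬ j = i := fun h => hij h.symm
    simp [hji]

lemma integrable_mul_dotProduct_stdGaussianPi {m : ℕ} (v w : Fin m → ℝ) :
    Integrable (fun η : Fin m → ℝ => (η ⬝ᵥ v) * (η ⬝ᵥ w)) (stdGaussianPi m) := by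
  have hi : Integrable (fun η : Fin m → ℝ => η ⬝ᵥ η) (stdGaussianPi m) := by
    simpa using (stdGaussianPi_moments m).1 1 (by norm_num)
  refine (hi.mul_const (v ⬝ᵥ v + w ⬝ᵥ w)).mono' ?_ (Filter.Eventually.of_forall fun η => ?_)
  · simp only [dotProduct]; fun_prop
  · rw [Real.norm_eq_abs]
    have h1 := dotProduct_sq_le η v
    have h2 := dotProduct_sq_le η w
    rw [abs_le]
    constructor <;>
      nlinarith [sq_nonneg (η ⬝ᵥ v + η ⬝ᵥ w), sq_nonneg (η ⬝ᵥ v - η ⬝ᵥ w)]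

lemma integral_mul_dotProduct_stdGaussianPi {m : ℕ} (v w : Fin m → ℝ) :
    ∫ η : Fin m → ℝ, (η ⬝ᵥ v) * (η ⬝ᵥ w) ∂(stdGaussianPi m) = v ⬝ᵥ w := by
  have hi : ∀ i j : Fin m, Integrable (fun η : Fin m → ℝ => η i * η j) (stdGaussianPi m) := by
    intro i j
    simpa using integrable_mul_dotProduct_stdGaussianPi (Pi.single i (1 : ℝ)) (Pi.single j 1)
  have h1 : ∀ η : Fin m → ℝ, (η ⬝ᵥ v) * (η ⬝ᵥ w) = ∑ i, ∑ j, (η i * η j) * (v i * w j) := by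
    intro η
    rw [dotProduct, dotProduct, Finset.sum_mul_sum]
    exact Finset.sum_congr rfl fun i _ => Finset.sum_congr rfl fun j _ => by ring
  simp only [h1]
  rw [integral_finsetSum _ fun i _ => integrable_finsetSum _ fun j _ => (hi i j).mul_const _]
  rw [dotProduct]
  refine Finset.sum_congr rfl fun i _ => ?_
  rw [integral_finsetSum _ fun j _ => (hi i j).mul_const _]
  simp [integral_mul_const, integral_mul_coord_stdGaussianPi]

end Gaussian

namespace LQR

variable {n m : ℕ} {S : LQR n m}

/-! ### Second moments of the initial state -/

lemma integral_add_three {α : Type*} [MeasurableSpace α] {ν : Measure α} {f g k : α → ℝ}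
    (hf : Integrable f ν) (hg : Integrable g ν) (hk : Integrable k ν) :
    ∫ x, (f x + g x + k x) ∂ν = ∫ x, f x ∂ν + ∫ x, g x ∂ν + ∫ x, k x ∂ν := by
  have hfg : Integrable (fun x => f x + g x) ν := hf.add hg
  rw [integral_add hfg hk, integral_add hf hg]

section InitialLaw

variable {D : Measure (Fin n → ℝ)}

lemma IsInitialLaw.integrable_mul (hD : S.IsInitialLaw D) (u v : Fin n → ℝ) :
    Integrable (fun x => (u ⬝ᵥ x) * (v ⬝ᵥ x)) D := by
  have := hD.1
  refine (integrable_const ((u ⬝ᵥ u + v ⬝ᵥ v) * S.Cm)).mono' ?_ ?_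
  · simp only [dotProduct]; fun_prop
  · filter_upwards [hD.2.2.2] with x hx
    have h1 := dotProduct_sq_le u x
    have h2 := dotProduct_sq_le v x
    have hu := dotProduct_self_nonneg' u
    have hv := dotProduct_self_nonneg' v
    have h3 := mul_le_mul_of_nonneg_left hx (add_nonneg hu hv)
    rw [Real.norm_eq_abs, abs_le]
    constructor <;>
      nlinarith [sq_nonneg (u ⬝ᵥ x + v ⬝ᵥ x), sq_nonneg (u ⬝ᵥ x - v ⬝ᵥ x)]

lemma IsInitialLaw.integral_mul (hD : S.IsInitialLaw D) (u v : Fin n → ℝ) :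
    ∫ x, (u ⬝ᵥ x) * (v ⬝ᵥ x) ∂D = u ⬝ᵥ (S.Sigma0 *ᵥ v) := by
  have hi : ∀ i j : Fin n, Integrable (fun x : Fin n → ℝ => x i * x j) D := by
    intro i j
    simpa using hD.integrable_mul (Pi.single i (1 : ℝ)) (Pi.single j 1)
  have h1 : ∀ x : Fin n → ℝ, (u ⬝ᵥ x) * (v ⬝ᵥ x) = ∑ i, ∑ j, (x i * x j) * (u i * v j) := by
    intro x
    rw [dotProduct, dotProduct, Finset.sum_mul_sum]
    exact Finset.sum_congr rfl fun i _ => Finset.sum_congr rfl fun j _ => by ring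
  simp only [h1]
  rw [integral_finsetSum _ fun i _ => integrable_finsetSum _ fun j _ => (hi i j).mul_const _]
  rw [dotProduct]
  refine Finset.sum_congr rfl fun i _ => ?_
  rw [integral_finsetSum _ fun j _ => (hi i j).mul_const _]
  simp only [integral_mul_const, hD.2.2.1, Matrix.mulVec, dotProduct, Finset.mul_sum]
  exact Finset.sum_congr rfl fun j _ => by ring

lemma IsInitialLaw.integrable_mulVec {p : ℕ} (hD : S.IsInitialLaw D)
    (Y Z : Matrix (Fin p) (Fin n) ℝ) : Integrable (fun x => (Y *ᵥ x) ⬝ᵥ (Z *ᵥ x)) D :=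
  integrable_finsetSum _ fun i _ => hD.integrable_mul (Y i) (Z i)

lemma IsInitialLaw.integral_mulVec {p : ℕ} (hD : S.IsInitialLaw D)
    (Y Z : Matrix (Fin p) (Fin n) ℝ) :
    ∫ x, (Y *ᵥ x) ⬝ᵥ (Z *ᵥ x) ∂D = ∑ i, Y i ⬝ᵥ (S.Sigma0 *ᵥ Z i) := by
  have : ∀ x, (Y *ᵥ x) ⬝ᵥ (Z *ᵥ x) = ∑ i, (Y i ⬝ᵥ x) * (Z i ⬝ᵥ x) := fun x => rfl
  simp only [this]
  rw [integral_finsetSum _ fun i _ => hD.integrable_mul (Y i) (Z i)]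
  exact Finset.sum_congr rfl fun i _ => hD.integral_mul _ _

lemma IsInitialLaw.integrable_qf (hD : S.IsInitialLaw D) (M : Matrix (Fin n) (Fin n) ℝ) :
    Integrable (fun x => qf M x) D := by
  simpa [qf] using hD.integrable_mulVec 1 M

/-- The expectation is the pairing of $M$ with $\Sigma_0$, written row by row. As a linear
expression in the entries of $M$ it is measurable in $M$. -/
lemma IsInitialLaw.integral_qf (hD : S.IsInitialLaw D) (M : Matrix (Fin n) (Fin n) ℝ) :
    ∫ x, qf M x ∂D = ∑ i, (1 : Matrix (Fin n) (Fin n) ℝ) i ⬝ᵥ (S.Sigma0 *ᵥ M i) := by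
  rw [← hD.integral_mulVec]
  simp [qf]

lemma IsInitialLaw.integral_qf_le (hD : S.IsInitialLaw D) {M : Matrix (Fin n) (Fin n) ℝ} {c : ℝ}
    (hc : 0 ≤ c) (h : ∀ x, qf M x ≤ c * (x ⬝ᵥ x)) : ∫ x, qf M x ∂D ≤ c * S.Cm := by
  have := hD.1
  calc ∫ x, qf M x ∂D ≤ ∫ _, c * S.Cm ∂D := by
        refine integral_mono_ae (hD.integrable_qf M) (integrable_const _) ?_
        filter_upwards [hD.2.2.2] with x hx
        exact (h x).trans (mul_le_mul_of_nonneg_left hx hc)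
    _ = c * S.Cm := by simp

/-- The excess cost `E (Δ x)ᵀ W (Δ x)` of the gain error `Δ`. -/
def excess (D : Measure (Fin n → ℝ)) (W : Matrix (Fin m) (Fin m) ℝ)
    (Δ : Matrix (Fin m) (Fin n) ℝ) : ℝ := ∫ x, qf W (Δ *ᵥ x) ∂D

lemma IsInitialLaw.integrable_excess (hD : S.IsInitialLaw D) (W : Matrix (Fin m) (Fin m) ℝ)
    (Δ : Matrix (Fin m) (Fin n) ℝ) : Integrable (fun x => qf W (Δ *ᵥ x)) D := by
  simpa [qf, Matrix.mulVec_mulVec] using hD.integrable_mulVec Δ (W * Δ)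

lemma IsInitialLaw.excess_eq (hD : S.IsInitialLaw D) (W : Matrix (Fin m) (Fin m) ℝ)
    (Δ : Matrix (Fin m) (Fin n) ℝ) :
    excess D W Δ = ∑ i, Δ i ⬝ᵥ (S.Sigma0 *ᵥ (W * Δ) i) := by
  rw [← hD.integral_mulVec]
  simp [excess, qf, Matrix.mulVec_mulVec]

lemma excess_nonneg {W : Matrix (Fin m) (Fin m) ℝ} (hW : W.PosSemidef)
    (Δ : Matrix (Fin m) (Fin n) ℝ) : 0 ≤ excess D W Δ :=
  integral_nonneg fun _ => qf_nonneg hW _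

/-- The excess cost dominates the Frobenius norm of the gain error. -/
lemma IsInitialLaw.frobSq_le_excess (hD : S.IsInitialLaw D) (hSig : S.Sigma0.PosDef)
    {W : Matrix (Fin m) (Fin m) ℝ} {c : ℝ} (hc : 0 ≤ c) (hW : ∀ u, c * (u ⬝ᵥ u) ≤ qf W u)
    (Δ : Matrix (Fin m) (Fin n) ℝ) :
    sigmaMin S.Sigma0 * c * frobSq Δ ≤ excess D W Δ := by
  have h1 : sigmaMin S.Sigma0 * frobSq Δ ≤ ∫ x, (Δ *ᵥ x) ⬝ᵥ (Δ *ᵥ x) ∂D := by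
    rw [hD.integral_mulVec, frobSq, Finset.mul_sum]
    exact Finset.sum_le_sum fun i _ => sigmaMin_mul_le_qf hSig _
  calc sigmaMin S.Sigma0 * c * frobSq Δ = c * (sigmaMin S.Sigma0 * frobSq Δ) := by ring
    _ ≤ c * ∫ x, (Δ *ᵥ x) ⬝ᵥ (Δ *ᵥ x) ∂D := mul_le_mul_of_nonneg_left h1 hc
    _ = ∫ x, c * ((Δ *ᵥ x) ⬝ᵥ (Δ *ᵥ x)) ∂D := (integral_const_mul _ _).symm
    _ ≤ _ := integral_mono ((hD.integrable_mulVec Δ Δ).const_mul c) (hD.integrable_excess W Δ)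
        fun x => hW _

/-- Gradient domination of the excess cost. -/
lemma IsInitialLaw.excess_le_gradient (hD : S.IsInitialLaw D) (hSig : S.Sigma0.PosDef)
    (hσ : 0 ≤ sigmaMin S.Sigma0)
    {W : Matrix (Fin m) (Fin m) ℝ} {c : ℝ} (hc : 0 ≤ c) (hW : ∀ u, c * (u ⬝ᵥ u) ≤ qf W u)
    (Δ : Matrix (Fin m) (Fin n) ℝ) :
    sigmaMin S.Sigma0 * c * excess D W Δ
      ≤ ∫ x, ((W * Δ) *ᵥ x) ⬝ᵥ ((W * Δ * S.Sigma0) *ᵥ x) ∂D := by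
  have hs := posSemidef_transpose hSig.posSemidef
  -- The inequality `mul_qf_le_mulVec_sq` is used twice: here with $\Sigma_0$ on each row of
  -- $W\Delta$, and at the end with $W$ on $\Delta x$. Their constants multiply.
  have h1 : sigmaMin S.Sigma0 * (∫ x, ((W * Δ) *ᵥ x) ⬝ᵥ ((W * Δ) *ᵥ x) ∂D)
      ≤ ∫ x, ((W * Δ) *ᵥ x) ⬝ᵥ ((W * Δ * S.Sigma0) *ᵥ x) ∂D := by
    rw [hD.integral_mulVec, hD.integral_mulVec, Finset.mul_sum]
    refine Finset.sum_le_sum fun i _ => ?_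
    have h2 : (W * Δ * S.Sigma0) i = S.Sigma0 *ᵥ (W * Δ) i := by
      rw [← Matrix.vecMul_transpose, hs]; rfl
    rw [h2, dotProduct_mulVec_comm' S.Sigma0 ((W * Δ) i) (S.Sigma0 *ᵥ (W * Δ) i), hs]
    exact mul_qf_le_mulVec_sq hσ (sigmaMin_mul_le_qf hSig) ((W * Δ) i)
  refine le_trans ?_ h1
  rw [mul_assoc]
  refine mul_le_mul_of_nonneg_left ?_ hσ
  rw [excess, ← integral_const_mul]
  refine integral_mono ((hD.integrable_excess W Δ).const_mul c) (hD.integrable_mulVec _ _)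
    fun x => ?_
  have := mul_qf_le_mulVec_sq hc hW (Δ *ᵥ x)
  simpa only [Matrix.mulVec_mulVec] using this

/-- The excess cost after a rank-one update. -/
lemma IsInitialLaw.excess_add_vecMulVec (hD : S.IsInitialLaw D)
    {W : Matrix (Fin m) (Fin m) ℝ} (hW : Wᵀ = W) (Δ : Matrix (Fin m) (Fin n) ℝ) (γ : ℝ)
    (η : Fin m → ℝ) (x₀ : Fin n → ℝ) :
    excess D W (Δ + γ • Matrix.vecMulVec η x₀) = excess D W Δ
      + 2 * γ * (η ⬝ᵥ ((W * Δ * S.Sigma0) *ᵥ x₀)) + γ ^ 2 * (qf S.Sigma0 x₀ * qf W η) := by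
  have h1 : ∀ x, qf W ((Δ + γ • Matrix.vecMulVec η x₀) *ᵥ x)
      = qf W (Δ *ᵥ x) + 2 * γ * ((((W * Δ)ᵀ *ᵥ η) ⬝ᵥ x) * (x₀ ⬝ᵥ x))
        + γ ^ 2 * qf W η * ((x₀ ⬝ᵥ x) * (x₀ ⬝ᵥ x)) := by
    intro x
    have e : (Δ + γ • Matrix.vecMulVec η x₀) *ᵥ x = Δ *ᵥ x + (γ * (x₀ ⬝ᵥ x)) • η := by
      rw [Matrix.add_mulVec, Matrix.smul_mulVec, Matrix.vecMulVec_mulVec, mul_smul]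
      congr 2
      ext i
      simp [mul_comm]
    rw [e, qf_add_vec hW, qf_smul_vec, Matrix.mulVec_smul, dotProduct_smul, smul_eq_mul,
      dotProduct_mulVec_symm hW, Matrix.mulVec_mulVec, dotProduct_mulVec_comm' (W * Δ) η]
    ring
  have i1 := hD.integrable_excess W Δ
  have i2 := (hD.integrable_mul ((W * Δ)ᵀ *ᵥ η) x₀).const_mul (2 * γ)
  have i3 := (hD.integrable_mul x₀ x₀).const_mul (γ ^ 2 * qf W η)
  have h2 : ((W * Δ)ᵀ *ᵥ η) ⬝ᵥ (S.Sigma0 *ᵥ x₀) = η ⬝ᵥ ((W * Δ * S.Sigma0) *ᵥ x₀) := by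
    rw [← dotProduct_mulVec_comm', Matrix.mulVec_mulVec]
  calc excess D W (Δ + γ • Matrix.vecMulVec η x₀)
      = ∫ x, (qf W (Δ *ᵥ x) + 2 * γ * ((((W * Δ)ᵀ *ᵥ η) ⬝ᵥ x) * (x₀ ⬝ᵥ x))
        + γ ^ 2 * qf W η * ((x₀ ⬝ᵥ x) * (x₀ ⬝ᵥ x))) ∂D := by rw [excess]; simp only [h1]
    _ = _ := by
      rw [integral_add_three i1 i2 i3, integral_const_mul, integral_const_mul, hD.integral_mul,
        hD.integral_mul, h2]
      simp only [excess, qf]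
      ring

end InitialLaw

/-! ### The surrogate cost -/

section Surrogate

variable {D : Measure (Fin n → ℝ)} {N h : ℕ}

lemma surrogate_eq (hh : h < N) (Kt : ℕ → Matrix (Fin m) (Fin n) ℝ)
    (K : Matrix (Fin m) (Fin n) ℝ) :
    S.surrogate D N Kt h K = ∫ x, qf (S.stageMat K (S.costMat N Kt (h + 1))) x ∂D := by
  simp only [surrogate, costToGo_neg_mulVec hh]

/-- Integrated completion of squares: the surrogate cost is a constant plus a quadratic in $K-G$, so
its minimizer is the Riccati gain of the current cost-to-go matrix. -/
lemma surrogate_eq_excess (hD : S.IsInitialLaw D) (hQ : S.Q.PosDef) (hR : S.R.PosDef)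
    (hT : S.QN.PosSemidef) (hh : h < N) (Kt : ℕ → Matrix (Fin m) (Fin n) ℝ)
    (K : Matrix (Fin m) (Fin n) ℝ) :
    S.surrogate D N Kt h K = ∫ x, qf (S.riccati (S.costMat N Kt (h + 1))) x ∂D
      + excess D (S.inputWeight (S.costMat N Kt (h + 1)))
        (K - S.gain (S.costMat N Kt (h + 1))) := by
  rw [surrogate_eq hh, excess, ← integral_add (hD.integrable_qf _) (hD.integrable_excess _ _)]
  simp only [qf_stageMat_eq hR (costMat_posSemidef hQ hR hT N Kt (h + 1))]

lemma surrogateMin_eq (hD : S.IsInitialLaw D) (hQ : S.Q.PosDef) (hR : S.R.PosDef)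
    (hT : S.QN.PosSemidef) (hh : h < N) (Kt : ℕ → Matrix (Fin m) (Fin n) ℝ) :
    S.surrogateMin D N Kt h = ∫ x, qf (S.riccati (S.costMat N Kt (h + 1))) x ∂D := by
  have hP := costMat_posSemidef hQ hR hT N Kt (h + 1)
  have hge : ∀ K, ∫ x, qf (S.riccati (S.costMat N Kt (h + 1))) x ∂D
      ≤ S.surrogate D N Kt h K := fun K => by
    rw [surrogate_eq_excess hD hQ hR hT hh]
    exact le_add_of_nonneg_right (excess_nonneg (inputWeight_posDef hR hP).posSemidef _)
  refine le_antisymm ?_ (le_ciInf hge)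
  refine (ciInf_le ⟨_, by rintro _ ⟨K, rfl⟩; exact hge K⟩
    (S.gain (S.costMat N Kt (h + 1)))).trans_eq ?_
  rw [surrogate_eq hh, stageMat_gain hR hP]

lemma surrogate_eq_surrogateMin_add (hD : S.IsInitialLaw D) (hQ : S.Q.PosDef) (hR : S.R.PosDef)
    (hT : S.QN.PosSemidef) (hh : h < N) (Kt : ℕ → Matrix (Fin m) (Fin n) ℝ)
    (K : Matrix (Fin m) (Fin n) ℝ) :
    S.surrogate D N Kt h K = S.surrogateMin D N Kt h
      + excess D (S.inputWeight (S.costMat N Kt (h + 1)))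
        (K - S.gain (S.costMat N Kt (h + 1))) := by
  rw [surrogateMin_eq hD hQ hR hT hh, surrogate_eq_excess hD hQ hR hT hh]

lemma surrogateMin_nonneg (hD : S.IsInitialLaw D) (hQ : S.Q.PosDef) (hR : S.R.PosDef)
    (hT : S.QN.PosSemidef) (hh : h < N) (Kt : ℕ → Matrix (Fin m) (Fin n) ℝ) :
    0 ≤ S.surrogateMin D N Kt h := by
  rw [surrogateMin_eq hD hQ hR hT hh]
  exact integral_nonneg fun x => qf_nonneg
    (riccati_posSemidef hQ hR (costMat_posSemidef hQ hR hT N Kt (h + 1))) x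

lemma excess_le_surrogate (hD : S.IsInitialLaw D) (hQ : S.Q.PosDef) (hR : S.R.PosDef)
    (hT : S.QN.PosSemidef) (hh : h < N) (Kt : ℕ → Matrix (Fin m) (Fin n) ℝ)
    (K : Matrix (Fin m) (Fin n) ℝ) :
    excess D (S.inputWeight (S.costMat N Kt (h + 1))) (K - S.gain (S.costMat N Kt (h + 1)))
      ≤ S.surrogate D N Kt h K := by
  rw [surrogate_eq_surrogateMin_add hD hQ hR hT hh]
  linarith [surrogateMin_nonneg hD hQ hR hT hh Kt]

lemma surrogateMin_le (hD : S.IsInitialLaw D) (hQ : S.Q.PosDef) (hR : S.R.PosDef)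
    (hT : S.QN.PosSemidef) (hh : h < N) (Kt : ℕ → Matrix (Fin m) (Fin n) ℝ)
    (K : Matrix (Fin m) (Fin n) ℝ) :
    S.surrogateMin D N Kt h ≤ S.surrogate D N Kt h K := by
  rw [surrogate_eq_surrogateMin_add hD hQ hR hT hh]
  exact le_add_of_nonneg_right (excess_nonneg
    (inputWeight_posDef hR (costMat_posSemidef hQ hR hT N Kt (h + 1))).posSemidef _)

/-- The surrogate cost controls the size of the gain. -/
lemma frobSq_le_surrogate (hD : S.IsInitialLaw D) (hQ : S.Q.PosDef) (hR : S.R.PosDef)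
    (hSig : S.Sigma0.PosDef) (hm : 0 < m)
    (hT : S.QN.PosSemidef) (hh : h < N) (Kt : ℕ → Matrix (Fin m) (Fin n) ℝ)
    (K : Matrix (Fin m) (Fin n) ℝ) :
    sigmaMin S.Sigma0 * sigmaMin S.R * frobSq K ≤ S.surrogate D N Kt h K := by
  refine (hD.frobSq_le_excess hSig (sigmaMin_pos hm hR).le (sigmaMin_mul_le_qf hR) K).trans ?_
  rw [surrogate_eq hh]
  refine integral_mono (hD.integrable_excess _ _) (hD.integrable_qf _) fun x => ?_
  simp only [qf_stageMat]
  linarith [qf_nonneg hQ.posSemidef x,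
    qf_nonneg (costMat_posSemidef hQ hR hT N Kt (h + 1)) ((S.A - S.B * K) *ᵥ x)]

/-- The state cost alone is at least $\sigma_{\min}(Q)\,\mathbb
E|x_0|^2\ge\sigma_{\min}(Q)\sigma_{\min}(\Sigma_0)n$. Positivity matters because $\theta_h$ divides
by this cost. -/
lemma surrogate_pos (hD : S.IsInitialLaw D) (hQ : S.Q.PosDef) (hR : S.R.PosDef)
    (hSig : S.Sigma0.PosDef) (hn : 0 < n)
    (hT : S.QN.PosSemidef) (hh : h < N) (Kt : ℕ → Matrix (Fin m) (Fin n) ℝ)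
    (K : Matrix (Fin m) (Fin n) ℝ) : 0 < S.surrogate D N Kt h K := by
  have hq := sigmaMin_pos hn hQ
  have hs := sigmaMin_pos hn hSig
  have h1 : sigmaMin S.Sigma0 * (n : ℝ) ≤ ∫ x, x ⬝ᵥ x ∂D := by
    have h2 := hD.integral_mulVec (1 : Matrix (Fin n) (Fin n) ℝ) 1
    simp only [Matrix.one_mulVec] at h2
    rw [h2]
    have h3 : ∀ i : Fin n, sigmaMin S.Sigma0 ≤
        (1 : Matrix (Fin n) (Fin n) ℝ) i ⬝ᵥ (S.Sigma0 *ᵥ (1 : Matrix (Fin n) (Fin n) ℝ) i) := by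
      intro i
      have h4 := sigmaMin_mul_le_qf hSig ((1 : Matrix (Fin n) (Fin n) ℝ) i)
      have h5 : (1 : Matrix (Fin n) (Fin n) ℝ) i ⬝ᵥ (1 : Matrix (Fin n) (Fin n) ℝ) i = 1 := by
        simp [dotProduct, Matrix.one_apply]
      rwa [h5, mul_one] at h4
    calc sigmaMin S.Sigma0 * (n : ℝ) = ∑ _i : Fin n, sigmaMin S.Sigma0 := by simp [mul_comm]
      _ ≤ _ := Finset.sum_le_sum fun i _ => h3 i
  have hi : Integrable (fun x : Fin n → ℝ => x ⬝ᵥ x) D := by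
    simpa using hD.integrable_mulVec (1 : Matrix (Fin n) (Fin n) ℝ) 1
  have hn' : (0 : ℝ) < n := by exact_mod_cast hn
  calc (0 : ℝ) < sigmaMin S.Q * (sigmaMin S.Sigma0 * n) := by positivity
    _ ≤ sigmaMin S.Q * ∫ x, x ⬝ᵥ x ∂D := mul_le_mul_of_nonneg_left h1 hq.le
    _ = ∫ x, sigmaMin S.Q * (x ⬝ᵥ x) ∂D := (integral_const_mul _ _).symm
    _ ≤ S.surrogate D N Kt h K := by
      rw [surrogate_eq hh]
      refine integral_mono (hi.const_mul _) (hD.integrable_qf _) fun x => ?_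
      simp only [qf_stageMat]
      linarith [sigmaMin_mul_le_qf hQ x, qf_nonneg hR.posSemidef (K *ᵥ x),
        qf_nonneg (costMat_posSemidef hQ hR hT N Kt (h + 1)) ((S.A - S.B * K) *ᵥ x)]

end Surrogate

/-! ### The observed cost -/

section ObservedCost

variable {N h : ℕ}

/-- The observed cost as a square completed in the input. -/
lemma costToGo_eq_riccati (hQ : S.Q.PosDef) (hR : S.R.PosDef) (hT : S.QN.PosSemidef)
    (hh : h < N) (Kt : ℕ → Matrix (Fin m) (Fin n) ℝ) (x : Fin n → ℝ) (u : Fin m → ℝ) :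
    S.costToGo N Kt h x u = qf (S.riccati (S.costMat N Kt (h + 1))) x
      + qf (S.inputWeight (S.costMat N Kt (h + 1)))
        (u + S.gain (S.costMat N Kt (h + 1)) *ᵥ x) := by
  have hP := costMat_posSemidef hQ hR hT N Kt (h + 1)
  rw [costToGo_eq hh]
  generalize S.costMat N Kt (h + 1) = P at *
  have hPt := posSemidef_transpose hP
  have hWt := posSemidef_transpose (inputWeight_posDef hR hP).posSemidef
  -- The gain $K=0$ gives $Q+A^\top PA=\mathcal R(P)+G^\top WG$ for the pure state terms; the mixed
  -- term follows from the normal equation $WG=B^\top PA$.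
  have h1 := qf_stageMat_eq hR hP 0 x
  rw [qf_stageMat] at h1
  simp only [Matrix.mul_zero, sub_zero, zero_sub, Matrix.zero_mulVec, qf_zero_vec,
    Matrix.neg_mulVec] at h1
  have h2 : qf (S.inputWeight P) (-(S.gain P *ᵥ x)) = qf (S.inputWeight P) (S.gain P *ᵥ x) := by
    simp [qf, Matrix.mulVec_neg]
  have h3 : u ⬝ᵥ (S.inputWeight P *ᵥ (S.gain P *ᵥ x)) = (S.B *ᵥ u) ⬝ᵥ (P *ᵥ (S.A *ᵥ x)) := by
    rw [Matrix.mulVec_mulVec, inputWeight_mul_gain hR hP, Matrix.mul_assoc, ← Matrix.mulVec_mulVec,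
      dotProduct_mulVec_comm', Matrix.transpose_transpose, Matrix.mulVec_mulVec]
  rw [add_comm (S.A *ᵥ x), qf_add_vec hPt, qf_add_vec hWt, h3, qf_inputWeight P u]
  linarith

lemma costToGo_nonneg (hQ : S.Q.PosDef) (hR : S.R.PosDef) (hT : S.QN.PosSemidef)
    (hh : h < N) (Kt : ℕ → Matrix (Fin m) (Fin n) ℝ) (x : Fin n → ℝ) (u : Fin m → ℝ) :
    0 ≤ S.costToGo N Kt h x u := by
  rw [costToGo_eq hh]
  linarith [qf_nonneg hQ.posSemidef x, qf_nonneg hR.posSemidef u,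
    qf_nonneg (costMat_posSemidef hQ hR hT N Kt (h + 1)) (S.A *ᵥ x + S.B *ᵥ u)]

/-- The observed cost at the perturbed input, as a quadratic polynomial in the noise. -/
lemma costToGo_perturbed (hQ : S.Q.PosDef) (hR : S.R.PosDef) (hT : S.QN.PosSemidef)
    (hh : h < N) (Kt : ℕ → Matrix (Fin m) (Fin n) ℝ) (K : Matrix (Fin m) (Fin n) ℝ)
    (x : Fin n → ℝ) (s : ℝ) (η : Fin m → ℝ) :
    S.costToGo N Kt h x (-(K *ᵥ x) + s • η)
      = qf (S.stageMat K (S.costMat N Kt (h + 1))) x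
        - 2 * s * (η ⬝ᵥ ((S.inputWeight (S.costMat N Kt (h + 1))
          * (K - S.gain (S.costMat N Kt (h + 1)))) *ᵥ x))
        + s ^ 2 * qf (S.inputWeight (S.costMat N Kt (h + 1))) η := by
  have hP := costMat_posSemidef hQ hR hT N Kt (h + 1)
  rw [costToGo_eq_riccati hQ hR hT hh]
  generalize S.costMat N Kt (h + 1) = P at *
  have hWt := posSemidef_transpose (inputWeight_posDef hR hP).posSemidef
  have e : -(K *ᵥ x) + s • η + S.gain P *ᵥ x = s • η + -((K - S.gain P) *ᵥ x) := by
    rw [Matrix.sub_mulVec]; abel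
  have e2 : qf (S.inputWeight P) (-((K - S.gain P) *ᵥ x))
      = qf (S.inputWeight P) ((K - S.gain P) *ᵥ x) := by simp [qf, Matrix.mulVec_neg]
  rw [e, qf_add_vec hWt, e2, qf_smul_vec, qf_stageMat_eq hR hP, Matrix.mulVec_neg,
    Matrix.mulVec_mulVec, smul_dotProduct, dotProduct_neg, smul_eq_mul]
  ring

/-- A bound of the observed cost for gains of bounded size. -/
lemma costToGo_perturbed_le (hh : h < N) (Kt : ℕ → Matrix (Fin m) (Fin n) ℝ)
    {K : Matrix (Fin m) (Fin n) ℝ} {b c : ℝ} (hb : 0 ≤ b)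
    (hP : ∀ y, qf (S.costMat N Kt (h + 1)) y ≤ b * (y ⬝ᵥ y)) (hK : frobSq K ≤ c)
    (x : Fin n → ℝ) (s : ℝ) (η : Fin m → ℝ) :
    S.costToGo N Kt h x (-(K *ᵥ x) + s • η)
      ≤ (specNorm S.Q + 2 * specNorm S.R * c
          + 2 * b * (specNorm S.A ^ 2 + 2 * specNorm S.B ^ 2 * c)) * (x ⬝ᵥ x)
        + 2 * s ^ 2 * (specNorm S.R + 2 * b * specNorm S.B ^ 2) * (η ⬝ᵥ η) := by
  set u := -(K *ᵥ x) + s • η with hu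
  have hx := dotProduct_self_nonneg' x
  have h1 : u ⬝ᵥ u ≤ 2 * (c * (x ⬝ᵥ x)) + 2 * (s ^ 2 * (η ⬝ᵥ η)) := by
    refine (dotProduct_add_self_le _ _).trans ?_
    have h2 : (-(K *ᵥ x)) ⬝ᵥ (-(K *ᵥ x)) ≤ c * (x ⬝ᵥ x) := by
      rw [neg_dotProduct_neg]
      exact (mulVec_sq_le_frobSq K x).trans (mul_le_mul_of_nonneg_right hK hx)
    have h3 : (s • η) ⬝ᵥ (s • η) = s ^ 2 * (η ⬝ᵥ η) := by
      simp only [dotProduct_smul, smul_dotProduct, smul_eq_mul]; ring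
    linarith
  have h4 := qf_le_specNorm S.Q x
  have h5 := qf_le_specNorm S.R u
  have h6 := hP (S.A *ᵥ x + S.B *ᵥ u)
  have h7 := dotProduct_add_self_le (S.A *ᵥ x) (S.B *ᵥ u)
  have h8 := mulVec_sq_le S.A x
  have h9 := mulVec_sq_le S.B u
  have h10 := mul_le_mul_of_nonneg_left h1 (specNorm_nonneg S.R)
  have h11 := mul_le_mul_of_nonneg_left h1 (sq_nonneg (specNorm S.B))
  have h12 : b * ((S.A *ᵥ x + S.B *ᵥ u) ⬝ᵥ (S.A *ᵥ x + S.B *ᵥ u))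
      ≤ b * (2 * (specNorm S.A ^ 2 * (x ⬝ᵥ x))
        + 2 * (specNorm S.B ^ 2 * (2 * (c * (x ⬝ᵥ x)) + 2 * (s ^ 2 * (η ⬝ᵥ η))))) :=
    mul_le_mul_of_nonneg_left (by linarith) hb
  rw [costToGo_eq hh]
  calc _ ≤ specNorm S.Q * (x ⬝ᵥ x)
        + specNorm S.R * (2 * (c * (x ⬝ᵥ x)) + 2 * (s ^ 2 * (η ⬝ᵥ η)))
        + b * (2 * (specNorm S.A ^ 2 * (x ⬝ᵥ x))
        + 2 * (specNorm S.B ^ 2 * (2 * (c * (x ⬝ᵥ x)) + 2 * (s ^ 2 * (η ⬝ᵥ η))))) := by linarith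
    _ = _ := by ring

end ObservedCost

end LQR

namespace LQR

variable {n m : ℕ} {S : LQR n m} {D : Measure (Fin n → ℝ)} {N h : ℕ}

/-! ### One step of the stochastic gradient method -/

lemma continuous_qf_comp {α : Type*} [TopologicalSpace α] {p : ℕ} (M : Matrix (Fin p) (Fin p) ℝ)
    {f : α → Fin p → ℝ} (hf : Continuous f) : Continuous fun a => qf M (f a) :=
  hf.dotProduct (continuous_const.matrix_mulVec hf)

lemma continuous_costToGo_perturbed (hQ : S.Q.PosDef) (hR : S.R.PosDef) (hT : S.QN.PosSemidef)
    (hh : h < N) (Kt : ℕ → Matrix (Fin m) (Fin n) ℝ) (K : Matrix (Fin m) (Fin n) ℝ) (s : ℝ) :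
    Continuous fun z : (Fin n → ℝ) × (Fin m → ℝ) =>
      S.costToGo N Kt h z.1 (-(K *ᵥ z.1) + s • z.2) := by
  simp only [costToGo_perturbed hQ hR hT hh]
  refine ((continuous_qf_comp _ continuous_fst).sub (continuous_const.mul
    (continuous_snd.dotProduct (continuous_const.matrix_mulVec continuous_fst)))).add
    (continuous_const.mul (continuous_qf_comp _ continuous_snd))

/-- The gain error after one step. -/
lemma sub_smul_gradEst (Kt : ℕ → Matrix (Fin m) (Fin n) ℝ) (K G : Matrix (Fin m) (Fin n) ℝ)
    (α : ℝ) (x : Fin n → ℝ) (η : Fin m → ℝ) :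
    K - α • S.gradEst N Kt h K x η - G = (K - G)
      + (α / S.sigma * S.costToGo N Kt h x (-(K *ᵥ x) + S.sigma • η)) • Matrix.vecMulVec η x := by
  rw [gradEst, smul_smul, sub_right_comm, sub_eq_add_neg (K - G), ← neg_smul]
  congr 2
  ring

/-- Integration over the noise in one step, for a fixed initial state. -/
lemma lintegral_step_noise_le (hD : S.IsInitialLaw D) (hQ : S.Q.PosDef) (hR : S.R.PosDef)
    (hSig : S.Sigma0.PosDef) (hT : S.QN.PosSemidef) (hsigma : 0 < S.sigma)
    (hh : h < N) (Kt : ℕ → Matrix (Fin m) (Fin n) ℝ) {K : Matrix (Fin m) (Fin n) ℝ}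
    {b c w α : ℝ} (hb : 0 ≤ b) (hw : 0 ≤ w)
    (hP : ∀ y, qf (S.costMat N Kt (h + 1)) y ≤ b * (y ⬝ᵥ y))
    (hW : ∀ u, qf (S.inputWeight (S.costMat N Kt (h + 1))) u ≤ w * (u ⬝ᵥ u))
    (hK : frobSq K ≤ c) (x₁ x₂ : ℝ)
    (hx₁ : x₁ = (specNorm S.Q + 2 * specNorm S.R * c
          + 2 * b * (specNorm S.A ^ 2 + 2 * specNorm S.B ^ 2 * c)) * √S.Cm ^ 3)
    (hx₂ : x₂ = 2 * (specNorm S.R + 2 * b * specNorm S.B ^ 2) * √S.Cm)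
    {x : Fin n → ℝ} (hx : x ⬝ᵥ x ≤ S.Cm) (W : Matrix (Fin m) (Fin m) ℝ)
    (hWdef : W = S.inputWeight (S.costMat N Kt (h + 1)))
    (Δ : Matrix (Fin m) (Fin n) ℝ) (hΔ : Δ = K - S.gain (S.costMat N Kt (h + 1))) :
    0 ≤ excess D W Δ + -(4 * α) * (((W * Δ) *ᵥ x) ⬝ᵥ ((W * Δ * S.Sigma0) *ᵥ x))
        + α ^ 2 * (w * specNorm S.Sigma0) * (1 / S.sigma ^ 2 * x₁ ^ 2 * m
          + 2 * x₁ * x₂ * m * (m + 2) + S.sigma ^ 2 * x₂ ^ 2 * m * (m + 2) * (m + 4)) ∧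
    ∫⁻ η, ENNReal.ofReal (excess D W
        (K - α • S.gradEst N Kt h K x η - S.gain (S.costMat N Kt (h + 1)))) ∂(stdGaussianPi m)
      ≤ ENNReal.ofReal (excess D W Δ
        + -(4 * α) * (((W * Δ) *ᵥ x) ⬝ᵥ ((W * Δ * S.Sigma0) *ᵥ x))
        + α ^ 2 * (w * specNorm S.Sigma0) * (1 / S.sigma ^ 2 * x₁ ^ 2 * m
          + 2 * x₁ * x₂ * m * (m + 2) + S.sigma ^ 2 * x₂ ^ 2 * m * (m + 2) * (m + 4))) := by
  have hPs := costMat_posSemidef hQ hR hT N Kt (h + 1)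
  have hWpd : W.PosDef := hWdef ▸ inputWeight_posDef hR hPs
  have hWt := posSemidef_transpose hWpd.posSemidef
  have hCm : 0 ≤ S.Cm := (dotProduct_self_nonneg' x).trans hx
  have hc : 0 ≤ c := (frobSq_nonneg K).trans hK
  have hSn := specNorm_nonneg S.Sigma0
  set σ := S.sigma with hσ
  set k₁ := specNorm S.Q + 2 * specNorm S.R * c
          + 2 * b * (specNorm S.A ^ 2 + 2 * specNorm S.B ^ 2 * c) with hk₁
  set k₂ := 2 * σ ^ 2 * (specNorm S.R + 2 * b * specNorm S.B ^ 2) with hk₂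
  have hk₁0 : 0 ≤ k₁ := by
    have := specNorm_nonneg S.Q
    have := specNorm_nonneg S.R
    positivity
  have hk₂0 : 0 ≤ k₂ := by
    have := specNorm_nonneg S.R
    positivity
  set q : (Fin m → ℝ) → ℝ := fun η => S.costToGo N Kt h x (-(K *ᵥ x) + σ • η) with hq
  set w₀ := (W * Δ) *ᵥ x with hw₀
  set w₁ := (W * Δ * S.Sigma0) *ᵥ x with hw₁
  set M₀ := qf (S.stageMat K (S.costMat N Kt (h + 1))) x with hM₀
  have hqeq : ∀ η, q η = M₀ - 2 * σ * (η ⬝ᵥ w₀) + σ ^ 2 * qf W η := fun η => by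
    rw [hq, hw₀, hM₀, hWdef, hΔ]; exact costToGo_perturbed hQ hR hT hh Kt K x σ η
  have hq0 : ∀ η, 0 ≤ q η := fun η => costToGo_nonneg hQ hR hT hh Kt x _
  have hqle : ∀ η, q η ≤ k₁ * S.Cm + k₂ * (η ⬝ᵥ η) := fun η =>
    (costToGo_perturbed_le hh Kt hb hP hK x σ η).trans
      (add_le_add (mul_le_mul_of_nonneg_left hx hk₁0) (by rw [hk₂]))
  -- pointwise expression and bound
  set f : (Fin m → ℝ) → ℝ := fun η => excess D W
        (K - α • S.gradEst N Kt h K x η - S.gain (S.costMat N Kt (h + 1))) with hf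
  have hfeq : ∀ η, f η = excess D W Δ + 2 * (α / σ * q η) * (η ⬝ᵥ w₁)
      + (α / σ * q η) ^ 2 * (qf S.Sigma0 x * qf W η) := fun η => by
    rw [hf]
    dsimp only
    rw [sub_smul_gradEst, ← hΔ, hD.excess_add_vecMulVec hWt]
  have hf0 : ∀ η, 0 ≤ f η := fun η => excess_nonneg hWpd.posSemidef _
  have hquad : ∀ η, (α / σ * q η) ^ 2 * (qf S.Sigma0 x * qf W η)
      ≤ α ^ 2 * (w * specNorm S.Sigma0) * (1 / σ ^ 2 * x₁ ^ 2 * (η ⬝ᵥ η)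
        + 2 * x₁ * x₂ * (η ⬝ᵥ η) ^ 2 + σ ^ 2 * x₂ ^ 2 * (η ⬝ᵥ η) ^ 3) := by
    intro η
    set s := η ⬝ᵥ η with hs
    have hs0 : 0 ≤ s := dotProduct_self_nonneg' η
    have h1 : qf S.Sigma0 x ≤ specNorm S.Sigma0 * S.Cm :=
      (qf_le_specNorm _ x).trans (mul_le_mul_of_nonneg_left hx hSn)
    have h2 : qf W η ≤ w * s := hWdef ▸ hW η
    have h3 : (q η) ^ 2 ≤ (k₁ * S.Cm + k₂ * s) ^ 2 := pow_le_pow_left₀ (hq0 η) (hqle η) 2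
    have h4 : qf S.Sigma0 x * qf W η ≤ (specNorm S.Sigma0 * S.Cm) * (w * s) :=
      mul_le_mul h1 h2 (qf_nonneg hWpd.posSemidef η) (mul_nonneg hSn hCm)
    have hr : √S.Cm ^ 2 = S.Cm := Real.sq_sqrt hCm
    -- The cost contributes $|x|^2\le C_m$ to its noise-free part, and the factor $x_0$ of the
    -- gradient estimate contributes $\sqrt{C_m}$ to both parts; hence $C_m^{3/2}$ in $\xi_1$ and
    -- $C_m^{1/2}$ in $\xi_2$.
    have e1 : x₁ = k₁ * S.Cm * √S.Cm := by rw [hx₁, pow_succ, hr]; ring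
    have e2 : σ ^ 2 * x₂ = k₂ * √S.Cm := by rw [hx₂, hk₂]; ring
    calc (α / σ * q η) ^ 2 * (qf S.Sigma0 x * qf W η)
        = α ^ 2 / σ ^ 2 * ((q η) ^ 2 * (qf S.Sigma0 x * qf W η)) := by ring
      _ ≤ α ^ 2 / σ ^ 2 * ((k₁ * S.Cm + k₂ * s) ^ 2
            * ((specNorm S.Sigma0 * S.Cm) * (w * s))) := by
          refine mul_le_mul_of_nonneg_left ?_ (by positivity)
          exact mul_le_mul h3 h4
            (mul_nonneg (qf_nonneg hSig.posSemidef x) (qf_nonneg hWpd.posSemidef η)) (sq_nonneg _)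
      _ = α ^ 2 * (w * specNorm S.Sigma0) * (1 / σ ^ 2 * ((k₁ * S.Cm + k₂ * s) ^ 2 * S.Cm) * s) := by
          ring
      _ = α ^ 2 * (w * specNorm S.Sigma0) * (1 / σ ^ 2 * (x₁ + σ ^ 2 * x₂ * s) ^ 2 * s) := by
          have e3 : (x₁ + σ ^ 2 * x₂ * s) ^ 2 = (k₁ * S.Cm + k₂ * s) ^ 2 * S.Cm := by
            rw [e1, e2]
            calc _ = (k₁ * S.Cm + k₂ * s) ^ 2 * √S.Cm ^ 2 := by ring
              _ = _ := by rw [hr]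
          rw [e3]
      _ = _ := by field_simp; ring
  -- integrability of the bound
  obtain ⟨hmi, hm1, hm2, hm3⟩ := stdGaussianPi_moments m
  have i1 : Integrable (fun η : Fin m → ℝ => η ⬝ᵥ η) (stdGaussianPi m) := by
    simpa using hmi 1 (by norm_num)
  have i2 := hmi 2 (by norm_num)
  have i3 := hmi 3 (by norm_num)
  have hWle : ∀ η, qf W η ≤ w * (η ⬝ᵥ η) := fun η => hWdef ▸ hW η
  have iodd : Integrable (fun η => (M₀ + σ ^ 2 * qf W η) * (η ⬝ᵥ w₁)) (stdGaussianPi m) := by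
    refine (((integrable_const (|M₀| * (1 + w₁ ⬝ᵥ w₁))).add
      (i1.const_mul (|M₀| + σ ^ 2 * w * (1 + w₁ ⬝ᵥ w₁)))).add
      (i2.const_mul (σ ^ 2 * w))).mono' ?_ (Filter.Eventually.of_forall fun η => ?_)
    · exact (Continuous.mul (continuous_const.add (continuous_const.mul
        (continuous_qf_comp W continuous_id)))
        (continuous_id.dotProduct continuous_const)).aestronglyMeasurable
    · have hs0 := dotProduct_self_nonneg' η
      have hw0 := dotProduct_self_nonneg' w₁
      have hWn := qf_nonneg hWpd.posSemidef η
      have h1 : |η ⬝ᵥ w₁| ≤ 1 + w₁ ⬝ᵥ w₁ + η ⬝ᵥ η := by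
        refine abs_le_of_sq_le_sq ?_ (by positivity)
        have := dotProduct_sq_le η w₁
        nlinarith
      have h2 : |M₀ + σ ^ 2 * qf W η| ≤ |M₀| + σ ^ 2 * (w * (η ⬝ᵥ η)) := by
        refine (abs_add_le _ _).trans (add_le_add le_rfl ?_)
        rw [abs_of_nonneg (by positivity)]
        exact mul_le_mul_of_nonneg_left (hWle η) (by positivity)
      rw [Real.norm_eq_abs, abs_mul]
      calc _ ≤ (|M₀| + σ ^ 2 * (w * (η ⬝ᵥ η))) * (1 + w₁ ⬝ᵥ w₁ + η ⬝ᵥ η) :=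
            mul_le_mul h2 h1 (abs_nonneg _) (by positivity)
        _ = _ := by simp only [Pi.add_apply]; ring
  have ieven := integrable_mul_dotProduct_stdGaussianPi w₀ w₁
  set C := α ^ 2 * (w * specNorm S.Sigma0) with hC
  have icross : Integrable (fun η => 2 * (α / σ * q η) * (η ⬝ᵥ w₁)) (stdGaussianPi m) := by
    refine ((iodd.const_mul (2 * (α / σ))).sub (ieven.const_mul (4 * α))).congr
      (Filter.Eventually.of_forall fun η => ?_)
    simp only [Pi.sub_apply, hqeq]
    field_simp
    ring
  -- The constant and quadratic parts of $q$ are even in $\eta$ and drop out against the odd factor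
  -- $\eta\cdot w_1$. The linear part $-2\sigma\,\eta\cdot w_0$ gives $-4\alpha\,w_0\cdot w_1$ since
  -- $\mathbb E\eta\eta^\top=I$: the estimate has no bias.
  have hcross : ∫ η, 2 * (α / σ * q η) * (η ⬝ᵥ w₁) ∂(stdGaussianPi m)
      = -(4 * α) * (w₀ ⬝ᵥ w₁) := by
    have h1 : ∀ η, 2 * (α / σ * q η) * (η ⬝ᵥ w₁) =
        2 * (α / σ) * ((M₀ + σ ^ 2 * qf W η) * (η ⬝ᵥ w₁))
          - 4 * α * ((η ⬝ᵥ w₀) * (η ⬝ᵥ w₁)) := by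
      intro η
      rw [hqeq]; field_simp; ring
    simp only [h1]
    rw [integral_sub (iodd.const_mul _) (ieven.const_mul _), integral_const_mul,
      integral_const_mul, integral_mul_dotProduct_stdGaussianPi,
      integral_odd_stdGaussianPi (f := fun η => (M₀ + σ ^ 2 * qf W η) * (η ⬝ᵥ w₁))]
    · ring
    · intro η
      simp only [qf, Matrix.mulVec_neg, neg_dotProduct, dotProduct_neg]
      ring
  have i1' : Integrable (fun η : Fin m → ℝ => 1 / σ ^ 2 * x₁ ^ 2 * (η ⬝ᵥ η)) (stdGaussianPi m) :=
    i1.const_mul _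
  have i2' : Integrable (fun η : Fin m → ℝ => 2 * x₁ * x₂ * (η ⬝ᵥ η) ^ 2) (stdGaussianPi m) :=
    i2.const_mul _
  have i3' : Integrable (fun η : Fin m → ℝ => σ ^ 2 * x₂ ^ 2 * (η ⬝ᵥ η) ^ 3) (stdGaussianPi m) :=
    i3.const_mul _
  have iq : Integrable (fun η : Fin m → ℝ => C * (1 / σ ^ 2 * x₁ ^ 2 * (η ⬝ᵥ η)
        + 2 * x₁ * x₂ * (η ⬝ᵥ η) ^ 2 + σ ^ 2 * x₂ ^ 2 * (η ⬝ᵥ η) ^ 3)) (stdGaussianPi m) :=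
    ((i1'.add i2').add i3').const_mul C
  set g : (Fin m → ℝ) → ℝ := fun η => excess D W Δ + 2 * (α / σ * q η) * (η ⬝ᵥ w₁)
      + C * (1 / σ ^ 2 * x₁ ^ 2 * (η ⬝ᵥ η)
        + 2 * x₁ * x₂ * (η ⬝ᵥ η) ^ 2 + σ ^ 2 * x₂ ^ 2 * (η ⬝ᵥ η) ^ 3) with hg
  have ic : Integrable (fun _ : Fin m → ℝ => excess D W Δ) (stdGaussianPi m) := integrable_const _
  have hgi : Integrable g (stdGaussianPi m) := (ic.add icross).add iq
  have hfg : ∀ η, f η ≤ g η := fun η => by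
    rw [hfeq]; exact add_le_add le_rfl (hquad η)
  have hg0 : ∀ η, 0 ≤ g η := fun η => (hf0 η).trans (hfg η)
  have hgint : ∫ η, g η ∂(stdGaussianPi m) = excess D W Δ + -(4 * α) * (w₀ ⬝ᵥ w₁)
      + C * (1 / σ ^ 2 * x₁ ^ 2 * m
          + 2 * x₁ * x₂ * m * (m + 2) + σ ^ 2 * x₂ ^ 2 * m * (m + 2) * (m + 4)) := by
    rw [hg, integral_add_three ic icross iq, hcross, integral_const_mul,
      integral_add_three i1' i2' i3', integral_const_mul, integral_const_mul, integral_const_mul,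
      hm1, hm2, hm3]
    simp only [integral_const, probReal_univ, one_smul]
    ring
  rw [← hgint]
  -- The sign is kept as a conclusion because the bound is next integrated over $x$, where
  -- `ENNReal.ofReal` would truncate negative values.
  refine ⟨integral_nonneg hg0, ?_⟩
  rw [ofReal_integral_eq_lintegral_ofReal hgi (Filter.Eventually.of_forall hg0)]
  exact lintegral_mono fun η => ENNReal.ofReal_le_ofReal (hfg η)

/-- The expected excess cost after one step of the stochastic gradient method. -/
lemma lintegral_step_le (hD : S.IsInitialLaw D) (hQ : S.Q.PosDef) (hR : S.R.PosDef)
    (hSig : S.Sigma0.PosDef) (hn : 0 < n) (hm : 0 < m) (hT : S.QN.PosSemidef)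
    (hsigma : 0 < S.sigma)
    (hh : h < N) (Kt : ℕ → Matrix (Fin m) (Fin n) ℝ) {K : Matrix (Fin m) (Fin n) ℝ}
    {b c w α : ℝ} (hb : 0 ≤ b) (hw : 0 ≤ w)
    (hP : ∀ y, qf (S.costMat N Kt (h + 1)) y ≤ b * (y ⬝ᵥ y))
    (hW : ∀ u, qf (S.inputWeight (S.costMat N Kt (h + 1))) u ≤ w * (u ⬝ᵥ u))
    (hK : frobSq K ≤ c) (hα : 0 ≤ α) (x₁ x₂ : ℝ)
    (hx₁ : x₁ = (specNorm S.Q + 2 * specNorm S.R * c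
          + 2 * b * (specNorm S.A ^ 2 + 2 * specNorm S.B ^ 2 * c)) * √S.Cm ^ 3)
    (hx₂ : x₂ = 2 * (specNorm S.R + 2 * b * specNorm S.B ^ 2) * √S.Cm)
    (W : Matrix (Fin m) (Fin m) ℝ)
    (hWdef : W = S.inputWeight (S.costMat N Kt (h + 1)))
    (G : Matrix (Fin m) (Fin n) ℝ) (hG : G = S.gain (S.costMat N Kt (h + 1))) :
    ∫⁻ z, ENNReal.ofReal (excess D W (K - α • S.gradEst N Kt h K z.1 z.2 - G))
        ∂(D.prod (stdGaussianPi m))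
      ≤ ENNReal.ofReal ((1 - α * S.mu) * excess D W (K - G)
        + α ^ 2 * (w * specNorm S.Sigma0) * (1 / S.sigma ^ 2 * x₁ ^ 2 * m
          + 2 * x₁ * x₂ * m * (m + 2) + S.sigma ^ 2 * x₂ ^ 2 * m * (m + 2) * (m + 4))) := by
  have := hD.1
  have hPs := costMat_posSemidef hQ hR hT N Kt (h + 1)
  have hWt : Wᵀ = W := hWdef ▸ posSemidef_transpose (inputWeight_posDef hR hPs).posSemidef
  have hmeas : Measurable fun z : (Fin n → ℝ) × (Fin m → ℝ) =>
      ENNReal.ofReal (excess D W (K - α • S.gradEst N Kt h K z.1 z.2 - G)) := by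
    refine ENNReal.measurable_ofReal.comp (Continuous.measurable ?_)
    simp only [sub_smul_gradEst, hD.excess_add_vecMulVec hWt]
    have hc := continuous_costToGo_perturbed hQ hR hT hh Kt K S.sigma
    refine (continuous_const.add (Continuous.mul (continuous_const.mul (continuous_const.mul hc))
      (continuous_snd.dotProduct (continuous_const.matrix_mulVec continuous_fst)))).add
      (((continuous_const.mul hc).pow 2).mul ((continuous_qf_comp _ continuous_fst).mul
        (continuous_qf_comp _ continuous_snd)))
  rw [lintegral_prod _ hmeas.aemeasurable]
  set E := excess D W (K - G) with hE
  set ξ := α ^ 2 * (w * specNorm S.Sigma0) * (1 / S.sigma ^ 2 * x₁ ^ 2 * m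
          + 2 * x₁ * x₂ * m * (m + 2) + S.sigma ^ 2 * x₂ ^ 2 * m * (m + 2) * (m + 4)) with hξ
  set F : (Fin n → ℝ) → ℝ := fun x => E
    + -(4 * α) * (((W * (K - G)) *ᵥ x) ⬝ᵥ ((W * (K - G) * S.Sigma0) *ᵥ x)) + ξ with hF
  have hkey : ∀ᵐ x ∂D, 0 ≤ F x ∧ ∫⁻ η, ENNReal.ofReal (excess D W
      (K - α • S.gradEst N Kt h K x η - G)) ∂(stdGaussianPi m) ≤ ENNReal.ofReal (F x) := by
    filter_upwards [hD.2.2.2] with x hx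
    subst hG
    exact lintegral_step_noise_le hD hQ hR hSig hT hsigma hh Kt hb hw hP hW hK x₁ x₂ hx₁ hx₂
      hx W hWdef _ rfl
  have i1 : Integrable (fun _ : Fin n → ℝ => E) D := integrable_const _
  have i2 : Integrable (fun x => -(4 * α) * (((W * (K - G)) *ᵥ x)
      ⬝ᵥ ((W * (K - G) * S.Sigma0) *ᵥ x))) D := (hD.integrable_mulVec _ _).const_mul _
  have i3 : Integrable (fun _ : Fin n → ℝ => ξ) D := integrable_const _
  have hFi : Integrable F D := (i1.add i2).add i3
  calc _ ≤ ∫⁻ x, ENNReal.ofReal (F x) ∂D := lintegral_mono_ae (hkey.mono fun x hx => hx.2)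
    _ = ENNReal.ofReal (∫ x, F x ∂D) :=
      (ofReal_integral_eq_lintegral_ofReal hFi (hkey.mono fun x hx => hx.1)).symm
    _ ≤ _ := by
      refine ENNReal.ofReal_le_ofReal ?_
      rw [hF, integral_add_three i1 i2 i3, integral_const_mul]
      -- Gradient domination turns the descent term $-4\alpha\,\mathbb E[\cdot]$ into $-\alpha\mu
      -- V$, as $\mu=4\sigma_{\min}(\Sigma_0)\sigma_{\min}(R)$.
      have h1 := hD.excess_le_gradient hSig (sigmaMin_pos hn hSig).le (sigmaMin_pos hm hR).le
        (W := W) (fun u => hWdef ▸ sigmaMin_le_inputWeight hR hPs u) (K - G)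
      have h2 := mul_le_mul_of_nonneg_left h1 (by positivity : 0 ≤ 4 * α)
      have h3 : S.mu = 4 * sigmaMin S.Sigma0 * sigmaMin S.R := rfl
      rw [h3]
      simp only [integral_const, probReal_univ, one_smul]
      linarith

end LQR

/-! ### A Lyapunov argument for stochastic approximation -/

section Lyapunov

open scoped ENNReal

variable {Ω E X : Type*} [MeasurableSpace Ω] [MeasurableSpace E] [MeasurableSpace X]

/-- The process with `K₀ = k₀` and `K_{t+1} = step t K_t (y t)`. -/
def markovIter (step : ℕ → X → E → X) (k₀ : X) (y : ℕ → E) : ℕ → X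
  | 0 => k₀
  | t + 1 => step t (markovIter step k₀ y t) (y t)

open Classical in
/-- The transition `step`, stopped outside of `V ≤ M`. -/
def stoppedStep (step : ℕ → X → E → X) (V : X → ℝ≥0∞) (M : ℝ≥0∞) (t : ℕ) (k : X) (e : E) : X :=
  if V k ≤ M then step t k e else k

lemma measurable_stoppedStep {step : ℕ → X → E → X}
    (hstep : ∀ t, Measurable fun p : X × E => step t p.1 p.2) {V : X → ℝ≥0∞} (hV : Measurable V)
    (M : ℝ≥0∞) (t : ℕ) : Measurable fun p : X × E => stoppedStep step V M t p.1 p.2 :=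
  Measurable.ite (measurableSet_le (hV.comp measurable_fst) measurable_const) (hstep t)
    measurable_fst

/-- The $\sigma$-algebra is arbitrary, so that it can be the one generated by the samples before
time $t$. -/
lemma measurable_markovIter_of_le {Ω : Type*} {F : MeasurableSpace Ω} {step : ℕ → X → E → X}
    (hstep : ∀ t, Measurable fun p : X × E => step t p.1 p.2) (k₀ : X) {Y : ℕ → Ω → E} {t : ℕ}
    (hY : ∀ s < t, Measurable[F] (Y s)) :
    Measurable[F] fun ω => markovIter step k₀ (fun s => Y s ω) t := by
  induction t with
  | zero => exact measurable_const
  | succ t ih =>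
    exact (hstep t).comp ((ih fun s hs => hY s (by omega)).prodMk (hY t (by omega)))

lemma indepFun_markovIter {Pr : Measure Ω} [IsProbabilityMeasure Pr] {step : ℕ → X → E → X}
    (hstep : ∀ t, Measurable fun p : X × E => step t p.1 p.2) (k₀ : X) {Y : ℕ → Ω → E}
    (hY : ∀ t, Measurable (Y t)) (hind : iIndepFun Y Pr) (t : ℕ) :
    IndepFun (fun ω => markovIter step k₀ (fun s => Y s ω) t) (Y t) Pr := by
  have h1 : Indep (⨆ s ∈ Set.Iio t, MeasurableSpace.comap (Y s) inferInstance)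
      (⨆ s ∈ ({t} : Set ℕ), MeasurableSpace.comap (Y s) inferInstance) Pr :=
    indep_iSup_of_disjoint (fun s => (hY s).comap_le) hind.iIndep (by simp)
  have h2 : Measurable[⨆ s ∈ Set.Iio t, MeasurableSpace.comap (Y s) inferInstance]
      fun ω => markovIter step k₀ (fun s => Y s ω) t :=
    measurable_markovIter_of_le hstep k₀ fun s hs =>
      (comap_measurable (Y s)).mono (le_iSup₂ (f := fun s (_ : s ∈ Set.Iio t) =>
        MeasurableSpace.comap (Y s) inferInstance) s hs) le_rfl
  rw [IndepFun_iff_Indep]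
  refine indep_of_indep_of_le_left (indep_of_indep_of_le_right h1 ?_) h2.comap_le
  simp

/-- The state at time $t$ depends on earlier samples only and is independent of the $t$-th one;
Fubini then plays the role of conditional expectation. -/
lemma lintegral_markovIter {Pr : Measure Ω} [IsProbabilityMeasure Pr] {ν : Measure E}
    {step : ℕ → X → E → X}
    (hstep : ∀ t, Measurable fun p : X × E => step t p.1 p.2) (k₀ : X) {Y : ℕ → Ω → E}
    (hY : ∀ t, Measurable (Y t)) (hlaw : ∀ t, Pr.map (Y t) = ν) (hind : iIndepFun Y Pr) (t : ℕ)
    {f : X × E → ℝ≥0∞} (hf : Measurable f) :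
    ∫⁻ ω, f (markovIter step k₀ (fun s => Y s ω) t, Y t ω) ∂Pr
      = ∫⁻ ω, ∫⁻ e, f (markovIter step k₀ (fun s => Y s ω) t, e) ∂ν ∂Pr := by
  have hK : Measurable fun ω => markovIter step k₀ (fun s => Y s ω) t :=
    measurable_markovIter_of_le hstep k₀ fun s _ => hY s
  have hν : IsProbabilityMeasure ν := hlaw t ▸ Measure.isProbabilityMeasure_map (hY t).aemeasurable
  have h1 := (indepFun_iff_map_prod_eq_prod_map_map hK.aemeasurable (hY t).aemeasurable).1
    (indepFun_markovIter hstep k₀ hY hind t)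
  rw [hlaw] at h1
  calc _ = ∫⁻ p, f p ∂(Pr.map fun ω => (markovIter step k₀ (fun s => Y s ω) t, Y t ω)) :=
        (lintegral_map hf (hK.prodMk (hY t))).symm
    _ = _ := by
      rw [h1, lintegral_prod _ hf.aemeasurable, lintegral_map hf.lintegral_prod_right' hK]

/-- A stopped process stays where it is, outside $V\le M$ for ever. So $V\le M$ at time $t$ means
that no stopping has occurred before. -/
lemma markovIter_stopped_eq {E X : Type*} {step : ℕ → X → E → X} {V : X → ℝ≥0∞} {M : ℝ≥0∞} (k₀ : X)
    (y : ℕ → E) {t : ℕ} (h : V (markovIter (stoppedStep step V M) k₀ y t) ≤ M) :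
    markovIter (stoppedStep step V M) k₀ y t = markovIter step k₀ y t := by
  induction t with
  | zero => rfl
  | succ t ih =>
    rw [markovIter, stoppedStep] at h
    by_cases hV : V (markovIter (stoppedStep step V M) k₀ y t) ≤ M
    · rw [markovIter, stoppedStep, if_pos hV, ih hV]; rfl
    · rw [if_neg hV] at h; exact absurd h hV

/-- A supermartingale-type bound: if `V ≤ M` forces `E V(step t k ·) ≤ (1 - 2/(t+θ)) V(k)
+ θ J / (t+θ)²`, then the process leaves `V ≤ M = 10 J / ζ` with probability at most `3 ζ / 10`, and
otherwise `E V(K_T) ≤ θ J / (T + θ)`. -/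
lemma measure_markovIter_gt_le {Pr : Measure Ω} [IsProbabilityMeasure Pr] {ν : Measure E}
    {step : ℕ → X → E → X}
    (hstep : ∀ t, Measurable fun p : X × E => step t p.1 p.2) (k₀ : X) {Y : ℕ → Ω → E}
    (hY : ∀ t, Measurable (Y t)) (hlaw : ∀ t, Pr.map (Y t) = ν) (hind : iIndepFun Y Pr)
    {V : X → ℝ≥0∞} (hV : Measurable V) {J ζ θ : ℝ} (hJ : 0 < J) (hζ : 0 < ζ) (hθ : 2 ≤ θ)
    (hV₀ : V k₀ ≤ ENNReal.ofReal J)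
    (hdrift : ∀ (t : ℕ) (k : X), V k ≤ ENNReal.ofReal (10 * ζ⁻¹ * J) →
      ∫⁻ e, V (step t k e) ∂ν ≤ ENNReal.ofReal (1 - 2 / (t + θ)) * V k
        + ENNReal.ofReal (θ * J / (t + θ) ^ 2)) (T : ℕ) {v : ℝ} (hv : 0 < v) :
    Pr {ω | ENNReal.ofReal v < V (markovIter step k₀ (fun s => Y s ω) T)}
      ≤ ENNReal.ofReal (3 * ζ / 10 + θ * J / ((T + θ) * v)) := by
  set M : ℝ≥0∞ := ENNReal.ofReal (10 * ζ⁻¹ * J) with hM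
  have hmeas := measurable_stoppedStep hstep hV M
  set K : ℕ → Ω → X := fun t ω => markovIter (stoppedStep step V M) k₀ (fun s => Y s ω) t with hK
  have hKm : ∀ t, Measurable (K t) := fun t =>
    measurable_markovIter_of_le hmeas k₀ fun s _ => hY s
  have hν : IsProbabilityMeasure ν := hlaw 0 ▸ Measure.isProbabilityMeasure_map (hY 0).aemeasurable
  have hs1 : ∀ t : ℕ, (1 : ℝ) < t + θ := fun t => by
    have : (0 : ℝ) ≤ t := Nat.cast_nonneg t
    linarith
  -- the stopped process is almost a supermartingale
  have hsuper : ∀ t, ∫⁻ ω, V (K t ω) ∂Pr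
      ≤ ENNReal.ofReal (J + θ * J * (1 / (θ - 1) - 1 / (t + θ - 1))) := by
    intro t
    induction t with
    | zero => simpa [hK, markovIter] using hV₀
    | succ t ih =>
      have h1 : ∫⁻ ω, V (K (t + 1) ω) ∂Pr
          ≤ ∫⁻ ω, (V (K t ω) + ENNReal.ofReal (θ * J / (t + θ) ^ 2)) ∂Pr := by
        refine (lintegral_markovIter hmeas k₀ hY hlaw hind t
          (f := fun p => V (stoppedStep step V M t p.1 p.2)) (hV.comp (hmeas t))).trans_le ?_
        refine lintegral_mono fun ω => ?_
        by_cases h2 : V (K t ω) ≤ M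
        · have h3 : ∀ e, stoppedStep step V M t (K t ω) e = step t (K t ω) e :=
            fun e => if_pos h2
          change ∫⁻ e, V (stoppedStep step V M t (K t ω) e) ∂ν ≤ _
          simp only [h3]
          refine (hdrift t _ h2).trans (add_le_add ?_ le_rfl)
          refine mul_le_of_le_one_left zero_le (ENNReal.ofReal_le_one.2 ?_)
          have : (0 : ℝ) ≤ 2 / (t + θ) := div_nonneg two_pos.le (by linarith [hs1 t])
          linarith
        · have h3 : ∀ e, stoppedStep step V M t (K t ω) e = K t ω := fun e => if_neg h2
          change ∫⁻ e, V (stoppedStep step V M t (K t ω) e) ∂ν ≤ _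
          simp only [h3, lintegral_const, measure_univ, mul_one]
          exact le_self_add
      refine h1.trans ?_
      rw [lintegral_add_right _ measurable_const, lintegral_const, measure_univ, mul_one]
      refine (add_le_add ih le_rfl).trans ?_
      have hs := hs1 t
      have hθ1 : 0 < θ - 1 := by linarith
      have h4 : 1 / (t + θ - 1) ≤ 1 / (θ - 1) :=
        one_div_le_one_div_of_le hθ1 (by linarith [(Nat.cast_nonneg t : (0 : ℝ) ≤ t)])
      rw [← ENNReal.ofReal_add (add_nonneg hJ.le (mul_nonneg (by positivity) (by linarith)))
        (by positivity)]
      refine ENNReal.ofReal_le_ofReal ?_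
      -- With $s=t+\theta$, the bound $s^{-2}\le(s-1)^{-1}-s^{-1}$ makes the accumulated noise
      -- telescope.
      have h5 : 1 / (t + θ) ^ 2 ≤ 1 / (t + θ - 1) - 1 / (t + θ) := by
        rw [div_sub_div _ _ (by linarith) (by linarith), div_le_div_iff₀ (by nlinarith) (by nlinarith)]
        nlinarith
      have h6 : θ * J * (1 / (t + θ) ^ 2) ≤ θ * J * (1 / (t + θ - 1) - 1 / (t + θ)) :=
        mul_le_mul_of_nonneg_left h5 (by positivity)
      have h7 : (((t + 1 : ℕ) : ℝ) + θ - 1) = t + θ := by push_cast; ring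
      rw [h7, div_eq_mul_one_div (θ * J)]
      linarith
  -- the mass which is not stopped contracts
  have hcontr : ∀ t, ∫⁻ ω in {ω | V (K t ω) ≤ M}, V (K t ω) ∂Pr
      ≤ ENNReal.ofReal (θ * J / (t + θ)) := by
    intro t
    induction t with
    | zero =>
      refine (setLIntegral_le_lintegral _ _).trans ?_
      have : θ * J / ((0 : ℕ) + θ) = J := by
        rw [Nat.cast_zero, zero_add, mul_div_cancel_left₀ _ (by linarith)]
      rw [this]
      simpa [hK, markovIter] using hV₀
    | succ t ih =>
      have hset : ∀ s, MeasurableSet {ω | V (K s ω) ≤ M} := fun s =>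
        measurableSet_le (hV.comp (hKm s)) measurable_const
      have hg : Measurable ({k | V k ≤ M}.indicator fun k => V k) :=
        hV.indicator (measurableSet_le hV measurable_const)
      have h1 : ∫⁻ ω in {ω | V (K (t + 1) ω) ≤ M}, V (K (t + 1) ω) ∂Pr
          ≤ ∫⁻ ω in {ω | V (K t ω) ≤ M}, (ENNReal.ofReal (1 - 2 / (t + θ)) * V (K t ω)
            + ENNReal.ofReal (θ * J / (t + θ) ^ 2)) ∂Pr := by
        rw [← lintegral_indicator (hset (t + 1)), ← lintegral_indicator (hset t)]
        refine (lintegral_markovIter hmeas k₀ hY hlaw hind t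
          (f := fun p => {k | V k ≤ M}.indicator (fun k => V k)
            (stoppedStep step V M t p.1 p.2)) (hg.comp (hmeas t))).trans_le ?_
        refine lintegral_mono fun ω => ?_
        by_cases h2 : V (K t ω) ≤ M
        · have h3 : ∀ e, stoppedStep step V M t (K t ω) e = step t (K t ω) e :=
            fun e => if_pos h2
          change ∫⁻ e, {k | V k ≤ M}.indicator (fun k => V k)
            (stoppedStep step V M t (K t ω) e) ∂ν ≤ _
          simp only [h3]
          rw [Set.indicator_of_mem (show ω ∈ {ω | V (K t ω) ≤ M} from h2)]
          exact (lintegral_mono fun e => Set.indicator_le_self _ _ _).trans (hdrift t _ h2)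
        · have h3 : ∀ e, stoppedStep step V M t (K t ω) e = K t ω := fun e => if_neg h2
          change ∫⁻ e, {k | V k ≤ M}.indicator (fun k => V k)
            (stoppedStep step V M t (K t ω) e) ∂ν ≤ _
          simp only [h3]
          rw [Set.indicator_of_notMem (show K t ω ∉ {k | V k ≤ M} from h2)]
          simp
      refine h1.trans ?_
      have hVK : Measurable fun ω => V (K t ω) := hV.comp (hKm t)
      rw [lintegral_add_right _ measurable_const, lintegral_const_mul _ hVK,
        lintegral_const, Measure.restrict_apply_univ]
      have hs := hs1 t
      have h2s : 2 / (t + θ) ≤ 1 := by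
        rw [div_le_one (by linarith)]; linarith [(Nat.cast_nonneg t : (0 : ℝ) ≤ t)]
      calc _ ≤ ENNReal.ofReal (1 - 2 / (t + θ)) * ENNReal.ofReal (θ * J / (t + θ))
            + ENNReal.ofReal (θ * J / (t + θ) ^ 2) * 1 :=
            add_le_add (mul_le_mul_right ih _) (mul_le_mul_right prob_le_one _)
        _ = ENNReal.ofReal ((1 - 2 / (t + θ)) * (θ * J / (t + θ)) + θ * J / (t + θ) ^ 2) := by
            rw [mul_one, ← ENNReal.ofReal_mul (by linarith), ← ENNReal.ofReal_add
              (mul_nonneg (by linarith) (by positivity)) (by positivity)]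
        _ ≤ _ := by
            refine ENNReal.ofReal_le_ofReal ?_
            have hs0 : 0 < (t : ℝ) + θ := by linarith
            have e : (1 - 2 / (t + θ)) * (θ * J / (t + θ)) + θ * J / (t + θ) ^ 2
                = θ * J * (((t + θ) - 1) / (t + θ) ^ 2) := by field_simp; ring
            rw [e, div_eq_mul_one_div (θ * J)]
            refine mul_le_mul_of_nonneg_left ?_ (by positivity)
            push_cast
            -- For $s=t+\theta$ this is $(s-1)(s+1)\le s^2$.
            rw [div_le_div_iff₀ (by positivity) (by linarith)]
            nlinarith
  -- conclusion
  have hMpos : 0 < 10 * ζ⁻¹ * J := by positivity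
  -- Either the stopped process has reached the level $M$, or it agrees with the original process at
  -- time $T$.
  have hsub : {ω | ENNReal.ofReal v < V (markovIter step k₀ (fun s => Y s ω) T)}
      ⊆ {ω | M ≤ V (K T ω)} ∪
        {ω | ENNReal.ofReal v ≤ {ω | V (K T ω) ≤ M}.indicator (fun ω => V (K T ω)) ω} := by
    intro ω hω
    by_cases h1 : V (K T ω) ≤ M
    · right
      have h2 : K T ω = markovIter step k₀ (fun s => Y s ω) T := markovIter_stopped_eq k₀ _ h1
      change ENNReal.ofReal v ≤ Set.indicator _ _ ω
      rw [Set.indicator_of_mem (show ω ∈ {ω | V (K T ω) ≤ M} from h1), h2]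
      exact le_of_lt hω
    · left; exact (not_le.1 h1).le
  have hm1 : Pr {ω | M ≤ V (K T ω)} ≤ ENNReal.ofReal (3 * ζ / 10) := by
    refine (meas_ge_le_lintegral_div (hV.comp (hKm T)).aemeasurable
      (ENNReal.ofReal_pos.2 hMpos).ne' ENNReal.ofReal_ne_top).trans ?_
    refine (ENNReal.div_le_div_right (hsuper T) _).trans ?_
    rw [← ENNReal.ofReal_div_of_pos hMpos]
    refine ENNReal.ofReal_le_ofReal ?_
    rw [div_le_iff₀ hMpos]
    have h1 : 0 ≤ 1 / (T + θ - 1) := by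
      have := hs1 T
      exact div_nonneg zero_le_one (by linarith)
    -- Here $\theta\ge2$ enters: the accumulated noise is at most $2J$, so $\mathbb EV\le3J$, to be
    -- compared with the level $10J/\zeta$.
    have h2 : θ * (1 / (θ - 1)) ≤ 2 := by
      rw [← div_eq_mul_one_div, div_le_iff₀ (by linarith)]; linarith
    have h3 : 3 * ζ / 10 * (10 * ζ⁻¹ * J) = 3 * J := by field_simp
    rw [h3]
    have h4 : 0 ≤ θ * J * (1 / (T + θ - 1)) := by positivity
    have h5 : J * (θ * (1 / (θ - 1))) ≤ J * 2 := mul_le_mul_of_nonneg_left h2 hJ.le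
    linarith
  have hm2 : Pr {ω | ENNReal.ofReal v ≤ {ω | V (K T ω) ≤ M}.indicator (fun ω => V (K T ω)) ω}
      ≤ ENNReal.ofReal (θ * J / ((T + θ) * v)) := by
    have hset : MeasurableSet {ω | V (K T ω) ≤ M} :=
      measurableSet_le (hV.comp (hKm T)) measurable_const
    refine (meas_ge_le_lintegral_div ((hV.comp (hKm T)).indicator hset).aemeasurable
      (ENNReal.ofReal_pos.2 hv).ne' ENNReal.ofReal_ne_top).trans ?_
    rw [lintegral_indicator hset]
    refine (ENNReal.div_le_div_right (hcontr T) _).trans ?_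
    rw [← ENNReal.ofReal_div_of_pos hv, div_div]
  have hs := hs1 T
  rw [ENNReal.ofReal_add (by positivity) (by positivity)]
  exact (measure_mono hsub).trans ((measure_union_le _ _).trans (add_le_add hm1 hm2))

end Lyapunov

/-! ### Measurability -/

instance matrixMeasurableSpace {p q : ℕ} : MeasurableSpace (Matrix (Fin p) (Fin q) ℝ) :=
  inferInstanceAs (MeasurableSpace (Fin p → Fin q → ℝ))

section MatrixMeasurable

variable {α : Type*} [MeasurableSpace α] {p q r : ℕ}

lemma measurable_matrix_iff {f : α → Matrix (Fin p) (Fin q) ℝ} :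
    Measurable f ↔ ∀ i j, Measurable fun a => f a i j := by
  refine (measurable_pi_iff (g := f)).trans (forall_congr' fun i => ?_)
  exact measurable_pi_iff

lemma Measurable.matrix_apply {f : α → Matrix (Fin p) (Fin q) ℝ} (hf : Measurable f) (i : Fin p)
    (j : Fin q) : Measurable fun a => f a i j := measurable_matrix_iff.1 hf i j

lemma Measurable.matrix_row {f : α → Matrix (Fin p) (Fin q) ℝ} (hf : Measurable f) (i : Fin p) :
    Measurable fun a => f a i := measurable_pi_iff.2 fun j => hf.matrix_apply i j

lemma Measurable.dotProduct' {f g : α → Fin p → ℝ} (hf : Measurable f) (hg : Measurable g) :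
    Measurable fun a => f a ⬝ᵥ g a :=
  Finset.measurable_fun_sum _ fun i _ =>
    ((measurable_pi_apply i).comp hf).mul ((measurable_pi_apply i).comp hg)

lemma Measurable.matrix_mulVec' {f : α → Matrix (Fin p) (Fin q) ℝ} {g : α → Fin q → ℝ}
    (hf : Measurable f) (hg : Measurable g) : Measurable fun a => f a *ᵥ g a :=
  measurable_pi_iff.2 fun i => (hf.matrix_row i).dotProduct' hg

lemma Measurable.matrix_mul' {f : α → Matrix (Fin p) (Fin q) ℝ} {g : α → Matrix (Fin q) (Fin r) ℝ}
    (hf : Measurable f) (hg : Measurable g) : Measurable fun a => f a * g a := by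
  refine measurable_matrix_iff.2 fun i j => ?_
  simp only [Matrix.mul_apply]
  exact Finset.measurable_fun_sum _ fun k _ => (hf.matrix_apply i k).mul (hg.matrix_apply k j)

lemma Measurable.matrix_add' {f g : α → Matrix (Fin p) (Fin q) ℝ} (hf : Measurable f)
    (hg : Measurable g) : Measurable fun a => f a + g a :=
  measurable_matrix_iff.2 fun i j => (hf.matrix_apply i j).add (hg.matrix_apply i j)

lemma Measurable.matrix_sub' {f g : α → Matrix (Fin p) (Fin q) ℝ} (hf : Measurable f)
    (hg : Measurable g) : Measurable fun a => f a - g a :=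
  measurable_matrix_iff.2 fun i j => (hf.matrix_apply i j).sub (hg.matrix_apply i j)

lemma Measurable.matrix_smul' {c : α → ℝ} {f : α → Matrix (Fin p) (Fin q) ℝ} (hc : Measurable c)
    (hf : Measurable f) : Measurable fun a => c a • f a :=
  measurable_matrix_iff.2 fun i j => hc.mul (hf.matrix_apply i j)

lemma Measurable.matrix_transpose' {f : α → Matrix (Fin p) (Fin q) ℝ} (hf : Measurable f) :
    Measurable fun a => (f a)ᵀ :=
  measurable_matrix_iff.2 fun i j => hf.matrix_apply j i

lemma Measurable.matrix_det' {f : α → Matrix (Fin p) (Fin p) ℝ} (hf : Measurable f) :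
    Measurable fun a => (f a).det := by
  simp only [Matrix.det_apply']
  exact Finset.measurable_fun_sum _ fun s _ => measurable_const.mul
    (Finset.measurable_fun_prod _ fun i _ => hf.matrix_apply _ _)

/-- Cramer's rule: the adjugate is polynomial in the entries, and $d\mapsto d^{-1}$ is measurable
also at $0$, so singular matrices need no separate treatment. -/
lemma Measurable.matrix_inv' {f : α → Matrix (Fin p) (Fin p) ℝ} (hf : Measurable f) :
    Measurable fun a => (f a)⁻¹ := by
  simp only [Matrix.inv_def, Ring.inverse_eq_inv']
  refine hf.matrix_det'.inv.matrix_smul' (measurable_matrix_iff.2 fun i j => ?_)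
  simp only [Matrix.adjugate_apply]
  refine Measurable.matrix_det' (measurable_matrix_iff.2 fun k l => ?_)
  by_cases hk : k = j
  · subst hk; simp
  · simpa [Matrix.updateRow_ne hk] using hf.matrix_apply k l

lemma Measurable.qf' {f : α → Matrix (Fin p) (Fin p) ℝ} {g : α → Fin p → ℝ} (hf : Measurable f)
    (hg : Measurable g) : Measurable fun a => qf (f a) (g a) :=
  hg.dotProduct' (hf.matrix_mulVec' hg)

lemma Measurable.frobSq' {f : α → Matrix (Fin p) (Fin q) ℝ} (hf : Measurable f) :
    Measurable fun a => frobSq (f a) :=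
  Finset.measurable_fun_sum _ fun i _ => (hf.matrix_row i).dotProduct' (hf.matrix_row i)

lemma Measurable.vecMulVec' {f : α → Fin p → ℝ} {g : α → Fin q → ℝ} (hf : Measurable f)
    (hg : Measurable g) : Measurable fun a => Matrix.vecMulVec (f a) (g a) :=
  measurable_matrix_iff.2 fun i j =>
    ((measurable_pi_apply i).comp hf).mul ((measurable_pi_apply j).comp hg)

/-- Needed because the number of inner iterations depends on the gains already computed, hence is
itself random. -/
lemma measurable_eval_nat {β : Type*} [MeasurableSpace β] {F : ℕ → α → β}
    (hF : ∀ t, Measurable (F t)) {T : α → ℕ} (hT : Measurable T) :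
    Measurable fun a => F (T a) a := by
  have h : Measurable fun p : ℕ × α => F p.1 p.2 := measurable_from_prod_countable_right hF
  exact h.comp (hT.prodMk measurable_id)

end MatrixMeasurable

namespace LQR

variable {n m : ℕ} {S : LQR n m} {α : Type*} [MeasurableSpace α]
  {Kt : α → ℕ → Matrix (Fin m) (Fin n) ℝ} {K₀ : α → Matrix (Fin m) (Fin n) ℝ}

lemma measurable_stageMat {P : α → Matrix (Fin n) (Fin n) ℝ} (hK : Measurable K₀)
    (hP : Measurable P) : Measurable fun a => S.stageMat (K₀ a) (P a) := by
  have h : Measurable fun a => S.A - S.B * K₀ a :=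
    measurable_const.matrix_sub' (measurable_const.matrix_mul' hK)
  exact (measurable_const.matrix_add'
    ((hK.matrix_transpose'.matrix_mul' measurable_const).matrix_mul' hK)).matrix_add'
    ((h.matrix_transpose'.matrix_mul' hP).matrix_mul' h)

lemma measurable_inputWeight {P : α → Matrix (Fin n) (Fin n) ℝ} (hP : Measurable P) :
    Measurable fun a => S.inputWeight (P a) :=
  measurable_const.matrix_add' ((measurable_const.matrix_mul' hP).matrix_mul' measurable_const)

lemma measurable_gain {P : α → Matrix (Fin n) (Fin n) ℝ} (hP : Measurable P) :
    Measurable fun a => S.gain (P a) :=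
  ((((measurable_inputWeight hP).matrix_inv').matrix_mul' measurable_const).matrix_mul'
    hP).matrix_mul' measurable_const

lemma measurable_lastCost (hKt : Measurable Kt) (N k : ℕ) :
    Measurable fun a => S.lastCost N (Kt a) k := by
  induction k with
  | zero => exact measurable_const
  | succ k ih => exact measurable_stageMat ((measurable_pi_apply _).comp hKt) ih

lemma measurable_costMat (hKt : Measurable Kt) (N h : ℕ) :
    Measurable fun a => S.costMat N (Kt a) h := measurable_lastCost hKt N _

lemma measurableSet_stageAccurate (N : ℕ) (ε : ℝ) (h : ℕ) :
    MeasurableSet {Kt : ℕ → Matrix (Fin m) (Fin n) ℝ | S.StageAccurate N ε Kt h} :=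
  measurableSet_le (((measurable_pi_apply h).matrix_sub'
    (measurable_gain (measurable_costMat measurable_id N (h + 1)))).frobSq') measurable_const

variable {D : Measure (Fin n → ℝ)} {N h : ℕ}

lemma IsInitialLaw.measurable_integral_qf (hD : S.IsInitialLaw D)
    {M : α → Matrix (Fin n) (Fin n) ℝ} (hM : Measurable M) :
    Measurable fun a => ∫ x, qf (M a) x ∂D := by
  simp only [hD.integral_qf]
  exact Finset.measurable_fun_sum _ fun i _ => measurable_const.dotProduct'
    (measurable_const.matrix_mulVec' (hM.matrix_row i))

lemma measurable_surrogate (hD : S.IsInitialLaw D) (hh : h < N) (hKt : Measurable Kt)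
    (hK : Measurable K₀) : Measurable fun a => S.surrogate D N (Kt a) h (K₀ a) := by
  simp only [surrogate_eq hh]
  exact hD.measurable_integral_qf (measurable_stageMat hK (measurable_costMat hKt N (h + 1)))

/-- An infimum over uncountably many gains is replaced by the explicit cost of the minimizing gain.
-/
lemma measurable_surrogateMin (hD : S.IsInitialLaw D) (hQ : S.Q.PosDef) (hR : S.R.PosDef)
    (hT : S.QN.PosSemidef) (hh : h < N) (hKt : Measurable Kt) :
    Measurable fun a => S.surrogateMin D N (Kt a) h := by
  simp only [surrogateMin_eq hD hQ hR hT hh,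
    ← stageMat_gain hR (costMat_posSemidef hQ hR hT N _ (h + 1))]
  have hc := measurable_costMat (S := S) hKt N (h + 1)
  exact hD.measurable_integral_qf (measurable_stageMat (measurable_gain hc) hc)

lemma measurable_theta (hD : S.IsInitialLaw D) (hQ : S.Q.PosDef) (hR : S.R.PosDef)
    (hT : S.QN.PosSemidef) (hh : h < N) (ζ : ℝ) (hKt : Measurable Kt) (hK : Measurable K₀) :
    Measurable fun a => S.theta D N ζ (Kt a) h (K₀ a) := by
  have h1 := measurable_surrogate hD hh hKt hK
  have h2 := measurable_surrogateMin hD hQ hR hT hh hKt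
  have h3 : Measurable fun a => S.cTilde D N ζ (Kt a) h (K₀ a) := by
    unfold cTilde; fun_prop
  have h4 : Measurable fun a => S.xi1 D N ζ (Kt a) h (K₀ a) := by
    unfold xi1; fun_prop
  have h5 : Measurable fun a => S.xi3 D N ζ (Kt a) h (K₀ a) := by
    unfold xi3; fun_prop
  unfold theta; fun_prop

lemma measurable_stepSize (hD : S.IsInitialLaw D) (hQ : S.Q.PosDef) (hR : S.R.PosDef)
    (hT : S.QN.PosSemidef) (hh : h < N) (ζ : ℝ) (t : ℕ) (hKt : Measurable Kt)
    (hK : Measurable K₀) : Measurable fun a => S.stepSize D N ζ (Kt a) h (K₀ a) t := by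
  have h1 := measurable_theta hD hQ hR hT hh ζ hKt hK
  unfold stepSize; fun_prop

lemma measurable_numIters (hD : S.IsInitialLaw D) (hQ : S.Q.PosDef) (hR : S.R.PosDef)
    (hT : S.QN.PosSemidef) (hh : h < N) (ε ζ : ℝ) (hKt : Measurable Kt)
    (hK : Measurable K₀) : Measurable fun a => S.numIters D N ε ζ (Kt a) h (K₀ a) := by
  have h1 := measurable_theta hD hQ hR hT hh ζ hKt hK
  have h2 := measurable_surrogate hD hh hKt hK
  unfold numIters
  exact Nat.measurable_ceil.comp ((measurable_const.mul h1).mul h2)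

lemma measurable_gradEst (hh : h < N) (hKt : Measurable Kt) (hK : Measurable K₀)
    {x : α → Fin n → ℝ} {η : α → Fin m → ℝ} (hx : Measurable x) (hη : Measurable η) :
    Measurable fun a => S.gradEst N (Kt a) h (K₀ a) (x a) (η a) := by
  have hu : Measurable fun a => -(K₀ a *ᵥ x a) + S.sigma • η a :=
    (hK.matrix_mulVec' hx).neg.add (hη.const_smul S.sigma)
  have h1 : Measurable fun a =>
      S.costToGo N (Kt a) h (x a) (-(K₀ a *ᵥ x a) + S.sigma • η a) := by
    simp only [costToGo_eq hh]
    exact ((measurable_const.qf' hx).add (measurable_const.qf' hu)).add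
      ((measurable_costMat hKt N (h + 1)).qf' ((measurable_const.matrix_mulVec' hx).add
        (measurable_const.matrix_mulVec' hu)))
  exact (measurable_const.mul h1).matrix_smul' (hη.vecMulVec' hx)

lemma measurable_innerIter (hD : S.IsInitialLaw D) (hQ : S.Q.PosDef) (hR : S.R.PosDef)
    (hT : S.QN.PosSemidef) (hh : h < N) (ζ : ℝ) (hKt : Measurable Kt) (hK : Measurable K₀)
    {y : α → ℕ → (Fin n → ℝ) × (Fin m → ℝ)} (hy : Measurable y) (t : ℕ) :
    Measurable fun a => S.innerIter D N ζ (Kt a) h (K₀ a) (y a) t := by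
  induction t with
  | zero => exact hK
  | succ t ih =>
    have hyt : Measurable fun a => y a t := (measurable_pi_apply t).comp hy
    exact ih.matrix_sub' ((measurable_stepSize hD hQ hR hT hh ζ t hKt hK).matrix_smul'
      (measurable_gradEst hh hKt ih hyt.fst hyt.snd))

lemma _root_.IsInitRule.measurable_comp {κ : ℝ}
    {init : ℕ → (ℕ → Matrix (Fin m) (Fin n) ℝ) → Matrix (Fin m) (Fin n) ℝ}
    (hinit : IsInitRule κ init) (hKt : Measurable Kt) (h : ℕ) :
    Measurable fun a => init h (Kt a) :=
  measurable_matrix_iff.2 fun i j => ((hinit h).1 i j).comp hKt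

/-- The result of the inner loop at stage `h`. -/
def stageResult (S : LQR n m) (D : Measure (Fin n → ℝ)) (N : ℕ) (ε ζ : ℝ)
    (init : ℕ → (ℕ → Matrix (Fin m) (Fin n) ℝ) → Matrix (Fin m) (Fin n) ℝ) (h : ℕ)
    (Kt : ℕ → Matrix (Fin m) (Fin n) ℝ) (y : ℕ → (Fin n → ℝ) × (Fin m → ℝ)) :
    Matrix (Fin m) (Fin n) ℝ :=
  S.innerIter D N ζ Kt h (init h Kt) y (S.numIters D N ε ζ Kt h (init h Kt))

lemma measurable_stageResult (hD : S.IsInitialLaw D) (hQ : S.Q.PosDef) (hR : S.R.PosDef)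
    (hT : S.QN.PosSemidef) (hh : h < N) (ε ζ : ℝ) {κ : ℝ}
    {init : ℕ → (ℕ → Matrix (Fin m) (Fin n) ℝ) → Matrix (Fin m) (Fin n) ℝ}
    (hinit : IsInitRule κ init) (hKt : Measurable Kt)
    {y : α → ℕ → (Fin n → ℝ) × (Fin m → ℝ)} (hy : Measurable y) :
    Measurable fun a => S.stageResult D N ε ζ init h (Kt a) (y a) :=
  measurable_eval_nat (F := fun t a => S.innerIter D N ζ (Kt a) h (init h (Kt a)) (y a) t)
    (fun t => measurable_innerIter hD hQ hR hT hh ζ hKt (hinit.measurable_comp hKt h) hy t)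
    (measurable_numIters hD hQ hR hT hh ε ζ hKt (hinit.measurable_comp hKt h))

lemma table_succ (ε ζ : ℝ)
    (init : ℕ → (ℕ → Matrix (Fin m) (Fin n) ℝ) → Matrix (Fin m) (Fin n) ℝ)
    (z : ℕ → ℕ → (Fin n → ℝ) × (Fin m → ℝ)) (k : ℕ) :
    S.table D N ε ζ init z (k + 1) = Function.update (S.table D N ε ζ init z k) (N - 1 - k)
      (S.stageResult D N ε ζ init (N - 1 - k) (S.table D N ε ζ init z k) (z (N - 1 - k))) := rfl

/-- The gains computed in the first `k` passes depend on the samples of these passes only. -/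
lemma measurable_table_of_le {Ω : Type*} {F : MeasurableSpace Ω} (hD : S.IsInitialLaw D)
    (hQ : S.Q.PosDef) (hR : S.R.PosDef) (hT : S.QN.PosSemidef) (ε ζ : ℝ) {κ : ℝ}
    {init : ℕ → (ℕ → Matrix (Fin m) (Fin n) ℝ) → Matrix (Fin m) (Fin n) ℝ}
    (hinit : IsInitRule κ init) {z : ℕ → ℕ → Ω → (Fin n → ℝ) × (Fin m → ℝ)} {k : ℕ} (hk : k ≤ N)
    (hz : ∀ h, N - k ≤ h → h < N → ∀ t, Measurable[F] (z h t)) :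
    Measurable[F] fun ω => S.table D N ε ζ init (fun h t => z h t ω) k := by
  induction k with
  | zero => exact measurable_const
  | succ k ih =>
    have ih' := ih (by omega) fun h h1 h2 => hz h (by omega) h2
    have hres : Measurable[F] fun ω => S.stageResult D N ε ζ init (N - 1 - k)
        (S.table D N ε ζ init (fun h t => z h t ω) k) (fun t => z (N - 1 - k) t ω) :=
      measurable_stageResult hD hQ hR hT (by omega) ε ζ hinit ih'
        (measurable_pi_iff.2 fun t => hz _ (by omega) (by omega) t)
    simp only [table_succ]
    refine measurable_pi_iff.2 fun j => ?_
    by_cases hj : j = N - 1 - k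
    · subst hj; simpa using hres
    · simp only [Function.update_of_ne hj]
      exact (measurable_pi_apply j).comp ih'

/-- A gain is never overwritten after its pass. Indices $j\ge N$ are included, and there the table
keeps its initial value $0$. -/
lemma table_apply_of_le (ε ζ : ℝ)
    (init : ℕ → (ℕ → Matrix (Fin m) (Fin n) ℝ) → Matrix (Fin m) (Fin n) ℝ)
    (z : ℕ → ℕ → (Fin n → ℝ) × (Fin m → ℝ)) {k l j : ℕ} (hkl : k ≤ l) (hl : l ≤ N)
    (hj : N - k ≤ j) : S.table D N ε ζ init z l j = S.table D N ε ζ init z k j := by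
  induction hkl with
  | refl => rfl
  | @step l hkl ih =>
    rw [table_succ, Function.update_of_ne, ih (by omega)]
    have : k ≤ l := hkl
    omega

end LQR

/-! ### Success probability of the algorithm -/

/-- Conditioning on an independent random variable: a bad event which has probability at most `c`
for every admissible value of `X` has probability at most `c`. -/
lemma measure_indepFun_le {Ω α β : Type*} [MeasurableSpace Ω] [MeasurableSpace α]
    [MeasurableSpace β] {Pr : Measure Ω} [IsProbabilityMeasure Pr] {X : Ω → α} {Y : Ω → β}
    (hX : Measurable X) (hY : Measurable Y) (hXY : IndepFun X Y Pr) {G : Set α}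
    (hG : MeasurableSet G) {B : Set (α × β)} (hB : MeasurableSet B) {c : ENNReal}
    (hc : ∀ x ∈ G, Pr {ω | (x, Y ω) ∈ B} ≤ c) : Pr {ω | X ω ∈ G ∧ (X ω, Y ω) ∈ B} ≤ c := by
  have := Measure.isProbabilityMeasure_map (μ := Pr) hX.aemeasurable
  have := Measure.isProbabilityMeasure_map (μ := Pr) hY.aemeasurable
  have hB' : MeasurableSet ((Prod.fst ⁻¹' G) ∩ B) := (measurable_fst hG).inter hB
  have h1 := (indepFun_iff_map_prod_eq_prod_map_map hX.aemeasurable hY.aemeasurable).1 hXY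
  have h2 : Pr {ω | X ω ∈ G ∧ (X ω, Y ω) ∈ B}
      = (Pr.map fun ω => (X ω, Y ω)) ((Prod.fst ⁻¹' G) ∩ B) := by
    rw [Measure.map_apply (hX.prodMk hY) hB']; rfl
  rw [h2, h1, Measure.prod_apply hB']
  calc _ ≤ ∫⁻ _, c ∂(Pr.map X) := by
        refine lintegral_mono fun x => ?_
        by_cases hx : x ∈ G
        · rw [Measure.map_apply hY (measurable_prodMk_left hB')]
          exact (measure_mono fun ω hω => hω.2).trans (hc x hx)
        · have : Prod.mk x ⁻¹' ((Prod.fst ⁻¹' G) ∩ B) = ∅ := by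
            ext y; simp [hx]
          simp [this]
    _ = c := by simp

namespace LQR

variable {n m : ℕ} {S : LQR n m} {D : Measure (Fin n → ℝ)} {N h : ℕ}

lemma innerIter_eq_markovIter (ζ : ℝ) (Kt : ℕ → Matrix (Fin m) (Fin n) ℝ)
    (K₀ : Matrix (Fin m) (Fin n) ℝ) (y : ℕ → (Fin n → ℝ) × (Fin m → ℝ)) (t : ℕ) :
    S.innerIter D N ζ Kt h K₀ y t
      = markovIter (fun t K e => K - S.stepSize D N ζ Kt h K₀ t •
          S.gradEst N Kt h K e.1 e.2) K₀ y t := by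
  induction t with
  | zero => rfl
  | succ t ih => rw [innerIter, markovIter, ih]

lemma mu_pos (hn : 0 < n) (hm : 0 < m) (hR : S.R.PosDef) (hSig : S.Sigma0.PosDef) :
    0 < S.mu := by
  have h1 := sigmaMin_pos hn hSig
  have h2 := sigmaMin_pos hm hR
  unfold mu; positivity

/-- One stage of the algorithm succeeds with probability at least `1 - ζ`, whenever the later
stages are accurate. -/
lemma measure_stage_le (hD : S.IsInitialLaw D) (hQ : S.Q.PosDef) (hR : S.R.PosDef)
    (hSig : S.Sigma0.PosDef) (hn : 0 < n) (hm : 0 < m) (hT : S.QN.PosSemidef)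
    (hsigma : 0 < S.sigma) (hh : h < N) {ε ζ : ℝ} (hζ : 0 < ζ) (htol : 0 < S.tol N ε h)
    {Kt : ℕ → Matrix (Fin m) (Fin n) ℝ}
    (hle : ∀ y, qf (S.costMat N Kt (h + 1)) y ≤ qf (S.rde N (h + 1)) y + S.ca * (y ⬝ᵥ y))
    (K₀ : Matrix (Fin m) (Fin n) ℝ)
    {Ω : Type*} [MeasurableSpace Ω] {Pr : Measure Ω} [IsProbabilityMeasure Pr]
    {Y : ℕ → Ω → (Fin n → ℝ) × (Fin m → ℝ)} (hY : ∀ t, Measurable (Y t))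
    (hlaw : ∀ t, Pr.map (Y t) = D.prod (stdGaussianPi m)) (hind : iIndepFun Y Pr) :
    Pr {ω | ¬ frobSq (S.innerIter D N ζ Kt h K₀ (fun t => Y t ω) (S.numIters D N ε ζ Kt h K₀)
      - S.gain (S.costMat N Kt (h + 1))) ≤ S.tol N ε h ^ 2} ≤ ENNReal.ofReal ζ := by
  have hPs := costMat_posSemidef hQ hR hT N Kt (h + 1)
  set W := S.inputWeight (S.costMat N Kt (h + 1)) with hW
  set G := S.gain (S.costMat N Kt (h + 1)) with hG
  have hWpd : W.PosDef := inputWeight_posDef hR hPs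
  set J := S.surrogate D N Kt h K₀ with hJdef
  have hJ : 0 < J := surrogate_pos hD hQ hR hSig hn hT hh Kt K₀
  set θ := S.theta D N ζ Kt h K₀ with hθdef
  have hθ : 2 ≤ θ := le_max_left _ _
  have hμ := mu_pos hn hm hR hSig
  have hsS := sigmaMin_pos hn hSig
  have hsR := sigmaMin_pos hm hR
  have hμdef : S.mu = 4 * sigmaMin S.Sigma0 * sigmaMin S.R := rfl
  set T := S.numIters D N ε ζ Kt h K₀ with hTdef
  set V : Matrix (Fin m) (Fin n) ℝ → ENNReal := fun K => ENNReal.ofReal (excess D W (K - G))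
    with hV
  set step : ℕ → Matrix (Fin m) (Fin n) ℝ → (Fin n → ℝ) × (Fin m → ℝ) →
    Matrix (Fin m) (Fin n) ℝ := fun t K e => K - S.stepSize D N ζ Kt h K₀ t •
          S.gradEst N Kt h K e.1 e.2 with hstepdef
  have hstep : ∀ t, Measurable fun p : Matrix (Fin m) (Fin n) ℝ × ((Fin n → ℝ) × (Fin m → ℝ)) =>
      step t p.1 p.2 := fun t =>
    measurable_fst.matrix_sub' (measurable_const.matrix_smul' (measurable_gradEst hh
      measurable_const measurable_fst measurable_snd.fst measurable_snd.snd))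
  have hVm : Measurable V := by
    refine ENNReal.measurable_ofReal.comp ?_
    simp only [hD.excess_eq]
    have hs : Measurable fun K : Matrix (Fin m) (Fin n) ℝ => K - G :=
      measurable_id.matrix_sub' measurable_const
    exact Finset.measurable_fun_sum _ fun i _ => (hs.matrix_row i).dotProduct'
      (measurable_const.matrix_mulVec' ((measurable_const.matrix_mul' hs).matrix_row i))
  have hdrift : ∀ (t : ℕ) (K : Matrix (Fin m) (Fin n) ℝ),
      V K ≤ ENNReal.ofReal (10 * ζ⁻¹ * J) →
      ∫⁻ e, V (step t K e) ∂(D.prod (stdGaussianPi m))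
        ≤ ENNReal.ofReal (1 - 2 / (t + θ)) * V K
          + ENNReal.ofReal (θ * J / (t + θ) ^ 2) := by
    intro t K hK
    have hE0 : 0 ≤ excess D W (K - G) := excess_nonneg hWpd.posSemidef _
    have hE : excess D W (K - G) ≤ 10 * ζ⁻¹ * J :=
      (ENNReal.ofReal_le_ofReal_iff (by positivity)).1 hK
    -- The surrogate cost is coercive: $V(K)\le10J/\zeta$ bounds $\widetilde J_h(K)$ by
    -- $10J/\zeta+\min\widetilde J_h$, which is the numerator of $\widetilde C_h$.
    have hKc : frobSq K ≤ S.cTilde D N ζ Kt h K₀ := by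
      rw [cTilde, le_div_iff₀ (by positivity), mul_comm]
      refine (frobSq_le_surrogate hD hQ hR hSig hm hT hh Kt K).trans ?_
      rw [surrogate_eq_surrogateMin_add hD hQ hR hT hh]
      linarith
    have hs0 : (0 : ℝ) < t + θ := by linarith [(Nat.cast_nonneg t : (0 : ℝ) ≤ t)]
    have hα : 0 ≤ S.stepSize D N ζ Kt h K₀ t := by
      rw [stepSize, ← hθdef]; positivity
    have hb : ∀ y, qf (S.costMat N Kt (h + 1)) y ≤ (S.pMax N + S.ca) * (y ⬝ᵥ y) := fun y => by
      have := qf_rde_le_pMax (S := S) (N := N) (h := h + 1) (by omega) hh y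
      linarith [hle y]
    have h1 := lintegral_step_le hD hQ hR hSig hn hm hT hsigma hh Kt
      (add_nonneg (pMax_nonneg N) (ca_pos hn hQ).le) (div_nonneg (c3_nonneg N) two_pos.le) hb
      (qf_inputWeight_le_c3 hh hle) hKc hα (S.xi1 D N ζ Kt h K₀) (S.xi2 N) rfl rfl W hW G hG
    refine h1.trans ?_
    have h2s : 2 / (t + θ) ≤ 1 := by
      rw [div_le_one hs0]; linarith [(Nat.cast_nonneg t : (0 : ℝ) ≤ t)]
    rw [hV, ← ENNReal.ofReal_mul (by linarith), ← ENNReal.ofReal_add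
      (mul_nonneg (by linarith) hE0) (by positivity)]
    refine ENNReal.ofReal_le_ofReal (add_le_add (le_of_eq ?_) ?_)
    · rw [stepSize, ← hθdef]; field_simp
    · have h3 : 2 * S.smoothL N * S.xi3 D N ζ Kt h K₀ / (S.mu ^ 2 * J) ≤ θ := le_max_right _ _
      rw [div_le_iff₀ (by positivity)] at h3
      have h4 : S.xi3 D N ζ Kt h K₀ = 1 / S.sigma ^ 2 * S.xi1 D N ζ Kt h K₀ ^ 2 * m
          + 2 * S.xi1 D N ζ Kt h K₀ * S.xi2 N * m * (m + 2)
          + S.sigma ^ 2 * S.xi2 N ^ 2 * m * (m + 2) * (m + 4) := rfl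
      rw [← h4]
      have h5 : S.stepSize D N ζ Kt h K₀ t ^ 2 * (S.c3 N / 2 * specNorm S.Sigma0)
          * S.xi3 D N ζ Kt h K₀
          = 2 * S.smoothL N * S.xi3 D N ζ Kt h K₀ / S.mu ^ 2 / (t + θ) ^ 2 := by
        rw [stepSize, smoothL, ← hθdef]; field_simp
      rw [h5]
      refine div_le_div_of_nonneg_right ?_ (by positivity)
      rw [div_le_iff₀ (by positivity)]
      linarith
  -- The level $\mu\varsigma^2/4=\sigma_{\min}(\Sigma_0)\sigma_{\min}(R)\varsigma^2$ of the excess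
  -- corresponds to the Frobenius error $\varsigma$.
  have hv : 0 < S.mu / 4 * S.tol N ε h ^ 2 := by positivity
  have hmain := measure_markovIter_gt_le hstep K₀ hY hlaw hind hVm hJ hζ hθ
    (ENNReal.ofReal_le_ofReal (excess_le_surrogate hD hQ hR hT hh Kt K₀)) hdrift T hv
  refine (measure_mono fun ω hω => ?_).trans (hmain.trans (ENNReal.ofReal_le_ofReal ?_))
  · have hω' : S.tol N ε h ^ 2 < frobSq (S.innerIter D N ζ Kt h K₀ (fun t => Y t ω) T - G) :=
      not_le.1 hω
    rw [innerIter_eq_markovIter] at hω'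
    have h1 := hD.frobSq_le_excess hSig hsR.le (W := W) (sigmaMin_le_inputWeight hR hPs)
      (markovIter step K₀ (fun t => Y t ω) T - G)
    have h2 : S.mu / 4 * S.tol N ε h ^ 2
        < excess D W (markovIter step K₀ (fun t => Y t ω) T - G) := by
      refine lt_of_lt_of_le ?_ h1
      rw [hμdef]
      have := mul_lt_mul_of_pos_left hω' (mul_pos hsS hsR)
      linarith
    exact (ENNReal.ofReal_lt_ofReal_iff (hv.trans h2)).2 h2
  · have hTle : 40 / (7 * S.mu * S.tol N ε h ^ 2 * ζ) * θ * J ≤ T := Nat.le_ceil _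
    have hTθ : (T : ℝ) ≤ T + θ := by linarith
    have h0 : 0 < 40 / (7 * S.mu * S.tol N ε h ^ 2 * ζ) * θ * J := by positivity
    -- The constant $40/7$ in $T_h$ is $4\cdot\frac{10}7$: it leaves failure probability $7\zeta/10$
    -- beside the $3\zeta/10$ of escape.
    have h1 : θ * J / ((T + θ) * (S.mu / 4 * S.tol N ε h ^ 2)) ≤ 7 * ζ / 10 := by
      rw [div_le_iff₀ (mul_pos (by linarith) hv)]
      calc θ * J = 7 * ζ / 10 * ((40 / (7 * S.mu * S.tol N ε h ^ 2 * ζ) * θ * J)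
            * (S.mu / 4 * S.tol N ε h ^ 2)) := by field_simp; norm_num
        _ ≤ _ := by
          refine mul_le_mul_of_nonneg_left ?_ (by positivity)
          exact mul_le_mul_of_nonneg_right (hTle.trans hTθ) hv.le
    linarith

end LQR

/-! ### Independence of the computed gains and the fresh samples, and the union bound over stages.
-/

lemma measurable_iSup_comap {Ω ι β : Type*} [mβ : MeasurableSpace β] (z : ι → Ω → β) {s : Set ι}
    {p : ι} (hp : p ∈ s) : Measurable[⨆ p ∈ s, mβ.comap (z p)] (z p) :=
  measurable_iff_comap_le.2 (le_iSup₂ (f := fun (p : ι) (_ : p ∈ s) => mβ.comap (z p)) p hp)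

lemma measurable_pi_of_forall {Ω ι β : Type*} {F : MeasurableSpace Ω} [MeasurableSpace β]
    {y : ι → Ω → β} (hy : ∀ t, Measurable[F] (y t)) : Measurable[F] fun ω t => y t ω :=
  measurable_pi_iff.2 hy

/-- Functions of disjoint families of independent random variables are independent. -/
lemma ProbabilityTheory.iIndepFun.indepFun_of_disjoint {Ω ι β γ δ : Type*} [MeasurableSpace Ω]
    [mβ : MeasurableSpace β] [MeasurableSpace γ] [MeasurableSpace δ] {Pr : Measure Ω}
    {z : ι → Ω → β} (hz : iIndepFun z Pr) (hzm : ∀ p, Measurable (z p)) {s t : Set ι}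
    (hst : Disjoint s t) {X : Ω → γ} {Y : Ω → δ}
    (hX : Measurable[⨆ p ∈ s, mβ.comap (z p)] X) (hY : Measurable[⨆ p ∈ t, mβ.comap (z p)] Y) :
    IndepFun X Y Pr := by
  rw [IndepFun_iff_Indep]
  exact indep_of_indep_of_le_left (indep_of_indep_of_le_right
    (indep_iSup_of_disjoint (fun p => (hzm p).comap_le) hz.iIndep hst)
    (measurable_iff_comap_le.1 hY)) (measurable_iff_comap_le.1 hX)

namespace LQR

variable {n m : ℕ} {S : LQR n m} {D : Measure (Fin n → ℝ)} {N h : ℕ}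

/-- After $k$ passes only samples of the stages from $N-k$ on have been used; an earlier stage $h$
draws from a disjoint family. -/
lemma indepFun_table_samples (hD : S.IsInitialLaw D)
    (hQ : S.Q.PosDef) (hR : S.R.PosDef) (hT : S.QN.PosSemidef) (ε ζ : ℝ) {κ : ℝ}
    {init : ℕ → (ℕ → Matrix (Fin m) (Fin n) ℝ) → Matrix (Fin m) (Fin n) ℝ}
    (hinit : IsInitRule κ init)
    {Ω : Type*} [MeasurableSpace Ω] {Pr : Measure Ω}
    {z : ℕ → ℕ → Ω → (Fin n → ℝ) × (Fin m → ℝ)} (hz : IsSampleArray Pr D z) {k : ℕ}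
    (hk : k ≤ N) (hh : h < N - k) :
    IndepFun (fun ω => S.table D N ε ζ init (fun h t => z h t ω) k) (fun ω t => z h t ω) Pr := by
  obtain ⟨hzm, -, hzi⟩ := hz
  refine hzi.indepFun_of_disjoint (s := {p | N - k ≤ p.1}) (t := {p | p.1 = h})
    (fun p => hzm p.1 p.2) ?_ ?_ ?_
  · rw [Set.disjoint_left]
    rintro p (hp : N - k ≤ p.1) (hp' : p.1 = h)
    omega
  · exact measurable_table_of_le hD hQ hR hT ε ζ hinit hk fun h' h1 _ t =>
      measurable_iSup_comap (fun p : ℕ × ℕ => z p.1 p.2) (p := (h', t)) h1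
  · exact measurable_pi_of_forall fun t =>
      measurable_iSup_comap (fun p : ℕ × ℕ => z p.1 p.2) (s := {p | p.1 = h}) (p := (h, t)) rfl

lemma measurableSet_forall_stageAccurate (N : ℕ) (ε : ℝ) (j₀ : ℕ) :
    MeasurableSet {Kt : ℕ → Matrix (Fin m) (Fin n) ℝ |
      ∀ j, j₀ ≤ j → j < N → S.StageAccurate N ε Kt j} := by
  simp only [Set.ofPred_forall]
  exact MeasurableSet.iInter fun j => MeasurableSet.iInter fun _ =>
    MeasurableSet.iInter fun _ => measurableSet_stageAccurate N ε j

lemma measurableSet_stageResult_bad (hD : S.IsInitialLaw D)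
    (hQ : S.Q.PosDef) (hR : S.R.PosDef) (hT : S.QN.PosSemidef) (hh : h < N) (ε ζ : ℝ) {κ : ℝ}
    {init : ℕ → (ℕ → Matrix (Fin m) (Fin n) ℝ) → Matrix (Fin m) (Fin n) ℝ}
    (hinit : IsInitRule κ init) :
    MeasurableSet
      {p : (ℕ → Matrix (Fin m) (Fin n) ℝ) × (ℕ → (Fin n → ℝ) × (Fin m → ℝ)) |
      ¬ frobSq (S.stageResult D N ε ζ init h p.1 p.2 - S.gain (S.costMat N p.1 (h + 1)))
        ≤ S.tol N ε h ^ 2} := by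
  refine (measurableSet_le (Measurable.frobSq' ?_) measurable_const).compl
  exact (measurable_stageResult hD hQ hR hT hh ε ζ hinit measurable_fst
    measurable_snd).matrix_sub' (measurable_gain (measurable_costMat measurable_fst N (h + 1)))

/-- The new gain of the next pass is the only way in which accuracy can get lost. -/
lemma stageAccurate_table_succ {ε ζ : ℝ}
    {init : ℕ → (ℕ → Matrix (Fin m) (Fin n) ℝ) → Matrix (Fin m) (Fin n) ℝ}
    {z : ℕ → ℕ → (Fin n → ℝ) × (Fin m → ℝ)} {k : ℕ} (hk : k + 1 ≤ N)
    (hacc : ∀ j, N - k ≤ j → j < N → S.StageAccurate N ε (S.table D N ε ζ init z k) j)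
    (hnew : frobSq (S.stageResult D N ε ζ init (N - 1 - k) (S.table D N ε ζ init z k)
      (z (N - 1 - k)) - S.gain (S.costMat N (S.table D N ε ζ init z k) (N - 1 - k + 1)))
        ≤ S.tol N ε (N - 1 - k) ^ 2) (j : ℕ) (h1 : N - (k + 1) ≤ j) (h2 : j < N) :
    S.StageAccurate N ε (S.table D N ε ζ init z (k + 1)) j := by
  have hagree : ∀ i, N - 1 - k + 1 ≤ i → i < N →
      S.table D N ε ζ init z (k + 1) i = S.table D N ε ζ init z k i := fun i h3 _ =>
    table_apply_of_le ε ζ init _ (by omega) hk (by omega)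
  by_cases hj : j = N - 1 - k
  · rw [hj, StageAccurate, costMat_congr hagree, table_succ, Function.update_self]
    exact hnew
  · exact (stageAccurate_congr (fun i h3 h4 => hagree i (by omega) h4) h2).2
      (hacc j (by omega) h2)

/-- After `k` passes, all computed gains are accurate with probability at least `1 - k ζ`. -/
lemma measure_not_accurate_le (hD : S.IsInitialLaw D) (hQ : S.Q.PosDef) (hR : S.R.PosDef)
    (hSig : S.Sigma0.PosDef) (hn : 0 < n) (hm : 0 < m) (hT : S.QN.PosSemidef)
    (hsigma : 0 < S.sigma) {ε ζ : ℝ} (hε : 0 < ε) (hζ : 0 < ζ)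
    (htol : ∀ h < N, 0 < S.tol N ε h) {κ : ℝ}
    {init : ℕ → (ℕ → Matrix (Fin m) (Fin n) ℝ) → Matrix (Fin m) (Fin n) ℝ}
    (hinit : IsInitRule κ init)
    {Ω : Type*} [MeasurableSpace Ω] {Pr : Measure Ω} [IsProbabilityMeasure Pr]
    {z : ℕ → ℕ → Ω → (Fin n → ℝ) × (Fin m → ℝ)} (hz : IsSampleArray Pr D z) {k : ℕ}
    (hk : k ≤ N) :
    Pr {ω | ¬ ∀ j, N - k ≤ j → j < N →
      S.StageAccurate N ε (S.table D N ε ζ init (fun h t => z h t ω) k) j}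
      ≤ k * ENNReal.ofReal ζ := by
  induction k with
  | zero =>
    have : {ω | ¬ ∀ j, N - 0 ≤ j → j < N →
      S.StageAccurate N ε (S.table D N ε ζ init (fun h t => z h t ω) 0) j} = ∅ := by
      refine Set.eq_empty_of_forall_notMem fun ω hω => hω fun j h1 h2 => absurd h2 (by omega)
    rw [this]; simp
  | succ k ih =>
    have hh : N - 1 - k < N := by omega
    have hXm : Measurable fun ω => S.table D N ε ζ init (fun h t => z h t ω) k :=
      measurable_table_of_le hD hQ hR hT ε ζ hinit (by omega) fun h _ _ t => hz.1 h t
    have hYm : Measurable fun ω t => z (N - 1 - k) t ω := measurable_pi_iff.2 fun t => hz.1 _ t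
    have hbad := measure_indepFun_le hXm hYm
      (indepFun_table_samples hD hQ hR hT ε ζ hinit hz (by omega) (by omega))
      (measurableSet_forall_stageAccurate (S := S) N ε (N - k))
      (measurableSet_stageResult_bad hD hQ hR hT hh ε ζ hinit) (c := ENNReal.ofReal ζ)
      -- For a frozen table the initial gain, the step sizes and the number of iterations are
      -- deterministic, so the one-stage bound applies to every accurate table.
      fun Kt hKt => measure_stage_le hD hQ hR hSig hn hm hT hsigma hh hζ (htol _ hh)
        (costMat_le_rde_add_ca hm hn hQ hR hT (by omega) hε (by omega) (by omega)
          fun j h1 h2 => hKt j (by omega) h2) (init _ Kt)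
        (fun t => hz.1 _ t) (fun t => hz.2.1 _ t)
        (hz.2.2.precomp (g := fun t : ℕ => (N - 1 - k, t)) fun a b hab => by simpa using hab)
    calc _ ≤ Pr ({ω | ¬ ∀ j, N - k ≤ j → j < N →
          S.StageAccurate N ε (S.table D N ε ζ init (fun h t => z h t ω) k) j} ∪ _) := by
          refine measure_mono fun ω hω => ?_
          by_contra hcon
          rw [Set.mem_union, not_or] at hcon
          have hg := not_not.1 hcon.1
          exact hω fun j h1 h2 => stageAccurate_table_succ hk hg
            (not_not.1 fun hb => hcon.2 ⟨hg, hb⟩) j h1 h2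
      _ ≤ _ := measure_union_le _ _
      _ ≤ k * ENNReal.ofReal ζ + ENNReal.ofReal ζ := add_le_add (ih (by omega)) hbad
      _ = _ := by push_cast; ring

end LQR

/-! ### Sample complexity -/

namespace LQR

variable {n m : ℕ} {S : LQR n m} {P : Matrix (Fin n) (Fin n) ℝ}

/-- A bound independent of the number of steps. It makes $p$, $C_1$ and $C_3$ bounded uniformly in
the horizon, and so in $\varepsilon$. -/
lemma exists_specNorm_iterate_riccati_le (hn : 0 < n) (hQ : S.Q.PosDef) (hR : S.R.PosDef)
    (hP : S.IsARESolution P) (hQN : (S.QN - P).PosSemidef) :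
    ∃ p : ℝ, 0 < p ∧ ∀ k, specNorm (S.riccati^[k] S.QN) ≤ p := by
  have hc : 0 ≤ inducedNorm P (S.QN - P) * condNumber P :=
    mul_nonneg (inducedNorm_nonneg _ _) (mul_nonneg (specNorm_nonneg _) (specNorm_nonneg _))
  refine ⟨inducedNorm P (S.QN - P) * condNumber P + specNorm P + 1, ?_, fun k => ?_⟩
  · linarith [specNorm_nonneg P]
  · have h1 := specNorm_iterate_riccati_sub_le hQ hR hP hQN k
    have h2 := specNorm_add_le (S.riccati^[k] S.QN - P) P
    rw [sub_add_cancel] at h2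
    have h3 := mul_le_of_le_one_right hc (pow_le_one₀ (n := 2 * k)
      (inducedNorm_nonneg P (S.A - S.B * S.gain P)) (inducedNorm_closedLoop_lt_one hn hQ hR hP).le)
    linarith

lemma pMax_le {p : ℝ} (hp : 0 ≤ p) (h : ∀ k, specNorm (S.riccati^[k] S.QN) ≤ p) (N : ℕ) :
    S.pMax N ≤ p := Real.iSup_le (fun _ => h _) hp

lemma exists_c1_le (hm : 0 < m) (hQ : S.Q.PosDef) (hR : S.R.PosDef)
    (hT : S.QN.PosSemidef) {p : ℝ} (hp : 0 ≤ p) (h : ∀ k, specNorm (S.riccati^[k] S.QN) ≤ p) :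
    ∃ c : ℝ, 0 ≤ c ∧ ∀ N, S.c1 N ≤ c := by
  have hl := lambdaMin_pos hm hR
  have hB := specNorm_nonneg S.B
  have hA := specNorm_nonneg S.A
  have hφ : ∀ N, S.phi N ≤ specNorm S.A
      + specNorm S.B * (specNorm S.B * p * specNorm S.A / lambdaMin S.R) := fun N =>
    Real.iSup_le (fun t => by
      have h1 := specNorm_gain_le hm hR (rde_posSemidef hQ hR hT N (t + 1))
      have h2 : specNorm S.B * specNorm (S.rde N (t + 1)) * specNorm S.A / lambdaMin S.R
          ≤ specNorm S.B * p * specNorm S.A / lambdaMin S.R := by gcongr; exact h _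
      exact (specNorm_sub_le _ _).trans (add_le_add le_rfl ((specNorm_mul_le _ _).trans
        (mul_le_mul_of_nonneg_left (h1.trans h2) hB)))) (by positivity)
  refine ⟨_, ?_, fun N => div_le_div_of_nonneg_right
    (mul_le_mul_of_nonneg_right (hφ N) hB) hl.le⟩
  positivity

lemma exists_c3_le (hn : 0 < n) (hQ : S.Q.PosDef) {p : ℝ} (hp : 0 ≤ p)
    (h : ∀ k, specNorm (S.riccati^[k] S.QN) ≤ p) : ∃ c : ℝ, 0 ≤ c ∧ ∀ N, S.c3 N ≤ c := by
  have ha := (ca_pos hn hQ).le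
  have h1 : specNorm (S.ca • (1 : Matrix (Fin n) (Fin n) ℝ)) ≤ S.ca := by
    refine specNorm_le_of_qf (Matrix.PosSemidef.one.smul ha) ha fun x => ?_
    rw [qf_smul, qf_one]
  have hB := specNorm_nonneg S.B
  have hR' := specNorm_nonneg S.R
  refine ⟨2 * (specNorm S.R + specNorm S.B * (p + S.ca) * specNorm S.B), by positivity,
    fun N => mul_le_mul_of_nonneg_left (Real.iSup_le (fun t => ?_) (by positivity)) two_pos.le⟩
  refine (specNorm_add_le _ _).trans (add_le_add le_rfl ((specNorm_mul_le _ _).trans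
    (mul_le_mul_of_nonneg_right ((specNorm_mul_le _ _).trans ?_) hB)))
  rw [specNorm_transpose]
  exact mul_le_mul_of_nonneg_left ((specNorm_add_le _ _).trans (add_le_add (h _) h1)) hB

lemma inv_min_le {x y s : ℝ} (hx : x⁻¹ ≤ s) (hy : y⁻¹ ≤ s) : (min x y)⁻¹ ≤ s := by
  rcases min_choice x y with h | h <;> rwa [h]

/-- The tolerance of the stages `h ≥ 1` is of order `√(ε / N)`. -/
lemma exists_inv_tol_sq_le (hm : 0 < m) (hn : 0 < n) (hQ : S.Q.PosDef) (hR : S.R.PosDef)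
    (hT : S.QN.PosSemidef) {p : ℝ} (hp : 0 ≤ p) (hb : ∀ k, specNorm (S.riccati^[k] S.QN) ≤ p) :
    ∃ c : ℝ, 0 ≤ c ∧ ∀ (N h : ℕ) (ε : ℝ), 0 < ε → ε < 1 → 1 ≤ h → h < N →
      (S.tol N ε h ^ 2)⁻¹ ≤ c * N * ε⁻¹ := by
  obtain ⟨b1, hb1, hc1⟩ := exists_c1_le hm hQ hR hT hp hb
  obtain ⟨b3, hb3, hc3⟩ := exists_c3_le hn hQ hp hb
  have ha := ca_pos hn hQ
  have he : 0 < Real.exp 1 := Real.exp_pos 1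
  refine ⟨b3 / S.ca + b3 / S.ca * (2 * Real.exp 1 * p / S.ca)
    + b3 / S.ca * (8 * Real.exp 1 * b1 * p) + 4 * b1 * b3, by positivity,
    fun N h ε hε hε1 h1 hN => ?_⟩
  have hN1 : (1 : ℝ) ≤ N := by exact_mod_cast (by omega : 1 ≤ N)
  have hi : 1 ≤ ε⁻¹ := (one_le_inv₀ hε).2 hε1.le
  have hNi : (N : ℝ) ≤ N * ε⁻¹ := le_mul_of_one_le_right (by linarith) hi
  have hiN : ε⁻¹ ≤ N * ε⁻¹ := le_mul_of_one_le_left (by linarith) hN1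
  have k1 := hc1 N
  have k3 := hc3 N
  have kp := pMax_le hp hb N
  have k1' := c1_nonneg hm hR N (S := S)
  have k3' := c3_nonneg N (S := S)
  have kp' := pMax_nonneg N (S := S)
  -- Each term of the minimum is inverted separately. The identities hold also for vanishing
  -- divisors, since $x/0=0$ and $0^{-1}=0$.
  have e1 : (S.ca / S.c3 N * (1 / N))⁻¹ ≤ b3 / S.ca * (N * ε⁻¹) := by
    rw [mul_inv, inv_div, one_div, inv_inv]; gcongr
  have e2 : (S.ca / S.c3 N * (S.ca / (2 * Real.exp 1 * N * S.pMax N)))⁻¹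
      ≤ b3 / S.ca * (2 * Real.exp 1 * p / S.ca) * (N * ε⁻¹) := by
    rw [mul_inv, inv_div, inv_div]
    calc _ = S.c3 N / S.ca * (2 * Real.exp 1 * S.pMax N / S.ca) * N := by ring
      _ ≤ _ := by gcongr
  have e3 : (S.ca / S.c3 N * (ε / (8 * Real.exp 1 * N * S.c1 N * S.pMax N)))⁻¹
      ≤ b3 / S.ca * (8 * Real.exp 1 * b1 * p) * (N * ε⁻¹) := by
    rw [mul_inv, inv_div, inv_div]
    calc _ = S.c3 N / S.ca * (8 * Real.exp 1 * S.c1 N * S.pMax N) * (N * ε⁻¹) := by ring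
      _ ≤ _ := by gcongr
  have e4 : (ε / (4 * S.c1 N * S.c3 N))⁻¹ ≤ 4 * b1 * b3 * (N * ε⁻¹) := by
    rw [inv_div, div_eq_mul_inv]; gcongr
  have hNε : 0 ≤ N * ε⁻¹ := by linarith
  have p1 : 0 ≤ b3 / S.ca * (N * ε⁻¹) := by positivity
  have p2 : 0 ≤ b3 / S.ca * (2 * Real.exp 1 * p / S.ca) * (N * ε⁻¹) := by positivity
  have p3 : 0 ≤ b3 / S.ca * (8 * Real.exp 1 * b1 * p) * (N * ε⁻¹) := by positivity
  have p4 : 0 ≤ 4 * b1 * b3 * (N * ε⁻¹) := by positivity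
  rw [tol_sq_eq hm hn hQ hR hε h1]
  refine inv_min_le (inv_min_le ?_ ?_) (inv_min_le ?_ ?_) <;> linarith

/-- The tolerances are positive: if the horizon exceeds one, then no divisor vanishes. -/
lemma tol_pos (hm : 0 < m) (hn : 0 < n) (hQ : S.Q.PosDef) (hR : S.R.PosDef) (hA : IsUnit S.A)
    (hP : S.IsARESolution P) (hQN : (S.QN - P).PosSemidef) {ε : ℝ} (hε : 0 < ε) {h : ℕ}
    (hh : h < S.horizon P ε) : 0 < S.tol (S.horizon P ε) ε h := by
  have hT := terminal_posSemidef hP hQN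
  rcases Nat.eq_zero_or_pos h with rfl | h1
  · rw [tol, if_pos rfl]; positivity
  set N := S.horizon P ε with hN
  have hN2 : 2 ≤ N := by omega
  have hB : 0 < specNorm S.B := by
    refine (specNorm_nonneg _).lt_of_ne fun h0 => ?_
    -- If $B=0$ the argument of the logarithm is $0$ and `Real.log 0 = 0`, so the horizon is $1$ and
    -- there is no stage $h\ge1$.
    have : N = 1 := by rw [hN, horizon, ← h0]; simp
    omega
  have ha := ca_pos hn hQ
  have h3 := c3_pos hm hn hQ hR hT (by omega : 1 ≤ N)
  have hφ : 0 < S.phi N := by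
    refine lt_of_lt_of_le ?_ (le_iSup_fin (fun t : Fin N => specNorm (S.A - S.B * S.optGain N t))
      ⟨0, by omega⟩)
    exact (specNorm_nonneg _).lt_of_ne fun h0 =>
      closedLoop_ne_zero hn hR hA (rde_posSemidef hQ hR hT N (0 + 1)) (specNorm_eq_zero.1 h0.symm)
  have h1' : 0 < S.c1 N := div_pos (mul_pos hφ hB) (lambdaMin_pos hm hR)
  have hp : 0 < S.pMax N := by
    have hx : (1 : Fin n → ℝ) ≠ 0 := fun h => by simpa using congrFun h ⟨0, hn⟩
    have k1 := qf_pos hP.1 hx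
    have k2 := iterate_riccati_ge hQ hR hP hQN (N - 1) 1
    have k3 := qf_rde_le_pMax (S := S) (N := N) (h := 1) le_rfl (by omega) 1
    rw [rde] at k3
    exact pos_of_mul_pos_left (k1.trans_le (k2.trans k3)) (dotProduct_self_nonneg' _)
  have hN0 : (0 : ℝ) < N := by exact_mod_cast (by omega : 0 < N)
  have he := Real.exp_pos 1
  rw [tol, if_neg (by omega)]
  refine lt_min (lt_min ?_ ?_) (lt_min ?_ ?_) <;> exact Real.sqrt_pos.2 (by positivity)

/-- The horizon grows logarithmically in `1 / ε`. -/
lemma exists_horizon_le (hn : 0 < n) (hm : 0 < m) (hQ : S.Q.PosDef) (hR : S.R.PosDef)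
    (hA : IsUnit S.A) (hP : S.IsARESolution P) :
    ∃ c : ℝ, 0 < c ∧ ∀ ε : ℝ, 0 < ε → ε < 1 →
      (S.horizon P ε : ℝ) ≤ c * (1 + Real.log (1 / ε)) := by
  have hl := lambdaMin_pos hm hR
  set ρ := inducedNorm P (S.A - S.B * S.gain P) with hρ
  have hρ0 : 0 < ρ := inducedNorm_closedLoop_pos hn hR hA hP
  have hρ1 : ρ < 1 := inducedNorm_closedLoop_lt_one hn hQ hR hP
  have hlog : 0 < Real.log (1 / ρ) := Real.log_pos ((one_lt_div hρ0).2 hρ1)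
  set X := 2 * inducedNorm P (S.QN - P) * condNumber P * specNorm (S.A - S.B * S.gain P)
        * specNorm S.B with hX
  refine ⟨(|Real.log (X / lambdaMin S.R)| + 1) / (2 * Real.log (1 / ρ)) + 3, by positivity,
    fun ε hε hε1 => ?_⟩
  have hl0 : 0 ≤ Real.log (1 / ε) := Real.log_nonneg ((one_le_div hε).2 hε1.le)
  have hXl : Real.log (X / (ε * lambdaMin S.R))
      ≤ |Real.log (X / lambdaMin S.R)| + Real.log (1 / ε) := by
    by_cases h0 : X / lambdaMin S.R = 0
    · rw [mul_comm, ← div_div, h0]; simpa using hl0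
    · rw [mul_comm, ← div_div, div_eq_mul_one_div (X / lambdaMin S.R) ε,
        Real.log_mul h0 (by positivity)]
      exact add_le_add (le_abs_self _) le_rfl
  have h1 : 1 / 2 * (Real.log (X / (ε * lambdaMin S.R)) / Real.log (1 / ρ)) + 1
      ≤ ((|Real.log (X / lambdaMin S.R)| + 1) / (2 * Real.log (1 / ρ)) + 1)
        * (1 + Real.log (1 / ε)) := by
    have h2 : Real.log (X / (ε * lambdaMin S.R))
        ≤ (|Real.log (X / lambdaMin S.R)| + 1) * (1 + Real.log (1 / ε)) := by
      nlinarith [abs_nonneg (Real.log (X / lambdaMin S.R))]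
    have h3 := div_le_div_of_nonneg_right h2 hlog.le
    calc _ ≤ 1 / 2 * ((|Real.log (X / lambdaMin S.R)| + 1) * (1 + Real.log (1 / ε))
          / Real.log (1 / ρ)) + (1 + Real.log (1 / ε)) := by linarith
      _ = _ := by field_simp
  set Y := ((|Real.log (X / lambdaMin S.R)| + 1) / (2 * Real.log (1 / ρ)) + 1)
        * (1 + Real.log (1 / ε)) with hY
  have hY0 : 0 ≤ Y := by positivity
  have h4 : (S.horizon P ε : ℝ) ≤ Y + 1 := by
    rw [horizon, Nat.cast_max, Nat.cast_one]
    exact max_le (by linarith) ((Nat.cast_le.2 (Nat.ceil_le_ceil h1)).trans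
      (Nat.ceil_lt_add_one hY0).le)
  rw [hY] at h4
  linarith

end LQR

/-! ### Uniform bounds for the initial costs and the iteration numbers. -/

namespace LQR

variable {n m : ℕ} {S : LQR n m} {P : Matrix (Fin n) (Fin n) ℝ}

lemma specNorm_costMat_le (hm : 0 < m) (hn : 0 < n) (hQ : S.Q.PosDef) (hR : S.R.PosDef)
    (hT : S.QN.PosSemidef) {p : ℝ} (hp : 0 ≤ p) (hb : ∀ k, specNorm (S.riccati^[k] S.QN) ≤ p)
    {N : ℕ} {ε : ℝ} (hε : 0 < ε) {Kt : ℕ → Matrix (Fin m) (Fin n) ℝ} {h : ℕ} (h1 : 1 ≤ h)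
    (hh : h ≤ N) (hacc : ∀ j, h ≤ j → j < N → S.StageAccurate N ε Kt j) :
    specNorm (S.costMat N Kt h) ≤ p + S.ca := by
  refine specNorm_le_of_qf (costMat_posSemidef hQ hR hT N Kt h)
    (add_nonneg hp (ca_pos hn hQ).le) fun x => ?_
  have k1 := costMat_le_rde_add_ca hm hn hQ hR hT (h1.trans hh) hε hh h1 hacc x
  have k2 := (qf_le_specNorm (S.rde N h) x).trans
    (mul_le_mul_of_nonneg_right (hb _) (dotProduct_self_nonneg' x))
  linarith

/-- An accurate gain is close to the Riccati gain of a bounded cost matrix, and the first term of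
the minimum keeps the tolerance bounded. Thus an initialization depending on the next gain starts
with bounded cost. -/
lemma exists_specNorm_le_of_stageAccurate (hm : 0 < m) (hn : 0 < n) (hQ : S.Q.PosDef)
    (hR : S.R.PosDef) (hT : S.QN.PosSemidef) {p : ℝ} (hp : 0 ≤ p)
    (hb : ∀ k, specNorm (S.riccati^[k] S.QN) ≤ p) :
    ∃ c : ℝ, 0 ≤ c ∧ ∀ (N : ℕ) (ε : ℝ) (Kt : ℕ → Matrix (Fin m) (Fin n) ℝ) (h : ℕ),
      0 < ε → 1 ≤ h → h < N → (∀ j, h ≤ j → j < N → S.StageAccurate N ε Kt j) →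
      specNorm (Kt h) ≤ c := by
  have ha := ca_pos hn hQ
  have hl := lambdaMin_pos hm hR
  have hs := sigmaMin_pos hm hR
  have hB := specNorm_nonneg S.B
  have hA := specNorm_nonneg S.A
  refine ⟨1 + S.ca / (2 * sigmaMin S.R) + specNorm S.B * (p + S.ca) * specNorm S.A
    / lambdaMin S.R, by positivity, fun N ε Kt h hε h1 hh hacc => ?_⟩
  have hN1 : (1 : ℝ) ≤ N := by exact_mod_cast (by omega : 1 ≤ N)
  have hc3 := sigmaMin_le_c3 hm hn hQ hR hT (by omega : 1 ≤ N)
  have h2 : specNorm (Kt h - S.gain (S.costMat N Kt (h + 1))) ≤ S.tol N ε h :=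
    specNorm_le_of_frobSq (tol_nonneg hε) (hacc h le_rfl hh)
  have h3 : S.tol N ε h ^ 2 ≤ S.ca / (2 * sigmaMin S.R) := by
    rw [tol_sq_eq hm hn hQ hR hε h1]
    refine (min_le_left _ _).trans ((min_le_left _ _).trans ?_)
    calc S.ca / S.c3 N * (1 / N) ≤ S.ca / S.c3 N :=
          mul_le_of_le_one_right (div_nonneg ha.le (c3_nonneg N))
            (by rw [div_le_one (by linarith)]; exact hN1)
      _ ≤ _ := by gcongr
  have h4 : specNorm (S.gain (S.costMat N Kt (h + 1)))
      ≤ specNorm S.B * (p + S.ca) * specNorm S.A / lambdaMin S.R := by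
    refine (specNorm_gain_le hm hR (costMat_posSemidef hQ hR hT N Kt (h + 1))).trans ?_
    have := specNorm_costMat_le hm hn hQ hR hT hp hb hε (h := h + 1) (by omega) hh
      fun j k1 k2 => hacc j (by omega) k2
    gcongr
  have h5 := specNorm_add_le (Kt h - S.gain (S.costMat N Kt (h + 1)))
    (S.gain (S.costMat N Kt (h + 1)))
  rw [sub_add_cancel] at h5
  -- Only $\varsigma^2$ has been bounded; $2\varsigma\le1+\varsigma^2$ accounts for the summand $1$
  -- in the constant.
  nlinarith [sq_nonneg (S.tol N ε h - 1)]

/-- The initial surrogate costs are bounded as long as the later stages are accurate. -/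
lemma exists_surrogate_le (hm : 0 < m) (hn : 0 < n) (hQ : S.Q.PosDef)
    (hR : S.R.PosDef) (hT : S.QN.PosSemidef) (hCm : 0 < S.Cm) {p : ℝ} (hp : 0 ≤ p)
    (hb : ∀ k, specNorm (S.riccati^[k] S.QN) ≤ p) (κ : ℝ) :
    ∃ J : ℝ, 0 ≤ J ∧ ∀ (N : ℕ) (ε : ℝ) (D : Measure (Fin n → ℝ))
      (Kt : ℕ → Matrix (Fin m) (Fin n) ℝ) (h : ℕ) (K₀ : Matrix (Fin m) (Fin n) ℝ),
      0 < ε → S.IsInitialLaw D → h < N →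
      (∀ j, h + 1 ≤ j → j < N → S.StageAccurate N ε Kt j) → Kt N = 0 →
      specNorm K₀ ≤ κ * (1 + specNorm (Kt (h + 1))) → S.surrogate D N Kt h K₀ ≤ J := by
  obtain ⟨c, hc, hK⟩ := exists_specNorm_le_of_stageAccurate hm hn hQ hR hT hp hb
  have ha := (ca_pos hn hQ).le
  have hQ' := specNorm_nonneg S.Q
  have hR' := specNorm_nonneg S.R
  have hA := specNorm_nonneg S.A
  have hB := specNorm_nonneg S.B
  obtain ⟨k, hk⟩ : ∃ k, k = |κ| * (1 + c) := ⟨_, rfl⟩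
  have hk0 : 0 ≤ k := by rw [hk]; positivity
  refine ⟨(specNorm S.Q + specNorm S.R * k ^ 2
    + (p + S.ca) * (specNorm S.A + specNorm S.B * k) ^ 2) * S.Cm, by positivity,
    fun N ε D Kt h K₀ hε hD hh hacc hz hK₀ => ?_⟩
  have h1 : specNorm (Kt (h + 1)) ≤ c := by
    -- At the last stage the next gain is the conventional $\widetilde K_N=0$.
    rcases Nat.lt_or_ge (h + 1) N with h2 | h2
    · exact hK N ε Kt (h + 1) hε (by omega) h2 hacc
    · rw [show h + 1 = N by omega, hz, specNorm_eq_zero.2 rfl]; exact hc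
  have h2 : specNorm K₀ ≤ k := by
    refine hK₀.trans ((mul_le_mul_of_nonneg_right (le_abs_self κ) ?_).trans ?_)
    · linarith [specNorm_nonneg (Kt (h + 1))]
    · rw [hk]; gcongr
  have h3 : specNorm (S.A - S.B * K₀) ≤ specNorm S.A + specNorm S.B * k :=
    (specNorm_sub_le _ _).trans (add_le_add le_rfl ((specNorm_mul_le _ _).trans
      (mul_le_mul_of_nonneg_left h2 hB)))
  have h4 := specNorm_costMat_le hm hn hQ hR hT hp hb hε (h := h + 1) (by omega) hh hacc
  have hn0 := specNorm_nonneg K₀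
  have hn1 := specNorm_nonneg (S.A - S.B * K₀)
  rw [surrogate_eq hh]
  refine hD.integral_qf_le (by positivity) fun x => ?_
  have hx := dotProduct_self_nonneg' x
  rw [qf_stageMat]
  have e1 := qf_le_specNorm S.Q x
  have e2 : qf S.R (K₀ *ᵥ x) ≤ specNorm S.R * k ^ 2 * (x ⬝ᵥ x) :=
    (qf_le_specNorm S.R _).trans ((mul_le_mul_of_nonneg_left (mulVec_sq_le K₀ x) hR').trans
      (by rw [← mul_assoc]; gcongr))
  have e3 : qf (S.costMat N Kt (h + 1)) ((S.A - S.B * K₀) *ᵥ x)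
      ≤ (p + S.ca) * (specNorm S.A + specNorm S.B * k) ^ 2 * (x ⬝ᵥ x) :=
    (qf_le_specNorm _ _).trans ((mul_le_mul_of_nonneg_left (mulVec_sq_le _ x)
      (specNorm_nonneg _)).trans (by rw [← mul_assoc]; gcongr))
  linarith

/-- The number of iterations of a stage, in terms of its tolerance. -/
lemma exists_numIters_le (hm : 0 < m) (hn : 0 < n) (hQ : S.Q.PosDef) (hR : S.R.PosDef)
    (hSig : S.Sigma0.PosDef) (hT : S.QN.PosSemidef) {p : ℝ} (hp : 0 ≤ p)
    (hb : ∀ k, specNorm (S.riccati^[k] S.QN) ≤ p) {J : ℝ} (hJ : 0 ≤ J) :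
    ∃ c : ℝ, 0 ≤ c ∧ ∀ (N : ℕ) (ε ζ : ℝ) (D : Measure (Fin n → ℝ))
      (Kt : ℕ → Matrix (Fin m) (Fin n) ℝ) (h : ℕ) (K₀ : Matrix (Fin m) (Fin n) ℝ),
      0 < ζ → ζ < 1 → S.IsInitialLaw D → h < N → S.surrogate D N Kt h K₀ ≤ J →
      (S.numIters D N ε ζ Kt h K₀ : ℝ) ≤ c * ζ⁻¹ ^ 3 * (S.tol N ε h ^ 2)⁻¹ + 1 := by
  obtain ⟨b3, hb3, hc3⟩ := exists_c3_le hn hQ hp hb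
  have ha := (ca_pos hn hQ).le
  have hμ := mu_pos hn hm hR hSig
  have hsS := sigmaMin_pos hn hSig
  have hsR := sigmaMin_pos hm hR
  have hQ' := specNorm_nonneg S.Q
  have hR' := specNorm_nonneg S.R
  have hA := specNorm_nonneg S.A
  have hB := specNorm_nonneg S.B
  have hS' := specNorm_nonneg S.Sigma0
  -- The $11$ is $10+1$: both $10\zeta^{-1}J$ and the minimum, which is at most $J\le J\zeta^{-1}$,
  -- are absorbed.
  obtain ⟨c, hc⟩ : ∃ c, c = 11 * J / (sigmaMin S.Sigma0 * sigmaMin S.R) := ⟨_, rfl⟩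
  have hc0 : 0 ≤ c := by rw [hc]; positivity
  obtain ⟨X₁, hX₁⟩ : ∃ X, X = (specNorm S.Q + 2 * specNorm S.R * c + 2 * (p + S.ca)
    * (specNorm S.A ^ 2 + 2 * specNorm S.B ^ 2 * c)) * √S.Cm ^ 3 := ⟨_, rfl⟩
  have hX₁0 : 0 ≤ X₁ := by rw [hX₁]; positivity
  obtain ⟨X₂, hX₂⟩ : ∃ X, X = 2 * (specNorm S.R + 2 * (p + S.ca) * specNorm S.B ^ 2) * √S.Cm :=
    ⟨_, rfl⟩
  have hX₂0 : 0 ≤ X₂ := by rw [hX₂]; positivity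
  obtain ⟨X₃, hX₃⟩ : ∃ X, X = 1 / S.sigma ^ 2 * X₁ ^ 2 * m + 2 * X₁ * X₂ * m * (m + 2)
    + S.sigma ^ 2 * X₂ ^ 2 * m * (m + 2) * (m + 4) := ⟨_, rfl⟩
  have hX₃0 : 0 ≤ X₃ := by rw [hX₃]; positivity
  refine ⟨40 / (7 * S.mu) * (2 * J + 2 * (b3 * specNorm S.Sigma0) * X₃ / S.mu ^ 2),
    by positivity, fun N ε ζ D Kt h K₀ hζ hζ1 hD hh hJle => ?_⟩
  have hz : 1 ≤ ζ⁻¹ := (one_le_inv₀ hζ).2 hζ1.le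
  have hz2 : 1 ≤ ζ⁻¹ ^ 2 := one_le_pow₀ hz
  have hJ0 := surrogate_pos hD hQ hR hSig hn hT hh Kt K₀
  have hmin := (surrogateMin_le hD hQ hR hT hh Kt K₀).trans hJle
  have hmin0 := surrogateMin_nonneg hD hQ hR hT hh Kt
  have kp := pMax_le hp hb N
  have kp' := pMax_nonneg N (S := S)
  have k3 := hc3 N
  have k3' := c3_nonneg N (S := S)
  have hC0 : 0 ≤ S.cTilde D N ζ Kt h K₀ := by
    rw [cTilde]; positivity
  have hC : S.cTilde D N ζ Kt h K₀ ≤ c * ζ⁻¹ := by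
    rw [cTilde, hc, div_mul_eq_mul_div]
    refine div_le_div_of_nonneg_right ?_ (by positivity)
    have e1 : 10 * ζ⁻¹ * S.surrogate D N Kt h K₀ ≤ 10 * ζ⁻¹ * J := by gcongr
    have e2 : J ≤ J * ζ⁻¹ := le_mul_of_one_le_right hJ hz
    linarith
  have hx1' : 0 ≤ S.xi1 D N ζ Kt h K₀ := by rw [xi1]; positivity
  have hx1 : S.xi1 D N ζ Kt h K₀ ≤ X₁ * ζ⁻¹ := by
    calc S.xi1 D N ζ Kt h K₀ ≤ (specNorm S.Q * ζ⁻¹ + 2 * specNorm S.R * (c * ζ⁻¹) + 2 * (p + S.ca)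
          * (specNorm S.A ^ 2 * ζ⁻¹ + 2 * specNorm S.B ^ 2 * (c * ζ⁻¹))) * √S.Cm ^ 3 := by
          rw [xi1]
          gcongr
          · exact le_mul_of_one_le_right hQ' hz
          · exact le_mul_of_one_le_right (sq_nonneg _) hz
      _ = X₁ * ζ⁻¹ := by rw [hX₁]; ring
  have hx2' : 0 ≤ S.xi2 N := by rw [xi2]; positivity
  have hx2 : S.xi2 N ≤ X₂ := by rw [xi2, hX₂]; gcongr
  have hx3' : 0 ≤ S.xi3 D N ζ Kt h K₀ := by rw [xi3]; positivity
  have hx3 : S.xi3 D N ζ Kt h K₀ ≤ X₃ * ζ⁻¹ ^ 2 := by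
    have hzz : ζ⁻¹ ≤ ζ⁻¹ ^ 2 := by rw [sq]; exact le_mul_of_one_le_left (by linarith) hz
    calc S.xi3 D N ζ Kt h K₀ ≤ 1 / S.sigma ^ 2 * (X₁ * ζ⁻¹) ^ 2 * m
          + 2 * (X₁ * ζ⁻¹) * X₂ * m * (m + 2)
          + S.sigma ^ 2 * X₂ ^ 2 * m * (m + 2) * (m + 4) := by rw [xi3]; gcongr
      _ = 1 / S.sigma ^ 2 * X₁ ^ 2 * m * ζ⁻¹ ^ 2 + 2 * X₁ * X₂ * m * (m + 2) * ζ⁻¹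
          + S.sigma ^ 2 * X₂ ^ 2 * m * (m + 2) * (m + 4) * 1 := by ring
      _ ≤ 1 / S.sigma ^ 2 * X₁ ^ 2 * m * ζ⁻¹ ^ 2 + 2 * X₁ * X₂ * m * (m + 2) * ζ⁻¹ ^ 2
          + S.sigma ^ 2 * X₂ ^ 2 * m * (m + 2) * (m + 4) * ζ⁻¹ ^ 2 := by gcongr
      _ = _ := by rw [hX₃]; ring
  have hθ0 : 0 ≤ S.theta D N ζ Kt h K₀ := le_trans two_pos.le (le_max_left _ _)
  -- Only the product $\theta_h\widetilde J_h(K_{h,0})$ enters $T_h$, and there the division by the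
  -- cost cancels; no lower bound on the cost is needed. The power $\zeta^{-2}$ is that of
  -- $\xi_{h,1}^2$.
  have hθ : S.theta D N ζ Kt h K₀ * S.surrogate D N Kt h K₀
      ≤ (2 * J + 2 * (b3 * specNorm S.Sigma0) * X₃ / S.mu ^ 2) * ζ⁻¹ ^ 2 := by
    have q1 : 2 * S.surrogate D N Kt h K₀ ≤ 2 * J * ζ⁻¹ ^ 2 :=
      le_trans (by linarith) (le_mul_of_one_le_right (by positivity) hz2)
    have q2 : 2 * S.smoothL N * S.xi3 D N ζ Kt h K₀ / (S.mu ^ 2 * S.surrogate D N Kt h K₀)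
        * S.surrogate D N Kt h K₀
        ≤ 2 * (b3 * specNorm S.Sigma0) * X₃ / S.mu ^ 2 * ζ⁻¹ ^ 2 := by
      calc _ = 2 * (S.c3 N * specNorm S.Sigma0) * S.xi3 D N ζ Kt h K₀ / S.mu ^ 2 := by
            rw [smoothL]; field_simp
        _ ≤ 2 * (b3 * specNorm S.Sigma0) * (X₃ * ζ⁻¹ ^ 2) / S.mu ^ 2 := by gcongr
        _ = _ := by ring
    have q1' : 0 ≤ 2 * J * ζ⁻¹ ^ 2 := by positivity
    have q2' : 0 ≤ 2 * (b3 * specNorm S.Sigma0) * X₃ / S.mu ^ 2 * ζ⁻¹ ^ 2 := by positivity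
    rw [theta, max_mul_of_nonneg _ _ hJ0.le, add_mul]
    exact max_le (by linarith) (by linarith)
  have ht : 0 ≤ (S.tol N ε h ^ 2)⁻¹ := inv_nonneg.2 (sq_nonneg _)
  rw [numIters]
  refine (Nat.ceil_lt_add_one (by positivity)).le.trans (add_le_add ?_ le_rfl)
  calc 40 / (7 * S.mu * S.tol N ε h ^ 2 * ζ) * S.theta D N ζ Kt h K₀ * S.surrogate D N Kt h K₀
      = 40 / (7 * S.mu) * ζ⁻¹ * (S.tol N ε h ^ 2)⁻¹
        * (S.theta D N ζ Kt h K₀ * S.surrogate D N Kt h K₀) := by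
        rw [div_eq_mul_inv, mul_inv, mul_inv]; ring
    _ ≤ 40 / (7 * S.mu) * ζ⁻¹ * (S.tol N ε h ^ 2)⁻¹
        * ((2 * J + 2 * (b3 * specNorm S.Sigma0) * X₃ / S.mu ^ 2) * ζ⁻¹ ^ 2) := by gcongr
    _ = _ := by ring

end LQR

/-! ### The total number of samples. -/

namespace LQR

variable {n m : ℕ} {S : LQR n m} {P : Matrix (Fin n) (Fin n) ℝ}

/-- If all computed gains are accurate, then the sample complexity is of order `ζ⁻³ ε⁻²`. -/
lemma exists_totalSamples_le (hm : 0 < m) (hn : 0 < n) (hQ : S.Q.PosDef) (hR : S.R.PosDef)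
    (hSig : S.Sigma0.PosDef) (hCm : 0 < S.Cm) (hP : S.IsARESolution P)
    (hQN : (S.QN - P).PosSemidef) (κ : ℝ) {b : ℝ} (hb : 0 < b) :
    ∃ c : ℝ, 0 < c ∧ ∀ (N : ℕ) (ε ζ : ℝ) (D : Measure (Fin n → ℝ))
      (init : ℕ → (ℕ → Matrix (Fin m) (Fin n) ℝ) → Matrix (Fin m) (Fin n) ℝ)
      (z : ℕ → ℕ → (Fin n → ℝ) × (Fin m → ℝ)),
      0 < ε → ε < 1 → 0 < ζ → ζ < 1 → S.IsInitialLaw D → IsInitRule κ init → 1 ≤ N →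
      (N : ℝ) ≤ b * (1 + Real.log (1 / ε)) →
      (∀ j < N, S.StageAccurate N ε (S.table D N ε ζ init z N) j) →
      (S.totalSamples D N ε ζ init z : ℝ) ≤ c * ζ⁻¹ ^ 3 * ε⁻¹ ^ 2 := by
  have hT := terminal_posSemidef hP hQN
  obtain ⟨p, hp, hpb⟩ := exists_specNorm_iterate_riccati_le hn hQ hR hP hQN
  obtain ⟨J, hJ, hJb⟩ := exists_surrogate_le hm hn hQ hR hT hCm hp.le hpb κ
  obtain ⟨Y, hY, hYb⟩ := exists_numIters_le hm hn hQ hR hSig hT hp.le hpb hJ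
  obtain ⟨t, ht, htb⟩ := exists_inv_tol_sq_le hm hn hQ hR hT hp.le hpb
  refine ⟨16 * Y + Y * t * (4 * b ^ 2) + 4 * b ^ 2, by positivity,
    fun N ε ζ D init z hε hε1 hζ hζ1 hD hinit hN hNb hacc => ?_⟩
  have hN1 : (1 : ℝ) ≤ N := by exact_mod_cast hN
  have hz : 1 ≤ ζ⁻¹ ^ 3 := one_le_pow₀ ((one_le_inv₀ hζ).2 hζ1.le)
  have hi : 1 ≤ ε⁻¹ := (one_le_inv₀ hε).2 hε1.le
  -- A logarithmic horizon satisfies $N^2=O(\varepsilon^{-1})$, via $1+u\le2e^{u/2}$. This absorbs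
  -- the cost $N\cdot N/\varepsilon$ of the stages $h\ge1$ into $\varepsilon^{-2}$ without a
  -- logarithm.
  have hN2 : (N : ℝ) ^ 2 ≤ 4 * b ^ 2 * ε⁻¹ := by
    have h1 : 1 + Real.log (1 / ε) ≤ 2 * Real.exp (Real.log (1 / ε) / 2) := by
      linarith [Real.add_one_le_exp (Real.log (1 / ε) / 2)]
    have h2 : Real.exp (Real.log (1 / ε) / 2) ^ 2 = ε⁻¹ := by
      rw [← Real.exp_nat_mul, Nat.cast_two, mul_div_cancel₀ _ two_ne_zero, Real.exp_log
        (by positivity), one_div]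
    calc (N : ℝ) ^ 2 ≤ (b * (2 * Real.exp (Real.log (1 / ε) / 2))) ^ 2 :=
          pow_le_pow_left₀ (by linarith) (hNb.trans (mul_le_mul_of_nonneg_left h1 hb.le)) 2
      _ = 4 * b ^ 2 * Real.exp (Real.log (1 / ε) / 2) ^ 2 := by ring
      _ = _ := by rw [h2]
  have hstage : ∀ h < N, (S.stageSamples D N ε ζ init z h : ℝ)
      ≤ Y * ζ⁻¹ ^ 3 * (S.tol N ε h ^ 2)⁻¹ + 1 := fun h hh => by
    refine hYb N ε ζ D _ h _ hζ hζ1 hD hh (hJb N ε D _ h _ hε hD hh (fun j h1 h2 => ?_) ?_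
      ((hinit h).2 _))
    · refine (stageAccurate_congr (fun i h3 _ => ?_) h2).1 (hacc j h2)
      exact table_apply_of_le ε ζ init z (by omega) le_rfl (by omega)
    -- Entry $N$ is never written, so it still has its initial value $0$.
    · exact table_apply_of_le (k := 0) ε ζ init z (by omega) (by omega) (by omega)
  have hY3 : 0 ≤ Y * ζ⁻¹ ^ 3 := by positivity
  obtain ⟨M, rfl⟩ : ∃ M, N = M + 1 := ⟨N - 1, by omega⟩
  rw [totalSamples, Nat.cast_sum, Finset.sum_range_succ']
  -- Stage $0$, with tolerance $\varepsilon/4$, is the only one whose own cost is of order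
  -- $\varepsilon^{-2}$.
  have h0 : (S.stageSamples D (M + 1) ε ζ init z 0 : ℝ) ≤ Y * ζ⁻¹ ^ 3 * (16 * ε⁻¹ ^ 2) + 1 := by
    refine (hstage 0 (by omega)).trans_eq ?_
    rw [tol, if_pos rfl]; field_simp; norm_num
  have h1 : ∑ h ∈ Finset.range M, (S.stageSamples D (M + 1) ε ζ init z (h + 1) : ℝ)
      ≤ M * (Y * ζ⁻¹ ^ 3 * (t * (M + 1 : ℕ) * ε⁻¹) + 1) := by
    calc _ ≤ ∑ _h ∈ Finset.range M, (Y * ζ⁻¹ ^ 3 * (t * (M + 1 : ℕ) * ε⁻¹) + 1) := by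
          refine Finset.sum_le_sum fun h hh => ?_
          have hh' := Finset.mem_range.1 hh
          refine (hstage (h + 1) (by omega)).trans (add_le_add (mul_le_mul_of_nonneg_left
            (htb _ _ ε hε hε1 (by omega) (by omega)) hY3) le_rfl)
      _ = _ := by rw [Finset.sum_const, Finset.card_range, nsmul_eq_mul]
  set N' : ℝ := ((M + 1 : ℕ) : ℝ) with hN'
  have hM : (M : ℝ) = N' - 1 := by rw [hN']; push_cast; ring
  have hNN : N' ≤ N' ^ 2 := by nlinarith
  have h2 : (M : ℝ) * (Y * ζ⁻¹ ^ 3 * (t * N' * ε⁻¹)) ≤ Y * ζ⁻¹ ^ 3 * t * (4 * b ^ 2) * ε⁻¹ ^ 2 := by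
    calc _ ≤ N' * (Y * ζ⁻¹ ^ 3 * (t * N' * ε⁻¹)) := by gcongr; linarith
      _ = Y * ζ⁻¹ ^ 3 * t * ε⁻¹ * N' ^ 2 := by ring
      _ ≤ Y * ζ⁻¹ ^ 3 * t * ε⁻¹ * (4 * b ^ 2 * ε⁻¹) := by gcongr
      _ = _ := by ring
  have h3 : N' ≤ 4 * b ^ 2 * (ζ⁻¹ ^ 3 * ε⁻¹ ^ 2) := by
    refine (hNN.trans hN2).trans (mul_le_mul_of_nonneg_left ?_ (by positivity))
    calc ε⁻¹ = 1 * ε⁻¹ := (one_mul _).symm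
      _ ≤ ζ⁻¹ ^ 3 * ε⁻¹ ^ 2 := by
        refine mul_le_mul hz ?_ (by positivity) (by positivity)
        rw [sq]; exact le_mul_of_one_le_left (by linarith) hi
  linarith

end LQR
end

/-! ### Conclusion: accuracy and sample count on one event. -/

theorem mainTheorem4 {n m : ℕ} (hn : 0 < n) (hm : 0 < m) (S : LQR n m)
    (hQ : S.Q.PosDef) (hR : S.R.PosDef) (hSigma0 : S.Sigma0.PosDef)
    (hCm : 0 < S.Cm) (hsigma : 0 < S.sigma)
    (hstab : IsStabilizable S.A S.B) (hA : IsUnit S.A)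
    (P : Matrix (Fin n) (Fin n) ℝ) (hP : S.IsARESolution P)
    (hQN : (S.QN - P).PosSemidef) (κ : ℝ) :
    ∃ C : ℝ, 0 < C ∧ ∀ ε : ℝ, 0 < ε → ε < 1 →
      ∀ (D : Measure (Fin n → ℝ)), S.IsInitialLaw D →
      ∀ (init : ℕ → (ℕ → Matrix (Fin m) (Fin n) ℝ) → Matrix (Fin m) (Fin n) ℝ),
        IsInitRule κ init →
      ∀ {Ω : Type*} [MeasurableSpace Ω] (Pr : Measure Ω) [IsProbabilityMeasure Pr]
        (z : ℕ → ℕ → Ω → (Fin n → ℝ) × (Fin m → ℝ)), IsSampleArray Pr D z →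
      (∀ ζ : ℝ, 0 < ζ → ζ < 1 →
        1 - S.horizon P ε * ζ ≤ Pr.real {ω |
          specNorm (S.output D (S.horizon P ε) ε ζ init (fun h t => z h t ω) - S.gain P) ≤ ε ∧
          (S.totalSamples D (S.horizon P ε) ε ζ init (fun h t => z h t ω) : ℝ)
            ≤ C * ζ⁻¹ ^ 3 * ε⁻¹ ^ 2}) ∧
      (∀ δ : ℝ, 0 < δ → δ < 1 →
        1 - δ ≤ Pr.real {ω |
          specNorm (S.output D (S.horizon P ε) ε (δ / S.horizon P ε) init
            (fun h t => z h t ω) - S.gain P) ≤ ε ∧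
          (S.totalSamples D (S.horizon P ε) ε (δ / S.horizon P ε) init
            (fun h t => z h t ω) : ℝ)
            ≤ C * δ⁻¹ ^ 3 * (1 + Real.log (1 / ε)) ^ 3 * ε⁻¹ ^ 2}) := by
  obtain ⟨b, hb, hbN⟩ := LQR.exists_horizon_le hn hm hQ hR hA hP
  obtain ⟨c, hc, hcb⟩ :=
    LQR.exists_totalSamples_le hm hn hQ hR hSigma0 hCm hP hQN κ hb
  -- The summand $c$ serves fixed $\zeta$; $cb^3$ serves $\zeta=\delta/N$, where
  -- $\zeta^{-3}=N^3\delta^{-3}$ and $N\le b(1+\log(1/\varepsilon))$.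
  refine ⟨c + c * b ^ 3, by positivity, fun ε hε hε1 D hD init hinit Ω _ Pr _ z hz => ?_⟩
  have hT := LQR.terminal_posSemidef hP hQN
  have hN1 := LQR.one_le_horizon (S := S) (P := P) ε
  have hNb := hbN ε hε hε1
  have hN1' : (1 : ℝ) ≤ S.horizon P ε := by exact_mod_cast hN1
  have hbase : ∀ ζ : ℝ, 0 < ζ → ζ < 1 → 1 - S.horizon P ε * ζ ≤ Pr.real {ω |
      specNorm (S.output D (S.horizon P ε) ε ζ init (fun h t => z h t ω) - S.gain P) ≤ ε ∧
      (S.totalSamples D (S.horizon P ε) ε ζ init (fun h t => z h t ω) : ℝ)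
        ≤ c * ζ⁻¹ ^ 3 * ε⁻¹ ^ 2} := fun ζ hζ hζ1 => by
    -- The event that all gains are accurate; the lower limit $N-N$ is $0$.
    set E : Set Ω := {ω | ∀ j, S.horizon P ε - S.horizon P ε ≤ j → j < S.horizon P ε →
      S.StageAccurate (S.horizon P ε) ε
        (S.table D (S.horizon P ε) ε ζ init (fun h t => z h t ω) (S.horizon P ε)) j} with hE
    have hEm : MeasurableSet E :=
      (LQR.measurable_table_of_le hD hQ hR hT ε ζ hinit le_rfl fun h _ _ t => hz.1 h t)
        (LQR.measurableSet_forall_stageAccurate _ ε _)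
    have hEc : Pr.real Eᶜ ≤ S.horizon P ε * ζ := by
      have h1 := LQR.measure_not_accurate_le hD hQ hR hSigma0 hn hm hT hsigma hε hζ
        (fun h hh => LQR.tol_pos hm hn hQ hR hA hP hQN hε hh) hinit hz
        (le_refl (S.horizon P ε))
      have h2 := ENNReal.toReal_mono (by finiteness) h1
      rwa [ENNReal.toReal_mul, ENNReal.toReal_natCast, ENNReal.toReal_ofReal hζ.le] at h2
    have hcompl := probReal_add_probReal_compl (μ := Pr) hEm
    -- On $E$ both conclusions hold deterministically, so the event of the theorem need not be shown
    -- to be measurable.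
    refine le_trans (by linarith) (measureReal_mono (s₁ := E) fun ω hω => ?_)
    have hacc := fun j hj => hω j (by omega) hj
    exact ⟨LQR.specNorm_sub_gain_le_of_stageAccurate hm hn hQ hR hA hP hQN hε hacc,
      hcb _ ε ζ D init _ hε hε1 hζ hζ1 hD hinit hN1 hNb hacc⟩
  refine ⟨fun ζ hζ hζ1 => (hbase ζ hζ hζ1).trans (measureReal_mono fun ω hω => ⟨hω.1, ?_⟩),
    fun δ hδ hδ1 => ?_⟩
  · refine hω.2.trans ?_
    have : 0 ≤ c * b ^ 3 := by positivity
    gcongr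
    linarith
  · have h1 := hbase (δ / S.horizon P ε) (by positivity)
      ((div_le_self hδ.le hN1').trans_lt hδ1)
    rw [mul_div_cancel₀ _ (by positivity)] at h1
    refine h1.trans (measureReal_mono fun ω hω => ⟨hω.1, hω.2.trans ?_⟩)
    have hl : 0 ≤ 1 + Real.log (1 / ε) := by
      have := Real.log_nonneg ((one_le_div hε).2 hε1.le)
      linarith
    calc c * (δ / S.horizon P ε)⁻¹ ^ 3 * ε⁻¹ ^ 2
        = c * (S.horizon P ε : ℝ) ^ 3 * δ⁻¹ ^ 3 * ε⁻¹ ^ 2 := by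
          rw [inv_div, div_eq_mul_inv]; ring
      _ ≤ c * (b * (1 + Real.log (1 / ε))) ^ 3 * δ⁻¹ ^ 3 * ε⁻¹ ^ 2 := by gcongr
      _ = c * b ^ 3 * δ⁻¹ ^ 3 * (1 + Real.log (1 / ε)) ^ 3 * ε⁻¹ ^ 2 := by ring
      _ ≤ _ := by gcongr; linarith
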